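/- Let $h\in\mathbb C$ be such that $q=e^h$ is not a root of unity; put $q^a=e^{ha}$, $[a]=\frac{q^a-q^{-a}}{q-q^{-1}}$, $[a]_+=\frac{q^a+q^{-a}}{q-q^{-1}}$. Let $n\ge 2$. The algebra $U'_q({\rm so}_n)$ is the associative unital $\mathbb C$-algebra generated by $I_{i,i-1}$, $i=2,\dots,n$, with the defining relations $$I_{i+1,i}I_{i,i-1}^2-(q+q^{-1})I_{i,i-1}I_{i+1,i}I_{i,i-1}+I_{i,i-1}^2I_{i+1,i}=-I_{i+1,i},\quad(1)$$ $$I_{i+1,i}^2I_{i,i-1}-(q+q^{-1})I_{i+1,i}I_{i,i-1}I_{i+1,i}+I_{i,i-1}I_{i+1,i}^2=-I_{i,i-1},\quad(2)$$ $$[I_{i,i-1},I_{j,j-1}]=0,\quad |i-j|>1.\quad(3)$$ Let $\epsilon=(\epsilon_2,\dots,\epsilon_n)$, $\epsilon_i=\pm1$, and let ${\bf m}_n=(m_{1,n},\dots,m_{\lfloor n/2\rfloor,n})$ consist of half-integral numbers (elements of $\mathbb Z+\frac12$) with $m_{1,n}\ge m_{2,n}\ge\dots\ge m_{\lfloor n/2\rfloor,n}\ge\frac12$.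 Consider tableaux $\xi_n=({\bf m}_n,{\bf m}_{n-1},\dots,{\bf m}_2)$ with top row ${\bf m}_n$ and rows ${\bf m}_k=(m_{1,k},\dots,m_{\lfloor k/2\rfloor,k})$ of half-integral numbers such that, for all rows involved, $$m_{1,2p+1}\ge m_{1,2p}\ge m_{2,2p+1}\ge m_{2,2p}\ge\dots\ge m_{p,2p+1}\ge m_{p,2p}\ge\tfrac12,$$ $$m_{1,2p}\ge m_{1,2p-1}\ge m_{2,2p}\ge m_{2,2p-1}\ge\dots\ge m_{p-1,2p-1}\ge m_{p,2p}.$$ Let $V$ be the complex vector space with basis $|\xi_n\rangle$ indexed by these tableaux. Put $l_{j,2p+1}=m_{j,2p+1}+p-j+1$, $l_{j,2p}=m_{j,2p}+p-j$, and let $(\xi_n)^{\pm j}_k$ be $\xi_n$ with $m_{j,k}$ replaced by $m_{j,k}\pm1$; the terms in which this is not a tableau are omitted. Define operators on $V$ by $$T(I_{2p+1,2p})|\xi_n\rangle=\delta_{m_{p,2p},1/2}\frac{\epsilon_{2p+1}}{q^{1/2}-q^{-1/2}}D_{2p}(\xi_n)|\xi_n\rangle+\sum_{j=1}^p\frac{A^j_{2p}(\xi_n)}{q^{l_{j,2p}}-q^{-l_{j,2p}}}|(\xi_n)^{+j}_{2p}\rangle-\sum_{j=1}^p\frac{A^j_{2p}((\xi_n)^{-j}_{2p})}{q^{l_{j,2p}}-q^{-l_{j,2p}}}|(\xi_n)^{-j}_{2p}\rangle,$$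 $$T(I_{2p,2p-1})|\xi_n\rangle=\sum_{j=1}^{p-1}\frac{B^j_{2p-1}(\xi_n)}{[2l_{j,2p-1}-1][l_{j,2p-1}]_+}|(\xi_n)^{+j}_{2p-1}\rangle-\sum_{j=1}^{p-1}\frac{B^j_{2p-1}((\xi_n)^{-j}_{2p-1})}{[2l_{j,2p-1}-1][l_{j,2p-1}-1]_+}|(\xi_n)^{-j}_{2p-1}\rangle+\epsilon_{2p}\hat C_{2p-1}(\xi_n)|\xi_n\rangle,$$ where $$A^j_{2p}=\left(\frac{\prod_{i=1}^p[l_{i,2p+1}+l_{j,2p}][l_{i,2p+1}-l_{j,2p}-1]\prod_{i=1}^{p-1}[l_{i,2p-1}+l_{j,2p}][l_{i,2p-1}-l_{j,2p}-1]}{\prod_{i\ne j}^p[l_{i,2p}+l_{j,2p}][l_{i,2p}-l_{j,2p}][l_{i,2p}+l_{j,2p}+1][l_{i,2p}-l_{j,2p}-1]}\right)^{1/2},$$ $$B^j_{2p-1}=\left(\frac{\prod_{i=1}^p[l_{i,2p}+l_{j,2p-1}][l_{i,2p}-l_{j,2p-1}]\prod_{i=1}^{p-1}[l_{i,2p-2}+l_{j,2p-1}][l_{i,2p-2}-l_{j,2p-1}]}{\prod_{i\ne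 j}^{p-1}[l_{i,2p-1}+l_{j,2p-1}][l_{i,2p-1}-l_{j,2p-1}][l_{i,2p-1}+l_{j,2p-1}-1][l_{i,2p-1}-l_{j,2p-1}-1]}\right)^{1/2},$$ $$\hat C_{2p-1}=\frac{\prod_{s=1}^p[l_{s,2p}]_+\prod_{s=1}^{p-1}[l_{s,2p-2}]_+}{\prod_{s=1}^{p-1}[l_{s,2p-1}]_+[l_{s,2p-1}-1]_+},\qquad D_{2p}=\frac{\prod_{i=1}^p[l_{i,2p+1}-\frac12]\prod_{i=1}^{p-1}[l_{i,2p-1}-\frac12]}{\prod_{i=1}^{p-1}[l_{i,2p}+\frac12][l_{i,2p}-\frac12]}.$$ The square roots are understood as follows: for every $a\ge0$ a square root $[a]^{1/2}$ of $[a]$ is fixed (arbitrarily), and the root of the quotient is formed by replacing every factor $[a]$ by $[\,|a|\,]^{1/2}$. (For $q>0$ and nonnegative roots $[a]^{1/2}$ this is the usual nonnegative square root.) Then the following hold. (a) The numbers $A^j_{2p}$ and $B^j_{2p-1}$ so defined are square roots of the displayed quotients whenever $\xi_n$ and the tableau raised at the corresponding entry are both admissible (also for the tableaux in (c)). (b)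 $V$ is nonzero and finite-dimensional, and the operators $T(I_{k,k-1})$, $k=2,\dots,n$, satisfy (1)–(3). Hence they define a unique representation $T_{\epsilon,{\bf m}_n}$ of $U'_q({\rm so}_n)$ on $V$. (c) Let $V'$ have as basis the half-integral tableaux with the same top row ${\bf m}_n$ that satisfy the weaker conditions $m_{1,2p+1}\ge m_{1,2p}\ge\dots\ge m_{p,2p+1}\ge m_{p,2p}\ge-m_{p,2p+1}$ and $m_{1,2p}\ge m_{1,2p-1}\ge\dots\ge m_{p-1,2p-1}\ge|m_{p,2p}|$, and let $T'(I_{k,k-1})$ be given on $V'$ by the same formulas without the $\delta$-term. These operators satisfy (1)–(3) and define a unique finite-dimensional representation $T'_{{\bf m}_n}$ of $U'_q({\rm so}_n)$ (depending on $\epsilon_2,\epsilon_4,\dots$), which is reducible if $n\ge3$. (d) For every choice of signs $\epsilon_{2p+1}$, $1\le p\le\lfloor(n-1)/2\rfloor$, let ${\cal H}_\epsilon\subset V'$ be the span of the vectors $|\xi_n\rangle_\epsilon$ that are obtained from the tableaux $\xi_n$ of $V$ by performing $|\xi_n\rangle\mapsto|\xi_n\rangle-\epsilon_{2p+1}|\xi_n'\rangle$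 for all these $p$, where $\xi_n'$ is $\xi_n$ with $m_{p,2p}$ replaced by $-m_{p,2p}$. Then $V'$ is the direct sum of these $2^{\lfloor(n-1)/2\rfloor}$ subspaces; they are invariant under $T'$; and $|\xi_n\rangle\mapsto|\xi_n\rangle_\epsilon$ is a linear isomorphism $V\to{\cal H}_\epsilon$ that intertwines $T_{\epsilon,{\bf m}_n}$ with the restriction of $T'_{{\bf m}_n}$ to ${\cal H}_\epsilon$. -/

import Mathlib

noncomputable section

namespace QSo

/-! ### The algebra `U'_q(so_n)` -/

/-- The relations (for all admissible indices `i`, writing `I_i` for `I_{i,i-1}`)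
`I_{i+1} I_i² - (q+q⁻¹) I_i I_{i+1} I_i + I_i² I_{i+1} = -I_{i+1}`,
`I_{i+1}² I_i - (q+q⁻¹) I_{i+1} I_i I_{i+1} + I_i I_{i+1}² = -I_i`,
`[I_i, I_j] = 0` for `|i-j| > 1`,
for a family `X i = I_{i,i-1}`, `2 ≤ i ≤ n`, of elements of an associative algebra. -/
structure SatisfiesRelations (q : ℂ) (n : ℕ) {A : Type*} [Ring A] [Algebra ℂ A]
    (X : Set.Icc 2 n → A) : Prop where
  cubic_left : ∀ i j : Set.Icc 2 n, (j : ℕ) = i + 1 →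
    X j * X i ^ 2 - (q + q⁻¹) • (X i * X j * X i) + X i ^ 2 * X j = -X j
  cubic_right : ∀ i j : Set.Icc 2 n, (j : ℕ) = i + 1 →
    X j ^ 2 * X i - (q + q⁻¹) • (X j * X i * X j) + X i * X j ^ 2 = -X i
  comm : ∀ i j : Set.Icc 2 n, 1 < |((i : ℕ) : ℤ) - ((j : ℕ) : ℤ)| →
    X i * X j - X j * X i = 0

/-- The same relations, as a relation on the free algebra on the symbols `I_{i,i-1}`. -/
inductive UqRel (q : ℂ) (n : ℕ) :
    FreeAlgebra ℂ (Set.Icc 2 n) → FreeAlgebra ℂ (Set.Icc 2 n) → Prop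
  | cubic_left (i j : Set.Icc 2 n) (hij : (j : ℕ) = i + 1) : UqRel q n
      (FreeAlgebra.ι ℂ j * FreeAlgebra.ι ℂ i ^ 2
        - (q + q⁻¹) • (FreeAlgebra.ι ℂ i * FreeAlgebra.ι ℂ j * FreeAlgebra.ι ℂ i)
        + FreeAlgebra.ι ℂ i ^ 2 * FreeAlgebra.ι ℂ j)
      (-FreeAlgebra.ι ℂ j)
  | cubic_right (i j : Set.Icc 2 n) (hij : (j : ℕ) = i + 1) : UqRel q n
      (FreeAlgebra.ι ℂ j ^ 2 * FreeAlgebra.ι ℂ i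
        - (q + q⁻¹) • (FreeAlgebra.ι ℂ j * FreeAlgebra.ι ℂ i * FreeAlgebra.ι ℂ j)
        + FreeAlgebra.ι ℂ i * FreeAlgebra.ι ℂ j ^ 2)
      (-FreeAlgebra.ι ℂ i)
  | comm (i j : Set.Icc 2 n) (hij : 1 < |((i : ℕ) : ℤ) - ((j : ℕ) : ℤ)|) : UqRel q n
      (FreeAlgebra.ι ℂ i * FreeAlgebra.ι ℂ j - FreeAlgebra.ι ℂ j * FreeAlgebra.ι ℂ i) 0

/-- The associative unital algebra `U'_q(so_n)`, by generators and relations. -/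
abbrev Uq (q : ℂ) (n : ℕ) : Type := RingQuot (UqRel q n)

/-- The generator `I_{i,i-1}` of `U'_q(so_n)`. -/
def Uq.gen (q : ℂ) (n : ℕ) (i : Set.Icc 2 n) : Uq q n :=
  RingQuot.mkAlgHom ℂ (UqRel q n) (FreeAlgebra.ι ℂ i)

/-! ### `q`-numbers, where `q = e^h` -/

/-- `q^a = e^{ha}`. -/
def qPow (h : ℂ) (a : ℚ) : ℂ := Complex.exp (h * (a : ℂ))

/-- `[a] = (q^a - q^{-a}) / (q - q^{-1})`. -/
def qNum (h : ℂ) (a : ℚ) : ℂ := (qPow h a - qPow h (-a)) / (qPow h 1 - qPow h (-1))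

/-- `[a]_+ = (q^a + q^{-a}) / (q - q^{-1})`. -/
def qNumPlus (h : ℂ) (a : ℚ) : ℂ := (qPow h a + qPow h (-a)) / (qPow h 1 - qPow h (-1))

/-! ### Tableaux

An array is a function `ξ`, where `ξ k j` stands for the entry `m_{j,k}` (the `j`-th entry of the
row `𝐦_k`), `2 ≤ k ≤ n`, `1 ≤ j ≤ ⌊k/2⌋`; all the other values of `ξ` are required to be `0`. -/

def IsHalfIntegral (x : ℚ) : Prop := ∃ z : ℤ, x = z + 1 / 2

/-- `𝐦_n = (m_1, …, m_{⌊n/2⌋})` is half-integral and `m_1 ≥ m_2 ≥ … ≥ m_{⌊n/2⌋} ≥ 1/2`. -/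
structure IsDominant (n : ℕ) (m : ℕ → ℚ) : Prop where
  half : ∀ j, 1 ≤ j → j ≤ n / 2 → IsHalfIntegral (m j)
  anti : ∀ j, 1 ≤ j → j < n / 2 → m (j + 1) ≤ m j
  last : 1 / 2 ≤ m (n / 2)

/-- Half-integral arrays of the triangular shape with top row `m`. -/
structure IsArray (n : ℕ) (m : ℕ → ℚ) (ξ : ℕ → ℕ → ℚ) : Prop where
  zero : ∀ k j, ¬(2 ≤ k ∧ k ≤ n ∧ 1 ≤ j ∧ j ≤ k / 2) → ξ k j = 0
  top : ∀ j, 1 ≤ j → j ≤ n / 2 → ξ n j = m j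
  half : ∀ k j, 2 ≤ k → k ≤ n → 1 ≤ j → j ≤ k / 2 → IsHalfIntegral (ξ k j)

/-- Tableaux of the nonclassical type: the betweenness conditions are
`m_{1,2p+1} ≥ m_{1,2p} ≥ m_{2,2p+1} ≥ m_{2,2p} ≥ … ≥ m_{p,2p+1} ≥ m_{p,2p} ≥ 1/2` and
`m_{1,2p} ≥ m_{1,2p-1} ≥ m_{2,2p} ≥ m_{2,2p-1} ≥ … ≥ m_{p-1,2p-1} ≥ m_{p,2p}`. -/
structure IsTableau (n : ℕ) (m : ℕ → ℚ) (ξ : ℕ → ℕ → ℚ) : Prop extends IsArray n m ξ where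
  odd_upper : ∀ p j, 2 * p + 1 ≤ n → 1 ≤ j → j ≤ p → ξ (2 * p) j ≤ ξ (2 * p + 1) j
  odd_lower : ∀ p j, 2 * p + 1 ≤ n → 1 ≤ j → j < p → ξ (2 * p + 1) (j + 1) ≤ ξ (2 * p) j
  odd_last : ∀ p, 1 ≤ p → 2 * p + 1 ≤ n → 1 / 2 ≤ ξ (2 * p) p
  even_upper : ∀ p j, 2 * p ≤ n → 1 ≤ j → j < p → ξ (2 * p - 1) j ≤ ξ (2 * p) j
  even_lower : ∀ p j, 2 * p ≤ n → 1 ≤ j → j < p → ξ (2 * p) (j + 1) ≤ ξ (2 * p - 1) j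

/-- (Half-integral) Gel'fand--Tsetlin tableaux of the classical type: the betweenness conditions are
`m_{1,2p+1} ≥ m_{1,2p} ≥ m_{2,2p+1} ≥ m_{2,2p} ≥ … ≥ m_{p,2p+1} ≥ m_{p,2p} ≥ -m_{p,2p+1}` and
`m_{1,2p} ≥ m_{1,2p-1} ≥ m_{2,2p} ≥ m_{2,2p-1} ≥ … ≥ m_{p-1,2p-1} ≥ |m_{p,2p}|`. -/
structure IsClassicalTableau (n : ℕ) (m : ℕ → ℚ) (ξ : ℕ → ℕ → ℚ) : Prop
    extends IsArray n m ξ where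
  odd_upper : ∀ p j, 2 * p + 1 ≤ n → 1 ≤ j → j ≤ p → ξ (2 * p) j ≤ ξ (2 * p + 1) j
  odd_lower : ∀ p j, 2 * p + 1 ≤ n → 1 ≤ j → j < p → ξ (2 * p + 1) (j + 1) ≤ ξ (2 * p) j
  odd_last : ∀ p, 1 ≤ p → 2 * p + 1 ≤ n → -ξ (2 * p + 1) p ≤ ξ (2 * p) p
  even_upper : ∀ p j, 2 * p ≤ n → 1 ≤ j → j < p → ξ (2 * p - 1) j ≤ ξ (2 * p) j
  even_lower : ∀ p j, 2 * p ≤ n → 1 ≤ j → j + 1 < p → ξ (2 * p) (j + 1) ≤ ξ (2 * p - 1) j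
  even_last : ∀ p, 2 ≤ p → 2 * p ≤ n → |ξ (2 * p) p| ≤ ξ (2 * p - 1) (p - 1)

/-- `(ξ)^{±j}_k`: the entry `m_{j,k}` is replaced by `m_{j,k} + s` (used with `s = ±1`). -/
def shift (ξ : ℕ → ℕ → ℚ) (k j : ℕ) (s : ℚ) : ℕ → ℕ → ℚ :=
  Function.update ξ k (Function.update (ξ k) j (ξ k j + s))

/-- The `l`-coordinates `l_{j,2p+1} = m_{j,2p+1} + p - j + 1`, `l_{j,2p} = m_{j,2p} + p - j`. -/
def lc (ξ : ℕ → ℕ → ℚ) (j k : ℕ) : ℚ :=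
  if Odd k then ξ k j + ((k / 2 : ℕ) : ℚ) - j + 1 else ξ k j + ((k / 2 : ℕ) : ℚ) - j

/-- The vector space with basis the arrays that satisfy `P`. -/
abbrev TabSpace (P : (ℕ → ℕ → ℚ) → Prop) : Type := {ξ : ℕ → ℕ → ℚ // P ξ} →₀ ℂ

open Classical in
/-- The basis vector `|ξ⟩`; an array that is not a tableau contributes nothing. -/
def ket (P : (ℕ → ℕ → ℚ) → Prop) (ξ : ℕ → ℕ → ℚ) : TabSpace P :=
  if hξ : P ξ then Finsupp.single ⟨ξ, hξ⟩ 1 else 0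

/-! ### The coefficients -/

/-- With `f a = [a]` this is the expression under the square root in `A^j_{2p}(ξ)`. -/
def exprA (f : ℚ → ℂ) (p j : ℕ) (ξ : ℕ → ℕ → ℚ) : ℂ :=
  ((∏ i ∈ Finset.Icc 1 p,
      f (lc ξ i (2 * p + 1) + lc ξ j (2 * p)) * f (lc ξ i (2 * p + 1) - lc ξ j (2 * p) - 1)) *
    ∏ i ∈ Finset.Icc 1 (p - 1),
      f (lc ξ i (2 * p - 1) + lc ξ j (2 * p)) * f (lc ξ i (2 * p - 1) - lc ξ j (2 * p) - 1)) /
  ∏ i ∈ (Finset.Icc 1 p).erase j,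
    f (lc ξ i (2 * p) + lc ξ j (2 * p)) * f (lc ξ i (2 * p) - lc ξ j (2 * p)) *
      f (lc ξ i (2 * p) + lc ξ j (2 * p) + 1) * f (lc ξ i (2 * p) - lc ξ j (2 * p) - 1)

/-- With `f a = [a]` this is the expression under the square root in `B^j_{2p-1}(ξ)`. -/
def exprB (f : ℚ → ℂ) (p j : ℕ) (ξ : ℕ → ℕ → ℚ) : ℂ :=
  ((∏ i ∈ Finset.Icc 1 p,
      f (lc ξ i (2 * p) + lc ξ j (2 * p - 1)) * f (lc ξ i (2 * p) - lc ξ j (2 * p - 1))) *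
    ∏ i ∈ Finset.Icc 1 (p - 1),
      f (lc ξ i (2 * p - 2) + lc ξ j (2 * p - 1)) * f (lc ξ i (2 * p - 2) - lc ξ j (2 * p - 1))) /
  ∏ i ∈ (Finset.Icc 1 (p - 1)).erase j,
    f (lc ξ i (2 * p - 1) + lc ξ j (2 * p - 1)) * f (lc ξ i (2 * p - 1) - lc ξ j (2 * p - 1)) *
      f (lc ξ i (2 * p - 1) + lc ξ j (2 * p - 1) - 1) *
      f (lc ξ i (2 * p - 1) - lc ξ j (2 * p - 1) - 1)

/-- `A^j_{2p}(ξ)`. Here `r a` is a chosen square root of `[a]` for `a ≥ 0`. The number of negative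
arguments under the root is even, so the root is taken with `[|a|]` in place of `[a]`. -/
def coefA (r : ℚ → ℂ) (p j : ℕ) (ξ : ℕ → ℕ → ℚ) : ℂ := exprA (fun a => r |a|) p j ξ

/-- `B^j_{2p-1}(ξ)`, with the same convention on the square root. -/
def coefB (r : ℚ → ℂ) (p j : ℕ) (ξ : ℕ → ℕ → ℚ) : ℂ := exprB (fun a => r |a|) p j ξ

/-- `Ĉ_{2p-1}(ξ)`. -/
def coefC (h : ℂ) (p : ℕ) (ξ : ℕ → ℕ → ℚ) : ℂ :=
  ((∏ s ∈ Finset.Icc 1 p, qNumPlus h (lc ξ s (2 * p))) *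
    ∏ s ∈ Finset.Icc 1 (p - 1), qNumPlus h (lc ξ s (2 * p - 2))) /
  ∏ s ∈ Finset.Icc 1 (p - 1),
    qNumPlus h (lc ξ s (2 * p - 1)) * qNumPlus h (lc ξ s (2 * p - 1) - 1)

/-- `D_{2p}(ξ)`. -/
def coefD (h : ℂ) (p : ℕ) (ξ : ℕ → ℕ → ℚ) : ℂ :=
  ((∏ i ∈ Finset.Icc 1 p, qNum h (lc ξ i (2 * p + 1) - 1 / 2)) *
    ∏ i ∈ Finset.Icc 1 (p - 1), qNum h (lc ξ i (2 * p - 1) - 1 / 2)) /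
  ∏ i ∈ Finset.Icc 1 (p - 1),
    qNum h (lc ξ i (2 * p) + 1 / 2) * qNum h (lc ξ i (2 * p) - 1 / 2)

/-! ### The operators -/

/-- A sign `±1` as a complex number. -/
def sgn (e : ℤˣ) : ℂ := ((e : ℤ) : ℂ)

/-- `∑_j A^j_{2p}(ξ)/(q^l - q^{-l}) |ξ^{+j}_{2p}⟩ - ∑_j A^j_{2p}(ξ^{-j}_{2p})/(q^l - q^{-l}) |ξ^{-j}_{2p}⟩`
with `l = l_{j,2p}`. On tableaux of the nonclassical type with `m_{p,2p} = 1/2` the summand `j = p`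
of the second sum is absent, because `ξ^{-p}_{2p}` is then not a tableau. -/
def oddPart (P : (ℕ → ℕ → ℚ) → Prop) (h : ℂ) (r : ℚ → ℂ) (p : ℕ) (ξ : ℕ → ℕ → ℚ) : TabSpace P :=
  (∑ j ∈ Finset.Icc 1 p,
    (coefA r p j ξ / (qPow h (lc ξ j (2 * p)) - qPow h (-lc ξ j (2 * p)))) •
      ket P (shift ξ (2 * p) j 1)) -
  ∑ j ∈ Finset.Icc 1 p,
    (coefA r p j (shift ξ (2 * p) j (-1)) /
      (qPow h (lc ξ j (2 * p)) - qPow h (-lc ξ j (2 * p)))) •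
      ket P (shift ξ (2 * p) j (-1))

/-- `∑_j B^j_{2p-1}(ξ)/([2l-1][l]_+) |ξ^{+j}_{2p-1}⟩
- ∑_j B^j_{2p-1}(ξ^{-j}_{2p-1})/([2l-1][l-1]_+) |ξ^{-j}_{2p-1}⟩ + ε_{2p} Ĉ_{2p-1}(ξ) |ξ⟩`
with `l = l_{j,2p-1}`. -/
def evenPart (P : (ℕ → ℕ → ℚ) → Prop) (h : ℂ) (r : ℚ → ℂ) (ε : ℕ → ℤˣ) (p : ℕ)
    (ξ : ℕ → ℕ → ℚ) : TabSpace P :=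
  (∑ j ∈ Finset.Icc 1 (p - 1),
    (coefB r p j ξ /
      (qNum h (2 * lc ξ j (2 * p - 1) - 1) * qNumPlus h (lc ξ j (2 * p - 1)))) •
      ket P (shift ξ (2 * p - 1) j 1)) -
  (∑ j ∈ Finset.Icc 1 (p - 1),
    (coefB r p j (shift ξ (2 * p - 1) j (-1)) /
      (qNum h (2 * lc ξ j (2 * p - 1) - 1) * qNumPlus h (lc ξ j (2 * p - 1) - 1))) •
      ket P (shift ξ (2 * p - 1) j (-1))) +
  (sgn (ε (2 * p)) * coefC h p ξ) • ket P ξ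

/-- The operator `T_{ε,𝐦_n}(I_{k,k-1})`. -/
def opT (h : ℂ) (r : ℚ → ℂ) (n : ℕ) (m : ℕ → ℚ) (ε : ℕ → ℤˣ) (k : ℕ) :
    Module.End ℂ (TabSpace (IsTableau n m)) :=
  Finsupp.linearCombination ℂ fun ξ : {ξ : ℕ → ℕ → ℚ // IsTableau n m ξ} =>
    if Odd k then
      (if ξ.1 (k - 1) (k / 2) = 1 / 2 then
        sgn (ε k) / (qPow h (1 / 2) - qPow h (-(1 / 2))) * coefD h (k / 2) ξ.1 else 0) •
          ket (IsTableau n m) ξ.1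
        + oddPart (IsTableau n m) h r (k / 2) ξ.1
    else evenPart (IsTableau n m) h r ε (k / 2) ξ.1

/-- The operator `T'_{𝐦_n}(I_{k,k-1})`, on the tableaux of the classical type. -/
def opT' (h : ℂ) (r : ℚ → ℂ) (n : ℕ) (m : ℕ → ℚ) (ε : ℕ → ℤˣ) (k : ℕ) :
    Module.End ℂ (TabSpace (IsClassicalTableau n m)) :=
  Finsupp.linearCombination ℂ fun ξ : {ξ : ℕ → ℕ → ℚ // IsClassicalTableau n m ξ} =>
    if Odd k then oddPart (IsClassicalTableau n m) h r (k / 2) ξ.1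
    else evenPart (IsClassicalTableau n m) h r ε (k / 2) ξ.1

/-! ### The splitting of `T'` -/

/-- The entries `m_{p,2p}` with `p ∈ S` are replaced by `-m_{p,2p}`. -/
def flip (S : Finset ℕ) (ξ : ℕ → ℕ → ℚ) : ℕ → ℕ → ℚ := fun k j =>
  if Even k ∧ k / 2 ∈ S ∧ j = k / 2 then -ξ k j else ξ k j

/-- The linear map that sends `|ξ⟩` to the vector obtained by applying, for every
`p = 1, …, ⌊(n-1)/2⌋`, the operation `|ξ⟩ ↦ |ξ⟩ - ε_{2p+1} |ξ'⟩`, where `ξ'` is `ξ` with `m_{p,2p}`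
replaced by `-m_{p,2p}`. Its range is the span of these vectors. -/
def splitMap (n : ℕ) (m : ℕ → ℚ) (ε : ℕ → ℤˣ) :
    TabSpace (IsTableau n m) →ₗ[ℂ] TabSpace (IsClassicalTableau n m) :=
  Finsupp.linearCombination ℂ fun ξ : {ξ : ℕ → ℕ → ℚ // IsTableau n m ξ} =>
    ∑ S ∈ (Finset.Icc 1 ((n - 1) / 2)).powerset,
      (∏ p ∈ S, -sgn (ε (2 * p + 1))) • ket (IsClassicalTableau n m) (flip S ξ.1)

/-- The signs `ε`, with `ε_{2p+1}` replaced by `σ_p` for `p = 1, …, ⌊(n-1)/2⌋`. -/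
def withOdd (n : ℕ) (ε : ℕ → ℤˣ) (σ : Finset.Icc 1 ((n - 1) / 2) → ℤˣ) : ℕ → ℤˣ := fun k =>
  if hk : Odd k ∧ k / 2 ∈ Finset.Icc 1 ((n - 1) / 2) then σ ⟨k / 2, hk.2⟩ else ε k

end QSo

end

/-!
Everything is done for the classical tableaux first. In the centred coordinates `m_{j,k} + k/2 - j`
(`ctr`) the roots in the formulas for odd and even rows agree (`exprA_eq_rt`, `exprB_eq_rt`), and
the operator that acts on row `k` becomes a sum over moves (`opT'_ket`): a move raises or lowers one
entry of the row, and the diagonal term of an odd row counts as one further move. A move has a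
multiplicative coordinate `tt`, which is `q` to the power of its signed centred coordinate; the
diagonal term behaves as if its coordinate were `i q^{-1/2}`. The coefficient `cf` of a move is set
to zero unless both its ends are classical tableaux, so that every relation becomes a statement
about sums over paths.

Operators on rows that are not adjacent commute because their coefficients do not see each other
(`opT'_comm`). In the cubic relation for adjacent rows (`cubic_of_paths`), a path consists of two
moves `x`, `y` in one row and a move `z` in the other, in any order.

* If `x` and `y` are not opposite, the paths along `x`, `y`, `z` cancel (`sum_paths_eq_zero`). When
  two moves are interchanged, the product of their coefficients changes by an explicit ratio of
  `q`-numbers (`cf_exchange`, `cf_exchange_same_row`), and then the claim is an identity between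
  Laurent polynomials in the coordinates (`hexagon`, or `double_move` if `x = y`). The exchange
  relations remain true when only one of the two orders passes through tableaux, because the
  product for that order is then multiplied by the `q`-number `[0]`.
* If `x` and `y` are opposite, the tableau at the end does not depend on `x`, and the sum over `x`
  gives the right-hand side of the relation (`sum_opposite_paths`). The products of coefficients are
  the terms of Lagrange's formula for the leading coefficient of a polynomial whose zeros are given
  by the entries of the adjacent rows, with one node for each move. Two nodes may coincide, but then
  the polynomial has a double zero there and neither of the two moves leads to a tableau, so that
  the terms may be omitted (`sum_prod_div_prod_eq_one`, `node_eq_node`).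

The chosen roots square to the expressions under the root signs because an even number of factors
is negative, by the interlacing of the rows (`rt_abs_sq`).

The sign changes of the last entries of the even rows form an elementary abelian 2-group that acts
on `V'` and commutes with the operators (`opT'_mul_flipOp`). The spaces `ℋ_ε` are the isotypic
parts for its characters (`chi`, `isInternal_range_splitMap`). On such a part the move from `1/2` to
`-1/2` becomes diagonal and yields the term with the factor `D_{2p}` (`opT'_comp_splitMap`). Hence
the operators on `V` are restrictions of those on `V'` and inherit the relations from them
(`SatisfiesRelations.of_injective`), and each of the at least two summands is a proper invariant
subspace if `n ≥ 3`.
-/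

namespace QSo

open Finset

/-! ### Interpolation with coinciding nodes -/

/-- The leading coefficient of a monic polynomial of degree `#s - 1`, read off from its values at
the nodes `z`. Coinciding nodes are allowed as long as they come in pairs and each such pair is a
double zero of the polynomial; the terms at these nodes are `0 / 0 = 0`, which is the correct
limiting value. -/
lemma sum_prod_div_prod_eq_one {ι υ : Type*} [DecidableEq ι] [DecidableEq υ] (z : ι → ℂ)
    (w : υ → ℂ) (s : Finset ι) (U : Finset υ) (hcard : #U + 1 = #s)
    (H : ∀ i ∈ s, ∀ j ∈ s, i ≠ j → z i = z j →
      (∀ k ∈ s, z k = z i → k = i ∨ k = j) ∧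
        ∃ u ∈ U, ∃ v ∈ U, u ≠ v ∧ w u = z i ∧ w v = z i) :
    ∑ i ∈ s, (∏ u ∈ U, (z i - w u)) / ∏ j ∈ s.erase i, (z i - z j) = 1 := by
  induction hn : #s using Nat.strong_induction_on generalizing s U with
  | _ N ih =>
  by_cases hinj : Set.InjOn z s
  · have hdeg : (Lagrange.nodal U w).degree = (#U : ℕ) := Lagrange.degree_nodal
    have := Lagrange.leadingCoeff_eq_sum (s := s) (v := z) hinj (P := Lagrange.nodal U w)
      (by rw [hdeg, ← hcard]; push_cast; rfl)
    rw [Lagrange.nodal_monic.leadingCoeff] at this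
    rw [this]
    simp [Lagrange.eval_nodal]
  · -- remove a pair of equal nodes together with the double zero; this changes no other term
    simp only [Set.InjOn, not_forall] at hinj
    obtain ⟨i, hi, j, hj, hz, hne⟩ := hinj
    obtain ⟨h3, u, hu, v, hv, huv, hwu, hwv⟩ := H i hi j hj hne hz
    have hjs : j ∈ s.erase i := mem_erase.2 ⟨Ne.symm hne, hj⟩
    have hvU : v ∈ U.erase u := mem_erase.2 ⟨Ne.symm huv, hv⟩
    have c1 := card_erase_of_mem hjs
    have c2 := card_erase_of_mem hi
    have c3 := card_erase_of_mem hvU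
    have c4 := card_erase_of_mem hu
    have p1 : 0 < #(s.erase i) := card_pos.2 ⟨j, hjs⟩
    have p2 : 0 < #(U.erase u) := card_pos.2 ⟨v, hvU⟩
    have key := ih (#((s.erase i).erase j)) (by omega) ((s.erase i).erase j) ((U.erase u).erase v)
      (by omega) ?_ rfl
    · rw [← add_sum_erase _ _ hi, ← add_sum_erase _ _ hjs, prod_eq_zero hu (by rw [hwu, sub_self]),
        prod_eq_zero hu (by rw [hwu, hz, sub_self]), zero_div, zero_div, zero_add, zero_add, ← key]
      refine sum_congr rfl fun k hk => ?_
      have hkj := ne_of_mem_erase hk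
      have hki := ne_of_mem_erase (mem_of_mem_erase hk)
      have hks := mem_of_mem_erase (mem_of_mem_erase hk)
      have hzk : z k - z i ≠ 0 := fun h0 => by
        rcases h3 k hks (sub_eq_zero.1 h0) with h | h
        exacts [hki h, hkj h]
      rw [← mul_prod_erase U _ hu, ← mul_prod_erase _ _ hvU,
        ← mul_prod_erase (s.erase k) _ (mem_erase.2 ⟨Ne.symm hki, hi⟩),
        ← mul_prod_erase ((s.erase k).erase i) _
          (mem_erase.2 ⟨Ne.symm hne, mem_erase.2 ⟨Ne.symm hkj, hj⟩⟩), hwu, hwv, ← hz,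
        mul_div_mul_left _ _ hzk, mul_div_mul_left _ _ hzk]
      congr 2
      ext x
      simp only [mem_erase]
      tauto
    · intro a ha b hb hab hzab
      have has := mem_of_mem_erase (mem_of_mem_erase ha)
      have hbs := mem_of_mem_erase (mem_of_mem_erase hb)
      obtain ⟨g3, u', hu', v', hv', huv', hwu', hwv'⟩ := H a has b hbs hab hzab
      have hza : z a ≠ z i := fun h0 => by
        rcases h3 a has h0 with h | h
        exacts [ne_of_mem_erase (mem_of_mem_erase ha) h, ne_of_mem_erase ha h]
      refine ⟨fun k hk => g3 k (mem_of_mem_erase (mem_of_mem_erase hk)), u', ?_, v', ?_, huv', hwu',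
        hwv'⟩ <;>
      · refine mem_erase.2 ⟨?_, mem_erase.2 ⟨?_, by assumption⟩⟩ <;>
        · rintro rfl
          exact hza (by first
            | rw [← hwu', hwu]
            | rw [← hwu', hwv]
            | rw [← hwv', hwu]
            | rw [← hwv', hwv])

/-! ### Exchange relations and the cubic relation -/

/-- `z - z⁻¹`; for `z = q^a` this is `(q - q⁻¹) [a]`. -/
noncomputable def br (z : ℂ) : ℂ := z - z⁻¹

lemma br_eq_zero_iff {z : ℂ} (hz : z ≠ 0) : br z = 0 ↔ z ^ 2 = 1 := by
  rw [br, sub_eq_zero]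
  field_simp

/-- The six ways to order two moves `x`, `y` in a row and a move `n` in a neighbouring row
contribute zero to the cubic relation. The numbers `p` are the weights of the paths, `s² = q`,
and `u`, `v` are the ratios of the multiplicative coordinate of `n` to those of `x`, `y`. -/
lemma hexagon {s u v : ℂ} (hs : s ≠ 0) (hu : u ≠ 0) (hv : v ≠ 0) (hq : br (s ^ 2) ≠ 0)
    (h1 : br (s ^ 2 * (u / v)) ≠ 0) (h2 : br ((s ^ 2)⁻¹ * (u / v)) ≠ 0)
    {pxyn pyxn pxny pynx pnxy pnyx : ℂ}
    (e1 : pxny * br (s * u) = pnxy * br (s⁻¹ * u))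
    (e2 : pynx * br (s * v) = pnyx * br (s⁻¹ * v))
    (e3 : pxyn * br (s * v) = pxny * br (s⁻¹ * v))
    (e4 : pyxn * br (s * u) = pynx * br (s⁻¹ * u))
    (e5 : pnxy * br ((s ^ 2)⁻¹ * (u / v)) = pnyx * br (s ^ 2 * (u / v)))
    (e6 : pxyn * br ((s ^ 2)⁻¹ * (u / v)) = pyxn * br (s ^ 2 * (u / v))) :
    (pxyn - (s ^ 2 + (s ^ 2)⁻¹) * pxny + pnxy) +
      (pyxn - (s ^ 2 + (s ^ 2)⁻¹) * pynx + pnyx) = 0 := by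
  have hsu := br_eq_zero_iff (mul_ne_zero hs hu)
  have hsv := br_eq_zero_iff (mul_ne_zero hs hv)
  have hsu' := br_eq_zero_iff (mul_ne_zero (inv_ne_zero hs) hu)
  have hsv' := br_eq_zero_iff (mul_ne_zero (inv_ne_zero hs) hv)
  have key : (br (s⁻¹ * u) * br (s⁻¹ * v) + br (s * u) * br (s * v)) *
      (br (s ^ 2 * (u / v)) + br ((s ^ 2)⁻¹ * (u / v))) = (s ^ 2 + (s ^ 2)⁻¹) *
      (br (s⁻¹ * u) * br (s * v) * br (s ^ 2 * (u / v)) +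
        br (s * u) * br (s⁻¹ * v) * br ((s ^ 2)⁻¹ * (u / v))) := by
    simp only [br]
    field_simp
    ring
  rw [Ne, br_eq_zero_iff (by positivity)] at hq
  have hc := (br_eq_zero_iff (z := s ^ 2 * (u / v)) (by positivity)).not.1 h1
  have hc' := (br_eq_zero_iff (z := (s ^ 2)⁻¹ * (u / v)) (by positivity)).not.1 h2
  generalize br (s * u) = a at *
  generalize br (s⁻¹ * u) = a' at *
  generalize br (s * v) = b at *
  generalize br (s⁻¹ * v) = b' at *
  generalize br (s ^ 2 * (u / v)) = c at *
  generalize br ((s ^ 2)⁻¹ * (u / v)) = c' at *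
  -- All six weights are multiples of a common factor `G`, obtained from whichever of `a`, `b` or
  -- `a'`, `b'` are both nonzero; otherwise `hq`, `h1` or `h2` would fail.
  by_cases hA : a ≠ 0 ∧ b ≠ 0
  · obtain ⟨hA1, hA2⟩ := hA
    obtain ⟨G, rfl⟩ : ∃ G, pnxy = a * b * c * G := ⟨pnxy / (a * b * c), by field_simp⟩
    obtain rfl : pnyx = a * b * c' * G := mul_right_cancel₀ h1 (by linear_combination -e5)
    obtain rfl : pxny = a' * b * c * G := mul_right_cancel₀ hA1 (by linear_combination e1)
    obtain rfl : pynx = a * b' * c' * G := mul_right_cancel₀ hA2 (by linear_combination e2)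
    obtain rfl : pxyn = a' * b' * c * G := mul_right_cancel₀ hA2 (by linear_combination e3)
    obtain rfl : pyxn = a' * b' * c' * G := mul_right_cancel₀ hA1 (by linear_combination e4)
    linear_combination G * key
  by_cases hB : a' ≠ 0 ∧ b' ≠ 0
  · obtain ⟨hB1, hB2⟩ := hB
    obtain ⟨G, rfl⟩ : ∃ G, pxyn = a' * b' * c * G := ⟨pxyn / (a' * b' * c), by field_simp⟩
    obtain rfl : pyxn = a' * b' * c' * G := mul_right_cancel₀ h1 (by linear_combination -e6)
    obtain rfl : pxny = a' * b * c * G := mul_right_cancel₀ hB2 (by linear_combination -e3)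
    obtain rfl : pynx = a * b' * c' * G := mul_right_cancel₀ hB1 (by linear_combination -e4)
    obtain rfl : pnxy = a * b * c * G := mul_right_cancel₀ hB1 (by linear_combination -e1)
    obtain rfl : pnyx = a * b * c' * G := mul_right_cancel₀ hB2 (by linear_combination -e2)
    linear_combination G * key
  exfalso
  rw [not_and_or, not_not, not_not, hsu, hsv] at hA
  rw [not_and_or, not_not, not_not, hsu', hsv'] at hB
  rcases hA with hA | hA <;> rcases hB with hB | hB
  · refine hq ?_
    have : (s ^ 2) ^ 2 * (s⁻¹ * u) ^ 2 = (s * u) ^ 2 := by field_simp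
    rwa [hA, hB, mul_one] at this
  · refine hc ?_
    have : (s ^ 2 * (u / v)) ^ 2 * (s⁻¹ * v) ^ 2 = (s * u) ^ 2 := by field_simp
    rwa [hA, hB, mul_one] at this
  · refine hc' ?_
    have : ((s ^ 2)⁻¹ * (u / v)) ^ 2 * (s * v) ^ 2 = (s⁻¹ * u) ^ 2 := by field_simp
    rwa [hA, hB, mul_one] at this
  · refine hq ?_
    have : (s ^ 2) ^ 2 * (s⁻¹ * v) ^ 2 = (s * v) ^ 2 := by field_simp
    rwa [hA, hB, mul_one] at this

/-- The cubic relation for two operators that act on partial basis vectors `ket ξ` by sums over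
moves: it suffices that the paths along two moves that are not opposite cancel (`hS`), and that
those along opposite moves add up to the right-hand side (`hD`). -/
lemma cubic_of_paths {G V ι κ : Type*} [AddCommGroup G] [AddCommGroup V] [Module ℂ V]
    (X Y : Module.End ℂ V) (ket : G → V) (MX : Finset ι) (MY : Finset κ) (vX : ι → G) (vY : κ → G)
    (cX : ι → G → ℂ) (cY : κ → G → ℂ) (op : ι → ι) (Q : ℂ)
    (hX : ∀ ξ, X (ket ξ) = ∑ i ∈ MX, cX i ξ • ket (ξ + vX i))
    (hY : ∀ ξ, Y (ket ξ) = ∑ k ∈ MY, cY k ξ • ket (ξ + vY k))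
    (hop : ∀ i ∈ MX, op i ∈ MX) (hop' : ∀ i ∈ MX, op (op i) = i)
    (hv : ∀ i ∈ MX, vX (op i) = -vX i)
    (hS : ∀ ξ, ∀ k ∈ MY, ∀ i ∈ MX, ∀ j ∈ MX, j ≠ op i →
      (cX i ξ * cX j (ξ + vX i) * cY k (ξ + vX i + vX j)
          - Q * (cX i ξ * cY k (ξ + vX i) * cX j (ξ + vX i + vY k))
          + cY k ξ * cX i (ξ + vY k) * cX j (ξ + vY k + vX i)) +
        (cX j ξ * cX i (ξ + vX j) * cY k (ξ + vX j + vX i)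
          - Q * (cX j ξ * cY k (ξ + vX j) * cX i (ξ + vX j + vY k))
          + cY k ξ * cX j (ξ + vY k) * cX i (ξ + vY k + vX j)) = 0)
    (hD : ∀ ξ, ∀ k ∈ MY, ∑ i ∈ MX,
      (cX i ξ * cX (op i) (ξ + vX i) * cY k ξ
          - Q * (cX i ξ * cY k (ξ + vX i) * cX (op i) (ξ + vX i + vY k))
          + cY k ξ * cX i (ξ + vY k) * cX (op i) (ξ + vY k + vX i)) = -cY k ξ) (ξ : G) :
    (Y * X ^ 2 - Q • (X * Y * X) + X ^ 2 * Y) (ket ξ) = (-Y) (ket ξ) := by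
  classical
  set T : κ → ι → ι → ℂ := fun k i j => cX i ξ * cX j (ξ + vX i) * cY k (ξ + vX i + vX j)
          - Q * (cX i ξ * cY k (ξ + vX i) * cX j (ξ + vX i + vY k))
          + cY k ξ * cX i (ξ + vY k) * cX j (ξ + vY k + vX i) with hT
  have h1 : (Y * X ^ 2 - Q • (X * Y * X) + X ^ 2 * Y) (ket ξ) =
      ∑ k ∈ MY, ∑ i ∈ MX, ∑ j ∈ MX, T k i j • ket (ξ + vX i + vX j + vY k) := by
    have a1 : (Y * X ^ 2) (ket ξ) = ∑ k ∈ MY, ∑ i ∈ MX, ∑ j ∈ MX,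
        (cX i ξ * cX j (ξ + vX i) * cY k (ξ + vX i + vX j)) • ket (ξ + vX i + vX j + vY k) := by
      rw [Finset.sum_comm]
      simp only [pow_two, Module.End.mul_apply, hX, hY, map_sum, map_smul, smul_smul,
        Finset.smul_sum]
      refine Finset.sum_congr rfl fun i _ => ?_
      rw [Finset.sum_comm]
    have a2 : (X * Y * X) (ket ξ) = ∑ k ∈ MY, ∑ i ∈ MX, ∑ j ∈ MX,
        (cX i ξ * cY k (ξ + vX i) * cX j (ξ + vX i + vY k)) • ket (ξ + vX i + vX j + vY k) := by
      rw [Finset.sum_comm]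
      simp only [Module.End.mul_apply, hX, hY, map_sum, map_smul, smul_smul, Finset.smul_sum]
      refine Finset.sum_congr rfl fun i _ => Finset.sum_congr rfl fun k _ =>
        Finset.sum_congr rfl fun j _ => ?_
      rw [add_right_comm (ξ + vX i), mul_assoc]
    have a3 : (X ^ 2 * Y) (ket ξ) = ∑ k ∈ MY, ∑ i ∈ MX, ∑ j ∈ MX,
        (cY k ξ * cX i (ξ + vY k) * cX j (ξ + vY k + vX i)) • ket (ξ + vX i + vX j + vY k) := by
      simp only [pow_two, Module.End.mul_apply, hX, hY, map_sum, map_smul, smul_smul,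
        Finset.smul_sum]
      refine Finset.sum_congr rfl fun k _ => Finset.sum_congr rfl fun i _ =>
        Finset.sum_congr rfl fun j _ => ?_
      rw [show ξ + vY k + vX i + vX j = ξ + vX i + vX j + vY k by abel, mul_assoc]
    rw [LinearMap.add_apply, LinearMap.sub_apply, LinearMap.smul_apply, a1, a2, a3]
    simp only [Finset.smul_sum, smul_smul, ← Finset.sum_sub_distrib, ← Finset.sum_add_distrib,
      ← sub_smul, ← add_smul, hT]
  rw [h1, LinearMap.neg_apply, hY, ← Finset.sum_neg_distrib]
  refine Finset.sum_congr rfl fun k hk => ?_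
  have h2 : ∀ i ∈ MX, ∑ j ∈ MX, T k i j • ket (ξ + vX i + vX j + vY k) =
      T k i (op i) • ket (ξ + vY k) + ∑ j ∈ MX,
        (if j = op i then 0 else T k i j • ket (ξ + vX i + vX j + vY k)) := by
    intro i hi
    rw [← Finset.add_sum_erase _ _ (hop i hi), ← Finset.add_sum_erase (a := op i) MX
      (fun j => if j = op i then 0 else T k i j • ket (ξ + vX i + vX j + vY k)) (hop i hi),
      if_pos rfl, zero_add, hv i hi]
    rw [add_neg_cancel_right]
    congr 1
    exact Finset.sum_congr rfl fun j hj => (if_neg (Finset.ne_of_mem_erase hj)).symm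
  rw [Finset.sum_congr rfl h2, Finset.sum_add_distrib, ← Finset.sum_smul]
  have h3 : ∑ i ∈ MX, T k i (op i) = -cY k ξ := by
    rw [← hD ξ k hk]
    refine Finset.sum_congr rfl fun i hi => ?_
    simp only [hT, hv i hi, add_neg_cancel_right]
  -- the sum over pairs of moves that are not opposite is antisymmetric
  have h4 : ∑ i ∈ MX, ∑ j ∈ MX,
      (if j = op i then 0 else T k i j • ket (ξ + vX i + vX j + vY k)) = 0 := by
    set S := ∑ i ∈ MX, ∑ j ∈ MX,
      (if j = op i then 0 else T k i j • ket (ξ + vX i + vX j + vY k)) with hSdef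
    have h5 : S + S = 0 := by
      nth_rewrite 2 [hSdef]
      rw [Finset.sum_comm, hSdef, ← Finset.sum_add_distrib]
      refine Finset.sum_eq_zero fun i hi => ?_
      rw [← Finset.sum_add_distrib]
      refine Finset.sum_eq_zero fun j hj => ?_
      by_cases hij : j = op i
      · rw [if_pos hij, if_pos (by rw [hij, hop' i hi]), add_zero]
      · have hji : i ≠ op j := fun h => hij (by rw [h, hop' j hj])
        rw [if_neg hij, if_neg hji, add_right_comm ξ (vX j), ← add_smul, hS ξ k hk i hi j hj hij,
          zero_smul]
    have h6 : (2 : ℂ) • S = 0 := by rw [two_smul, h5]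
    exact (smul_eq_zero.1 h6).resolve_left two_ne_zero
  rw [h3, h4, add_zero, neg_smul]

/-! ### `q`-numbers -/

section qNumbers

variable {h : ℂ}

lemma qPow_zero (h : ℂ) : qPow h 0 = 1 := by simp [qPow]

lemma qPow_add (h : ℂ) (a b : ℚ) : qPow h (a + b) = qPow h a * qPow h b := by
  simp only [qPow, ← Complex.exp_add]
  push_cast
  ring_nf

lemma qPow_ne_zero (h : ℂ) (a : ℚ) : qPow h a ≠ 0 := Complex.exp_ne_zero _

lemma qPow_neg (h : ℂ) (a : ℚ) : qPow h (-a) = (qPow h a)⁻¹ := by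
  rw [qPow, qPow, ← Complex.exp_neg]
  push_cast
  ring_nf

lemma qPow_sub (h : ℂ) (a b : ℚ) : qPow h (a - b) = qPow h a / qPow h b := by
  rw [sub_eq_add_neg, qPow_add, qPow_neg, div_eq_mul_inv]

lemma qPow_one (h : ℂ) : qPow h 1 = Complex.exp h := by simp [qPow]

lemma qPow_natCast_mul (h : ℂ) (k : ℕ) (a : ℚ) : qPow h (k * a) = qPow h a ^ k := by
  rw [qPow, qPow, ← Complex.exp_nat_mul]
  push_cast
  ring_nf

lemma qPow_two_mul (h : ℂ) (a : ℚ) : qPow h (2 * a) = qPow h a ^ 2 := by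
  exact_mod_cast qPow_natCast_mul h 2 a

lemma qPow_eq_one_iff (hq : ∀ k : ℕ, 0 < k → Complex.exp h ^ k ≠ 1) {a : ℚ} :
    qPow h a = 1 ↔ a = 0 := by
  refine ⟨fun h1 => ?_, fun h0 => by rw [h0, qPow_zero]⟩
  by_contra ha
  have key : ∀ b : ℚ, 0 < b → qPow h b ≠ 1 := by
    intro b hb h1
    have hnum : 0 < b.num := Rat.num_pos.2 hb
    refine hq b.num.toNat (by omega) ?_
    have e : (b.num.toNat : ℚ) * 1 = (b.den : ℚ) * b := by
      have : ((b.num.toNat : ℤ) : ℚ) = (b.num : ℚ) := by rw [Int.toNat_of_nonneg hnum.le]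
      rw [mul_one, Rat.den_mul_eq_num]
      exact_mod_cast this
    rw [← qPow_one, ← qPow_natCast_mul, e, qPow_natCast_mul, h1, one_pow]
  rcases lt_or_gt_of_ne ha with hlt | hgt
  · exact key (-a) (by linarith) (by rw [qPow_neg, h1, inv_one])
  · exact key a hgt h1

lemma qPow_ne_neg_one (hq : ∀ k : ℕ, 0 < k → Complex.exp h ^ k ≠ 1) (a : ℚ) :
    qPow h a ≠ -1 := by
  intro h1
  have h2 : qPow h (2 * a) = 1 := by rw [qPow_two_mul, h1]; norm_num
  have h3 : a = 0 := by
    have := (qPow_eq_one_iff hq).1 h2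
    linarith
  rw [h3, qPow_zero] at h1
  norm_num at h1

lemma qPow_sub_qPow_neg_ne_zero (hq : ∀ k : ℕ, 0 < k → Complex.exp h ^ k ≠ 1) {a : ℚ}
    (ha : a ≠ 0) : qPow h a - qPow h (-a) ≠ 0 := by
  intro h0
  have h1 : qPow h (2 * a) = 1 := by
    rw [sub_eq_zero, qPow_neg] at h0
    rw [qPow_two_mul, pow_two]
    nth_rewrite 1 [h0]
    exact inv_mul_cancel₀ (qPow_ne_zero h a)
  have := (qPow_eq_one_iff hq).1 h1
  exact ha (by linarith)

lemma qPow_add_qPow_neg_ne_zero (hq : ∀ k : ℕ, 0 < k → Complex.exp h ^ k ≠ 1) (a : ℚ) :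
    qPow h a + qPow h (-a) ≠ 0 := by
  intro h0
  refine qPow_ne_neg_one hq (2 * a) ?_
  rw [qPow_neg] at h0
  have := qPow_ne_zero h a
  rw [qPow_two_mul]
  field_simp at h0
  linear_combination h0

lemma qNum_zero (h : ℂ) : qNum h 0 = 0 := by simp [qNum]

lemma qNum_neg (h : ℂ) (a : ℚ) : qNum h (-a) = -qNum h a := by
  rw [qNum, qNum, neg_neg, ← neg_div, neg_sub]

lemma qNumPlus_neg (h : ℂ) (a : ℚ) : qNumPlus h (-a) = qNumPlus h a := by
  rw [qNumPlus, qNumPlus, neg_neg, add_comm]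

lemma qNum_ne_zero (hq : ∀ k : ℕ, 0 < k → Complex.exp h ^ k ≠ 1) {a : ℚ} (ha : a ≠ 0) :
    qNum h a ≠ 0 :=
  div_ne_zero (qPow_sub_qPow_neg_ne_zero hq ha) (qPow_sub_qPow_neg_ne_zero hq one_ne_zero)

lemma qNumPlus_ne_zero (hq : ∀ k : ℕ, 0 < k → Complex.exp h ^ k ≠ 1) (a : ℚ) :
    qNumPlus h a ≠ 0 :=
  div_ne_zero (qPow_add_qPow_neg_ne_zero hq a) (qPow_sub_qPow_neg_ne_zero hq one_ne_zero)

end qNumbers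

/-! ### Centred coordinates and interlacing rows -/

/-- The centred coordinate `m_{j,k} + k/2 - j` of an entry. It equals `l_{j,k}` in the even rows and
`l_{j,k} - 1/2` in the odd ones; in these coordinates the formulas for both kinds of rows agree. -/
def ctr (ξ : ℕ → ℕ → ℚ) (k j : ℕ) : ℚ := ξ k j + k / 2 - j

lemma lc_even (ξ : ℕ → ℕ → ℚ) (j p : ℕ) : lc ξ j (2 * p) = ctr ξ (2 * p) j := by
  rw [lc, if_neg (by simp), ctr, Nat.mul_div_cancel_left p two_pos]
  push_cast
  ring

lemma lc_odd (ξ : ℕ → ℕ → ℚ) (j p : ℕ) : lc ξ j (2 * p + 1) = ctr ξ (2 * p + 1) j + 1 / 2 := by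
  rw [lc, if_pos (by simp), ctr, show (2 * p + 1) / 2 = p by omega]
  push_cast
  ring

lemma lc_odd' (ξ : ℕ → ℕ → ℚ) (j p : ℕ) (hp : 1 ≤ p) :
    lc ξ j (2 * p - 1) = ctr ξ (2 * p - 1) j + 1 / 2 := by
  obtain ⟨p, rfl⟩ := Nat.exists_eq_add_of_le' hp
  exact lc_odd ξ j p

/-- The relative position of the `i`-th entry `u` of a row and the `j`-th entry `d` of the row
below, in centred coordinates. -/
def Interlaces (i j : ℕ) (u d : ℚ) : Prop := 0 < u + d ∧ (i ≤ j → d < u) ∧ (j < i → u < d)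

lemma IsHalfIntegral.le_of_lt {x y : ℚ} (hx : IsHalfIntegral x) (hy : IsHalfIntegral y)
    (hxy : x < y + 1) : x ≤ y := by
  obtain ⟨a, rfl⟩ := hx
  obtain ⟨b, rfl⟩ := hy
  have : (a : ℚ) < b + 1 := by linarith
  have h2 : a < b + 1 := by exact_mod_cast this
  have : (a : ℚ) ≤ b := by exact_mod_cast (by omega : a ≤ b)
  linarith

lemma IsHalfIntegral.neg {x : ℚ} (hx : IsHalfIntegral x) : IsHalfIntegral (-x) := by
  obtain ⟨a, rfl⟩ := hx
  exact ⟨-a - 1, by push_cast; ring⟩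

lemma IsHalfIntegral.half_le {x : ℚ} (hx : IsHalfIntegral x) (h0 : 0 < x) : 1 / 2 ≤ x := by
  refine IsHalfIntegral.le_of_lt ⟨0, by norm_num⟩ hx (by linarith)

lemma IsHalfIntegral.eq_half {x : ℚ} (hx : IsHalfIntegral x) (h0 : 0 < x) (h1 : x ≤ 1) :
    x = 1 / 2 :=
  le_antisymm (hx.le_of_lt ⟨0, by norm_num⟩ (by linarith)) (hx.half_le h0)

/-- Classical tableaux in terms of the relative position of all pairs of entries of adjacent rows
(not only of neighbouring ones). -/
lemma isClassicalTableau_iff {n : ℕ} {m : ℕ → ℚ} {ξ : ℕ → ℕ → ℚ} :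
    IsClassicalTableau n m ξ ↔ IsArray n m ξ ∧ ∀ k i j, 2 ≤ k → k + 1 ≤ n → 1 ≤ i →
      i ≤ (k + 1) / 2 → 1 ≤ j → j ≤ k / 2 → Interlaces i j (ctr ξ (k + 1) i) (ctr ξ k j) := by
  constructor
  · intro hξ
    refine ⟨hξ.toIsArray, fun k i j hk hkn hi hi' hj hj' => ?_⟩
    have hU : ∀ j, 1 ≤ j → j ≤ k / 2 → ctr ξ k j < ctr ξ (k + 1) j := by
      intro j h1 h2
      obtain ⟨p, rfl | rfl⟩ := Nat.even_or_odd' k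
      · have := hξ.odd_upper p j hkn h1 (by omega)
        simp only [ctr]; push_cast; linarith
      · have := hξ.even_upper (p + 1) j hkn h1 (by omega)
        rw [show 2 * (p + 1) - 1 = 2 * p + 1 by omega, show 2 * (p + 1) = 2 * p + 1 + 1 by omega]
          at this
        simp only [ctr]; push_cast; linarith
    have hL : ∀ j, 1 ≤ j → j + 1 ≤ (k + 1) / 2 → ctr ξ (k + 1) (j + 1) < ctr ξ k j := by
      intro j h1 h2
      obtain ⟨p, rfl | rfl⟩ := Nat.even_or_odd' k
      · have := hξ.odd_lower p j hkn h1 (by omega)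
        simp only [ctr]; push_cast; linarith
      · have : ξ (2 * p + 1 + 1) (j + 1) ≤ ξ (2 * p + 1) j := by
          by_cases hjp : j + 1 < p + 1
          · exact hξ.even_lower (p + 1) j hkn h1 hjp
          · have h3 := hξ.even_last (p + 1) (by omega) hkn
            obtain rfl : j = p := by omega
            exact (le_abs_self _).trans h3
        simp only [ctr]; push_cast; linarith
    have hS : 0 < ctr ξ (k + 1) ((k + 1) / 2) + ctr ξ k (k / 2) := by
      obtain ⟨p, rfl | rfl⟩ := Nat.even_or_odd' k
      · have := hξ.odd_last p (by omega) hkn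
        rw [show (2 * p + 1) / 2 = p by omega, show 2 * p / 2 = p by omega]
        simp only [ctr]; push_cast; linarith
      · have := hξ.even_last (p + 1) (by omega) hkn
        rw [show 2 * (p + 1) - 1 = 2 * p + 1 by omega, show 2 * (p + 1) = 2 * p + 1 + 1 by omega,
          show p + 1 - 1 = p by omega] at this
        have h2 := (neg_abs_le (ξ (2 * p + 1 + 1) (p + 1)))
        rw [show (2 * p + 1 + 1) / 2 = p + 1 by omega, show (2 * p + 1) / 2 = p by omega]
        simp only [ctr]; push_cast; linarith
    have antiU : ∀ d i, 1 ≤ i → i + d ≤ (k + 1) / 2 →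
        ctr ξ (k + 1) (i + d) ≤ ctr ξ (k + 1) i := by
      intro d
      induction d with
      | zero => intros; simp
      | succ d ih =>
        intro i h1 h2
        have := ih i h1 (by omega)
        have a := hL (i + d) (by omega) (by omega)
        have b := hU (i + d) (by omega) (by omega)
        rw [← add_assoc]; linarith
    have antiD : ∀ d j, 1 ≤ j → j + d ≤ k / 2 → ctr ξ k (j + d) ≤ ctr ξ k j := by
      intro d
      induction d with
      | zero => intros; simp
      | succ d ih =>
        intro j h1 h2
        have := ih j h1 (by omega)
        have a := hL (j + d) (by omega) (by omega)
        have b := hU (j + d + 1) (by omega) (by omega)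
        rw [← add_assoc]; linarith
    refine ⟨?_, fun hij => ?_, fun hij => ?_⟩
    · have a := antiU ((k + 1) / 2 - i) i hi (by omega)
      have b := antiD (k / 2 - j) j hj (by omega)
      rw [show i + ((k + 1) / 2 - i) = (k + 1) / 2 by omega] at a
      rw [show j + (k / 2 - j) = k / 2 by omega] at b
      linarith
    · have a := antiD (j - i) i hi (by omega)
      rw [show i + (j - i) = j by omega] at a
      linarith [hU i hi (by omega)]
    · have a := antiU (i - (j + 1)) (j + 1) (by omega) (by omega)
      rw [show j + 1 + (i - (j + 1)) = i by omega] at a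
      linarith [hL j hj (by omega)]
  · rintro ⟨hA, H⟩
    refine ⟨hA, ?_, ?_, ?_, ?_, ?_, ?_⟩
    · intro p j h1 h2 h3
      have := (H (2 * p) j j (by omega) h1 h2 (by omega) h2 (by omega)).2.1 le_rfl
      refine (hA.half _ _ (by omega) (by omega) h2 (by omega)).le_of_lt
        (hA.half _ _ (by omega) (by omega) h2 (by omega)) ?_
      simp only [ctr] at this; push_cast at this; linarith
    · intro p j h1 h2 h3
      have := (H (2 * p) (j + 1) j (by omega) h1 (by omega) (by omega) h2 (by omega)).2.2
        (by omega)
      refine (hA.half _ _ (by omega) (by omega) (by omega) (by omega)).le_of_lt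
        (hA.half _ _ (by omega) (by omega) h2 (by omega)) ?_
      simp only [ctr] at this; push_cast at this; linarith
    · intro p h1 h2
      have := (H (2 * p) p p (by omega) h2 h1 (by omega) h1 (by omega)).1
      refine (hA.half _ _ (by omega) (by omega) (by omega) (by omega)).neg.le_of_lt
        (hA.half _ _ (by omega) (by omega) h1 (by omega)) ?_
      simp only [ctr] at this; push_cast at this; linarith
    · intro p j h1 h2 h3
      have := (H (2 * p - 1) j j (by omega) (by omega) h2 (by omega) h2 (by omega)).2.1 le_rfl
      refine (hA.half _ _ (by omega) (by omega) h2 (by omega)).le_of_lt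
        (hA.half _ _ (by omega) (by omega) h2 (by omega)) ?_
      rw [show 2 * p - 1 + 1 = 2 * p by omega] at this
      simp only [ctr] at this; push_cast [show 1 ≤ 2 * p by omega] at this; linarith
    · intro p j h1 h2 h3
      have := (H (2 * p - 1) (j + 1) j (by omega) (by omega) (by omega) (by omega) h2
        (by omega)).2.2 (by omega)
      refine (hA.half _ _ (by omega) (by omega) (by omega) (by omega)).le_of_lt
        (hA.half _ _ (by omega) (by omega) h2 (by omega)) ?_
      rw [show 2 * p - 1 + 1 = 2 * p by omega] at this
      simp only [ctr] at this; push_cast [show 1 ≤ 2 * p by omega] at this; linarith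
    · intro p h1 h2
      have h3 := H (2 * p - 1) p (p - 1) (by omega) (by omega) (by omega) (by omega) (by omega)
        (by omega)
      have h4 := h3.1
      have h5 := h3.2.2 (by omega)
      rw [show 2 * p - 1 + 1 = 2 * p by omega] at h4 h5
      simp only [ctr] at h4 h5
      push_cast [show 1 ≤ 2 * p by omega, show 1 ≤ p by omega] at h4 h5
      have a1 := hA.half (2 * p) p (by omega) (by omega) (by omega) (by omega)
      have a2 := hA.half (2 * p - 1) (p - 1) (by omega) (by omega) (by omega) (by omega)
      exact abs_le'.2 ⟨a1.le_of_lt a2 (by linarith), a1.neg.le_of_lt a2 (by linarith)⟩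

/-! ### Moves -/

/-- The change of an array under a move in row `k`: `some (j, s)` adds `s = ±1` to the `j`-th entry,
`none` changes nothing (it stands for the diagonal term of the operators). -/
def mv (k : ℕ) : Option (ℕ × ℤˣ) → ℕ → ℕ → ℚ
  | none => 0
  | some x => Pi.single k (Pi.single x.1 ((x.2 : ℤ) : ℚ))

/-- The moves in row `k`; those of the odd rows include `none`. -/
def moves (k : ℕ) : Finset (Option (ℕ × ℤˣ)) :=
  if Odd k then insertNone (Icc 1 (k / 2) ×ˢ univ)
  else (Icc 1 (k / 2) ×ˢ univ).map Function.Embedding.some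

lemma some_mem_moves {k j : ℕ} {s : ℤˣ} : some (j, s) ∈ moves k ↔ 1 ≤ j ∧ j ≤ k / 2 := by
  rw [moves]
  split_ifs <;> simp [Int.units_eq_one_or]

lemma none_mem_moves {k : ℕ} : none ∈ moves k ↔ Odd k := by
  rw [moves]
  split_ifs with h <;> simp [h]

/-- The opposite move. -/
def opp : Option (ℕ × ℤˣ) → Option (ℕ × ℤˣ) := Option.map fun x => (x.1, -x.2)

lemma opp_opp (x : Option (ℕ × ℤˣ)) : opp (opp x) = x := by cases x <;> simp [opp]

lemma opp_mem_moves {k : ℕ} {x : Option (ℕ × ℤˣ)} (hx : x ∈ moves k) : opp x ∈ moves k := by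
  rcases x with _ | ⟨j, s⟩
  · exact hx
  · exact some_mem_moves.2 (some_mem_moves.1 hx)

lemma mv_opp (k : ℕ) (x : Option (ℕ × ℤˣ)) : mv k (opp x) = -mv k x := by
  rcases x with _ | ⟨j, s⟩
  · simp [mv, opp]
  · simp [mv, opp, Pi.single_neg]

/-- The sign `s` as a rational number. -/
abbrev sq (s : ℤˣ) : ℚ := ((s : ℤ) : ℚ)

lemma sq_cases (s : ℤˣ) : sq s = 1 ∨ sq s = -1 := by
  rcases Int.units_eq_one_or s with rfl | rfl <;> simp [sq]

lemma sq_mul_self (s : ℤˣ) : sq s * sq s = 1 := by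
  rcases sq_cases s with h | h <;> rw [h] <;> norm_num

lemma ctr_add_mv (ξ : ℕ → ℕ → ℚ) (k j : ℕ) (s : ℤˣ) (k' i : ℕ) :
    ctr (ξ + mv k (some (j, s))) k' i = ctr ξ k' i + if k' = k ∧ i = j then sq s else 0 := by
  by_cases h1 : k' = k
  · subst h1
    by_cases h2 : i = j
    · subst h2
      simp [ctr, mv]
      ring
    · simp [ctr, mv, h2]
  · simp [ctr, mv, h1]

lemma ctr_add_mv_self (ξ : ℕ → ℕ → ℚ) (k j : ℕ) (s : ℤˣ) :
    ctr (ξ + mv k (some (j, s))) k j = ctr ξ k j + sq s := by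
  rw [ctr_add_mv, if_pos ⟨rfl, rfl⟩]

lemma ctr_add_mv_of_ne (ξ : ℕ → ℕ → ℚ) {k j : ℕ} (s : ℤˣ) {k' i : ℕ} (h : ¬(k' = k ∧ i = j)) :
    ctr (ξ + mv k (some (j, s))) k' i = ctr ξ k' i := by
  rw [ctr_add_mv, if_neg h, add_zero]

lemma shift_eq_add_mv (ξ : ℕ → ℕ → ℚ) (k j : ℕ) (s : ℤˣ) :
    shift ξ k j (sq s) = ξ + mv k (some (j, s)) := by
  ext k' i
  by_cases h1 : k' = k
  · subst h1
    by_cases h2 : i = j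
    · subst h2
      simp [shift, mv]
    · simp [shift, mv, h2]
  · simp [shift, mv, h1]

/-- The signed centred coordinate of a move: it increases by one under that move. -/
def sc (ξ : ℕ → ℕ → ℚ) (k : ℕ) (x : ℕ × ℤˣ) : ℚ := sq x.2 * ctr ξ k x.1

lemma sc_add_mv_self (ξ : ℕ → ℕ → ℚ) (k : ℕ) (x : ℕ × ℤˣ) :
    sc (ξ + mv k (some x)) k x = sc ξ k x + 1 := by
  rw [sc, sc, ctr_add_mv_self, mul_add, sq_mul_self]

lemma sc_add_mv_of_ne (ξ : ℕ → ℕ → ℚ) {k : ℕ} (x : ℕ × ℤˣ) {k' : ℕ} {y : ℕ × ℤˣ}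
    (h : ¬(k' = k ∧ y.1 = x.1)) : sc (ξ + mv k (some x)) k' y = sc ξ k' y := by
  rw [sc, sc, ctr_add_mv_of_ne _ _ h]

lemma sc_neg (ξ : ℕ → ℕ → ℚ) (k j : ℕ) (s : ℤˣ) : sc ξ k (j, -s) = -sc ξ k (j, s) := by
  simp [sc, sq]

/-! ### Integrality -/

variable {n : ℕ} {m : ℕ → ℚ} {ξ ξ' : ℕ → ℕ → ℚ}

lemma IsArray.exists_ctr_eq (hξ : IsArray n m ξ) {k j : ℕ} (hk : k ≤ n) (hj : 1 ≤ j)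
    (hj' : j ≤ k / 2) : ∃ z : ℤ, ctr ξ k j = z + (k + 1) / 2 := by
  obtain ⟨z, hz⟩ := hξ.half k j (by omega) hk hj hj'
  exact ⟨z - j, by rw [ctr, hz]; push_cast; ring⟩

lemma IsArray.isHalfIntegral_sub (hξ : IsArray n m ξ) {k i j : ℕ} (hk : k + 1 ≤ n) (hi : 1 ≤ i)
    (hi' : i ≤ (k + 1) / 2) (hj : 1 ≤ j) (hj' : j ≤ k / 2) :
    IsHalfIntegral (ctr ξ (k + 1) i - ctr ξ k j) := by
  obtain ⟨z, hz⟩ := hξ.exists_ctr_eq hk hi hi'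
  obtain ⟨w, hw⟩ := hξ.exists_ctr_eq (by omega) hj hj'
  exact ⟨z - w, by rw [hz, hw]; push_cast; ring⟩

lemma IsArray.isHalfIntegral_add (hξ : IsArray n m ξ) {k i j : ℕ} (hk : k + 1 ≤ n) (hi : 1 ≤ i)
    (hi' : i ≤ (k + 1) / 2) (hj : 1 ≤ j) (hj' : j ≤ k / 2) :
    IsHalfIntegral (ctr ξ (k + 1) i + ctr ξ k j) := by
  obtain ⟨z, hz⟩ := hξ.exists_ctr_eq hk hi hi'
  obtain ⟨w, hw⟩ := hξ.exists_ctr_eq (by omega) hj hj'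
  exact ⟨z + w + k + 1, by rw [hz, hw]; push_cast; ring⟩

lemma IsArray.isInt_sub (hξ : IsArray n m ξ) {k i j : ℕ} (hk : k ≤ n) (hi : 1 ≤ i)
    (hi' : i ≤ k / 2) (hj : 1 ≤ j) (hj' : j ≤ k / 2) :
    ∃ z : ℤ, ctr ξ k i - ctr ξ k j = z := by
  obtain ⟨z, hz⟩ := hξ.exists_ctr_eq hk hi hi'
  obtain ⟨w, hw⟩ := hξ.exists_ctr_eq (by omega) hj hj'
  exact ⟨z - w, by rw [hz, hw]; push_cast; ring⟩

lemma IsArray.isInt_add (hξ : IsArray n m ξ) {k i j : ℕ} (hk : k ≤ n) (hi : 1 ≤ i)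
    (hi' : i ≤ k / 2) (hj : 1 ≤ j) (hj' : j ≤ k / 2) :
    ∃ z : ℤ, ctr ξ k i + ctr ξ k j = z := by
  obtain ⟨z, hz⟩ := hξ.exists_ctr_eq hk hi hi'
  obtain ⟨w, hw⟩ := hξ.exists_ctr_eq (by omega) hj hj'
  exact ⟨z + w + k + 1, by rw [hz, hw]; push_cast; ring⟩

lemma one_le_of_int {x : ℚ} (hx : ∃ z : ℤ, x = z) (h0 : 0 < x) : 1 ≤ x := by
  obtain ⟨z, rfl⟩ := hx
  exact_mod_cast (by exact_mod_cast h0 : 0 < z)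

lemma IsArray.add_mv (hξ : IsArray n m ξ) {k : ℕ} (hk : k + 1 ≤ n) {x : Option (ℕ × ℤˣ)}
    (hx : x ∈ moves k) : IsArray n m (ξ + mv k x) := by
  rcases x with _ | ⟨j, s⟩
  · simpa [mv] using hξ
  obtain ⟨hj, hj'⟩ := some_mem_moves.1 hx
  have key : ∀ k' i, ¬(k' = k ∧ i = j) → (ξ + mv k (some (j, s))) k' i = ξ k' i := by
    intro k' i hne
    have := ctr_add_mv_of_ne ξ s hne
    simp only [ctr] at this
    linarith
  have key2 : (ξ + mv k (some (j, s))) k j = ξ k j + sq s := by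
    have := ctr_add_mv_self ξ k j s
    simp only [ctr] at this
    linarith
  refine ⟨fun k' i h => ?_, fun i h1 h2 => ?_, fun k' i h1 h2 h3 h4 => ?_⟩
  · rw [key _ _ (by rintro ⟨rfl, rfl⟩; omega), hξ.zero _ _ h]
  · rw [key _ _ (by rintro ⟨rfl, rfl⟩; omega), hξ.top _ h1 h2]
  · by_cases hne : k' = k ∧ i = j
    · obtain ⟨rfl, rfl⟩ := hne
      obtain ⟨z, hz⟩ := hξ.half k' i h1 h2 h3 h4
      exact ⟨z + s, by rw [key2, hz]; push_cast; ring⟩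
    · rw [key _ _ hne]
      exact hξ.half k' i h1 h2 h3 h4

/-! ### Relative position of entries -/

lemma IsClassicalTableau.interlaces (hξ : IsClassicalTableau n m ξ) {k i j : ℕ} (hk : k + 1 ≤ n)
    (hi : 1 ≤ i) (hi' : i ≤ (k + 1) / 2) (hj : 1 ≤ j) (hj' : j ≤ k / 2) :
    Interlaces i j (ctr ξ (k + 1) i) (ctr ξ k j) :=
  (isClassicalTableau_iff.1 hξ).2 k i j (by omega) hk hi hi' hj hj'

/-- Rows `k` and `k'` are adjacent. -/
def RowAdj (k k' : ℕ) : Prop := k' = k + 1 ∨ k = k' + 1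

lemma RowAdj.symm {k k' : ℕ} (h : RowAdj k k') : RowAdj k' k := Or.symm h

lemma RowAdj.ne {k k' : ℕ} (h : RowAdj k k') : k ≠ k' := by
  rcases h with h | h <;> omega

/-- Between two entries of a row there is, in absolute value, an entry of each adjacent row. Its
place depends on the places of the two entries only. -/
lemma exists_between {k o i j : ℕ} (ho : RowAdj k o) (hon : o ≤ n) (hkn : k ≤ n) (hi : 1 ≤ i)
    (hij : i < j) (hj : j ≤ k / 2) : ∃ e, 1 ≤ e ∧ e ≤ o / 2 ∧
      ∀ ξ, IsClassicalTableau n m ξ → |ctr ξ k j| < ctr ξ o e ∧ ctr ξ o e < ctr ξ k i := by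
  rcases ho with rfl | rfl
  · refine ⟨j, by omega, by omega, fun ξ hξ => ⟨abs_lt.2 ?_, ?_⟩⟩
    · obtain ⟨a, b, c⟩ := hξ.interlaces hon (i := j) (j := j) (by omega) (by omega) (by omega) hj
      exact ⟨by linarith, b le_rfl⟩
    · exact (hξ.interlaces hon (i := j) (j := i) (by omega) (by omega) hi (by omega)).2.2 hij
  · refine ⟨i, by omega, by omega, fun ξ hξ => ⟨abs_lt.2 ?_, ?_⟩⟩
    · obtain ⟨a, b, c⟩ := hξ.interlaces hkn (i := j) (j := i) (by omega) hj hi (by omega)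
      exact ⟨by linarith, c hij⟩
    · exact (hξ.interlaces hkn (i := i) (j := i) hi (by omega) hi (by omega)).2.1 le_rfl

lemma IsClassicalTableau.abs_ctr_lt (hξ : IsClassicalTableau n m ξ) {k i j : ℕ} (hk : k + 1 ≤ n)
    (hi : 1 ≤ i) (hij : i < j) (hj : j ≤ k / 2) : |ctr ξ k j| < ctr ξ k i := by
  obtain ⟨e, -, -, he⟩ := exists_between (m := m) (Or.inl rfl) hk (by omega) hi hij hj
  exact (he ξ hξ).1.trans (he ξ hξ).2

lemma IsClassicalTableau.ctr_pos (hξ : IsClassicalTableau n m ξ) {k j : ℕ} (hk : k + 1 ≤ n)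
    (hodd : Odd k) (hj : 1 ≤ j) (hj' : j ≤ k / 2) : 0 < ctr ξ k j := by
  obtain ⟨p, rfl⟩ := hodd
  have a := (hξ.interlaces hk (i := j + 1) (j := j) (by omega) (by omega) hj hj').1
  have b := (hξ.interlaces hk (i := j + 1) (j := j) (by omega) (by omega) hj hj').2.2 (by omega)
  linarith

lemma IsClassicalTableau.ctr_ne_zero (hξ : IsClassicalTableau n m ξ) {k j : ℕ} (hk : k + 1 ≤ n)
    (hj : 1 ≤ j) (hj' : j ≤ k / 2) : ctr ξ k j ≠ 0 := by
  obtain ⟨p, rfl | rfl⟩ := Nat.even_or_odd' k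
  · obtain ⟨z, hz⟩ := hξ.exists_ctr_eq (by omega) hj hj'
    intro h0
    rw [hz] at h0
    have h1 : (((2 * z + 2 * p + 1 : ℤ)) : ℚ) = 0 := by push_cast at h0 ⊢; linarith
    have h2 : 2 * z + 2 * p + 1 = 0 := by exact_mod_cast h1
    omega
  · exact (hξ.ctr_pos hk (by simp) hj hj').ne'

/-- The order of the signed coordinates of two moves in adjacent rows is the same for all
tableaux. -/
lemma sc_lt_iff (hξ : IsClassicalTableau n m ξ) (hξ' : IsClassicalTableau n m ξ') {k k' : ℕ}
    (h : RowAdj k k') (hk : k ≤ n) (hk' : k' ≤ n) {x y : ℕ × ℤˣ} (hx : some x ∈ moves k)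
    (hy : some y ∈ moves k') : sc ξ k x < sc ξ k' y ↔ sc ξ' k x < sc ξ' k' y := by
  obtain ⟨j, s⟩ := x
  obtain ⟨i, t⟩ := y
  obtain ⟨hj, hj'⟩ := some_mem_moves.1 hx
  obtain ⟨hi, hi'⟩ := some_mem_moves.1 hy
  rcases h with rfl | rfl
  · obtain ⟨a1, a2, a3⟩ := hξ.interlaces hk' hi hi' hj hj'
    obtain ⟨b1, b2, b3⟩ := hξ'.interlaces hk' hi hi' hj hj'
    rcases le_or_gt i j with hij | hij
    · have a2 := a2 hij
      have b2 := b2 hij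
      simp only [sc]
      rcases sq_cases s with hs | hs <;> rcases sq_cases t with ht | ht <;> rw [hs, ht] <;>
        constructor <;> intro <;> linarith
    · have a2 := a3 hij
      have b2 := b3 hij
      simp only [sc]
      rcases sq_cases s with hs | hs <;> rcases sq_cases t with ht | ht <;> rw [hs, ht] <;>
        constructor <;> intro <;> linarith
  · obtain ⟨a1, a2, a3⟩ := hξ.interlaces hk hj hj' hi hi'
    obtain ⟨b1, b2, b3⟩ := hξ'.interlaces hk hj hj' hi hi'
    rcases le_or_gt j i with hij | hij
    · have a2 := a2 hij
      have b2 := b2 hij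
      simp only [sc]
      rcases sq_cases s with hs | hs <;> rcases sq_cases t with ht | ht <;> rw [hs, ht] <;>
        constructor <;> intro <;> linarith
    · have a2 := a3 hij
      have b2 := b3 hij
      simp only [sc]
      rcases sq_cases s with hs | hs <;> rcases sq_cases t with ht | ht <;> rw [hs, ht] <;>
        constructor <;> intro <;> linarith

lemma IsArray.isHalfIntegral_sc (hξ : IsArray n m ξ) {k k' : ℕ} (h : RowAdj k k') (hk : k ≤ n)
    (hk' : k' ≤ n) {x y : ℕ × ℤˣ} (hx : some x ∈ moves k) (hy : some y ∈ moves k') :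
    IsHalfIntegral (sc ξ k' y - sc ξ k x) := by
  obtain ⟨j, s⟩ := x
  obtain ⟨i, t⟩ := y
  obtain ⟨hj, hj'⟩ := some_mem_moves.1 hx
  obtain ⟨hi, hi'⟩ := some_mem_moves.1 hy
  have key : IsHalfIntegral (ctr ξ k' i - ctr ξ k j) ∧ IsHalfIntegral (ctr ξ k' i + ctr ξ k j) := by
    rcases h with rfl | rfl
    · exact ⟨hξ.isHalfIntegral_sub hk' hi hi' hj hj', hξ.isHalfIntegral_add hk' hi hi' hj hj'⟩
    · refine ⟨?_, ?_⟩
      · rw [← neg_sub]; exact (hξ.isHalfIntegral_sub hk hj hj' hi hi').neg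
      · rw [add_comm]; exact hξ.isHalfIntegral_add hk hj hj' hi hi'
  simp only [sc]
  rcases sq_cases s with hs | hs <;> rcases sq_cases t with ht | ht <;> rw [hs, ht]
  · simpa using key.1
  · convert key.2.neg using 1; ring
  · convert key.2 using 1; ring
  · convert key.1.neg using 1; ring

/-! ### Admissibility of intermediate arrays -/

/-- An array whose pairs of adjacent entries all occur in one of two classical tableaux is one. -/
lemma IsArray.isClassicalTableau_of_pairs {η : ℕ → ℕ → ℚ} (hη : IsArray n m η)
    (hξ : IsClassicalTableau n m ξ) (hξ' : IsClassicalTableau n m ξ')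
    (H : ∀ k i j, k + 1 ≤ n → 1 ≤ i → i ≤ (k + 1) / 2 → 1 ≤ j → j ≤ k / 2 →
      (ctr η (k + 1) i = ctr ξ (k + 1) i ∧ ctr η k j = ctr ξ k j) ∨
      (ctr η (k + 1) i = ctr ξ' (k + 1) i ∧ ctr η k j = ctr ξ' k j)) :
    IsClassicalTableau n m η := by
  refine isClassicalTableau_iff.2 ⟨hη, fun k i j _ hk hi hi' hj hj' => ?_⟩
  rcases H k i j hk hi hi' hj hj' with ⟨h1, h2⟩ | ⟨h1, h2⟩ <;> rw [h1, h2]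
  exacts [hξ.interlaces hk hi hi' hj hj', hξ'.interlaces hk hi hi' hj hj']

/-- Moves in rows that are not adjacent do not obstruct each other. -/
lemma isClassicalTableau_of_far {k k' : ℕ} (hkk : 1 < |(k : ℤ) - k'|) (hk : k + 1 ≤ n)
    {x y : Option (ℕ × ℤˣ)} (hx : x ∈ moves k) (hξ : IsClassicalTableau n m ξ)
    (hξ' : IsClassicalTableau n m (ξ + mv k x + mv k' y)) :
    IsClassicalTableau n m (ξ + mv k x) := by
  rcases y with _ | ⟨i, t⟩
  · simpa [mv] using hξ'
  rcases x with _ | ⟨j, s⟩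
  · simpa [mv] using hξ
  refine (hξ.toIsArray.add_mv hk hx).isClassicalTableau_of_pairs hξ hξ' fun l a b _ _ _ _ _ => ?_
  by_cases hl : l = k ∨ l + 1 = k
  · right
    have h1 : l ≠ k' := by rintro rfl; rw [lt_abs] at hkk; omega
    have h2 : l + 1 ≠ k' := by rintro rfl; rw [lt_abs] at hkk; omega
    exact ⟨(ctr_add_mv_of_ne _ _ (by tauto)).symm, (ctr_add_mv_of_ne _ _ (by tauto)).symm⟩
  · left
    exact ⟨ctr_add_mv_of_ne _ _ (by tauto), ctr_add_mv_of_ne _ _ (by tauto)⟩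

/-- Moves of different entries of a row do not obstruct each other. -/
lemma isClassicalTableau_of_same_row {k : ℕ} (hk : k + 1 ≤ n) {x y : ℕ × ℤˣ}
    (hx : some x ∈ moves k) (hxy : x.1 ≠ y.1) (hξ : IsClassicalTableau n m ξ)
    (hξ' : IsClassicalTableau n m (ξ + mv k (some x) + mv k (some y))) :
    IsClassicalTableau n m (ξ + mv k (some x)) := by
  obtain ⟨j, s⟩ := x
  obtain ⟨i, t⟩ := y
  refine (hξ.toIsArray.add_mv hk hx).isClassicalTableau_of_pairs hξ hξ' fun l a b _ _ _ _ _ => ?_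
  by_cases hl : (l = k ∧ b = j) ∨ (l + 1 = k ∧ a = j)
  · right
    refine ⟨(ctr_add_mv_of_ne _ _ ?_).symm, (ctr_add_mv_of_ne _ _ ?_).symm⟩
    · rintro ⟨h1, rfl⟩; rcases hl with ⟨h2, h3⟩ | ⟨h2, h3⟩
      · omega
      · exact hxy h3.symm
    · rintro ⟨h1, rfl⟩; rcases hl with ⟨h2, h3⟩ | ⟨h2, h3⟩
      · exact hxy h3.symm
      · omega
  · left
    exact ⟨ctr_add_mv_of_ne _ _ (by tauto), ctr_add_mv_of_ne _ _ (by tauto)⟩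

/-- If moving the lower entry alone is not allowed but moving both is, then the signed coordinate
of the lower entry is less than that of the upper entry by exactly `1/2`. -/
lemma Interlaces.of_not_lower {i j : ℕ} {u d : ℚ} {s t : ℤˣ} (h : Interlaces i j u d)
    (h' : Interlaces i j (u + sq t) (d + sq s)) (hn : ¬Interlaces i j u (d + sq s))
    (h1 : IsHalfIntegral (u - d)) (h2 : IsHalfIntegral (u + d)) : sq t * u - sq s * d = 1 / 2 := by
  obtain ⟨a1, a2, a3⟩ := h
  obtain ⟨b1, b2, b3⟩ := h'
  have h3 : IsHalfIntegral (d - u) := by simpa using h1.neg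
  simp only [Interlaces] at hn
  rcases le_or_gt i j with hij | hij
  · have a2 := a2 hij
    have b2 := b2 hij
    simp only [hij, not_lt.2 hij, forall_true_left, false_implies, and_true, not_and_or, not_lt]
      at hn
    rcases sq_cases s with hs | hs <;> rcases sq_cases t with ht | ht <;>
      simp only [hs, ht] at b1 b2 hn ⊢ <;> rcases hn with hn | hn <;> try linarith
    · linarith [h1.eq_half (by linarith) (by linarith)]
    · linarith [h2.eq_half (by linarith) (by linarith)]
  · have a2 := a3 hij
    have b2 := b3 hij
    simp only [hij, not_le.2 hij, forall_true_left, false_implies, true_and, not_and_or, not_lt]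
      at hn
    rcases sq_cases s with hs | hs <;> rcases sq_cases t with ht | ht <;>
      simp only [hs, ht] at b1 b2 hn ⊢ <;> rcases hn with hn | hn <;> try linarith
    · linarith [h2.eq_half (by linarith) (by linarith)]
    · linarith [h3.eq_half (by linarith) (by linarith)]

/-- The counterpart of `Interlaces.of_not_lower` with the roles of the two entries interchanged. -/
lemma Interlaces.of_not_upper {i j : ℕ} {u d : ℚ} {s t : ℤˣ} (h : Interlaces i j u d)
    (h' : Interlaces i j (u + sq t) (d + sq s)) (hn : ¬Interlaces i j (u + sq t) d)
    (h1 : IsHalfIntegral (u - d)) (h2 : IsHalfIntegral (u + d)) : sq s * d - sq t * u = 1 / 2 := by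
  obtain ⟨a1, a2, a3⟩ := h
  obtain ⟨b1, b2, b3⟩ := h'
  have h3 : IsHalfIntegral (d - u) := by simpa using h1.neg
  simp only [Interlaces] at hn
  rcases le_or_gt i j with hij | hij
  · have a2 := a2 hij
    have b2 := b2 hij
    simp only [hij, not_lt.2 hij, forall_true_left, false_implies, and_true, not_and_or, not_lt]
      at hn
    rcases sq_cases s with hs | hs <;> rcases sq_cases t with ht | ht <;>
      simp only [hs, ht] at b1 b2 hn ⊢ <;> rcases hn with hn | hn <;> try linarith
    · linarith [h2.eq_half (by linarith) (by linarith)]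
    · linarith [h1.eq_half (by linarith) (by linarith)]
  · have a2 := a3 hij
    have b2 := b3 hij
    simp only [hij, not_le.2 hij, forall_true_left, false_implies, true_and, not_and_or, not_lt]
      at hn
    rcases sq_cases s with hs | hs <;> rcases sq_cases t with ht | ht <;>
      simp only [hs, ht] at b1 b2 hn ⊢ <;> rcases hn with hn | hn <;> try linarith
    · linarith [h3.eq_half (by linarith) (by linarith)]
    · linarith [h2.eq_half (by linarith) (by linarith)]

/-- If a move leads out of the set of tableaux, but a second move in an adjacent row leads back into
it, then the second entry is the one that blocks the first move. -/
lemma sc_sub_eq_half {k k' : ℕ} (h : RowAdj k k') (hk : k + 1 ≤ n)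
    {x y : ℕ × ℤˣ} (hx : some x ∈ moves k) (hξ : IsClassicalTableau n m ξ)
    (hξ' : IsClassicalTableau n m (ξ + mv k (some x) + mv k' (some y)))
    (hn : ¬IsClassicalTableau n m (ξ + mv k (some x))) : sc ξ k' y - sc ξ k x = 1 / 2 := by
  obtain ⟨j, s⟩ := x
  obtain ⟨i, t⟩ := y
  by_contra hne
  refine hn (isClassicalTableau_iff.2 ⟨hξ.toIsArray.add_mv hk hx,
    fun l a b hl hln ha ha' hb hb' => ?_⟩)
  have I1 := hξ.interlaces hln ha ha' hb hb'
  have I2 := hξ'.interlaces hln ha ha' hb hb'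
  have J1 := hξ.isHalfIntegral_sub hln ha ha' hb hb'
  have J2 := hξ.isHalfIntegral_add hln ha ha' hb hb'
  by_contra hcon
  by_cases hlow : l = k ∧ b = j
  · obtain ⟨rfl, rfl⟩ := hlow
    rw [ctr_add_mv_self, ctr_add_mv_of_ne _ _ (by omega)] at hcon
    have e1 : ctr (ξ + mv l (some (b, s)) + mv k' (some (i, t))) l b =
        ctr ξ l b + sq s := by
      rw [ctr_add_mv_of_ne _ _ (fun h1 => h.ne h1.1), ctr_add_mv_self]
    rw [e1, ctr_add_mv, ctr_add_mv_of_ne _ _ (by omega)] at I2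
    by_cases hup : l + 1 = k' ∧ a = i
    · obtain ⟨rfl, rfl⟩ := hup
      rw [if_pos ⟨rfl, rfl⟩] at I2
      exact hne (I1.of_not_lower I2 hcon J1 J2)
    · rw [if_neg hup, add_zero] at I2
      exact hcon I2
  by_cases hup : l + 1 = k ∧ a = j
  · obtain ⟨rfl, rfl⟩ := hup
    rw [ctr_add_mv_self, ctr_add_mv_of_ne _ _ (by omega)] at hcon
    have e1 : ctr (ξ + mv (l + 1) (some (a, s)) + mv k' (some (i, t))) (l + 1) a =
        ctr ξ (l + 1) a + sq s := by
      rw [ctr_add_mv_of_ne _ _ (fun h1 => h.ne h1.1), ctr_add_mv_self]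
    rw [e1, ctr_add_mv, ctr_add_mv_of_ne _ _ (by omega)] at I2
    by_cases hlo : l = k' ∧ b = i
    · obtain ⟨rfl, rfl⟩ := hlo
      rw [if_pos ⟨rfl, rfl⟩] at I2
      refine hne (I1.of_not_upper I2 hcon J1 J2)
    · rw [if_neg hlo, add_zero] at I2
      exact hcon I2
  · rw [ctr_add_mv_of_ne _ _ hlow, ctr_add_mv_of_ne _ _ hup] at hcon
    exact hcon I1

/-- The entries of the rows adjacent to row `k`, as pairs (row, place). -/
def adj (k : ℕ) : Finset (ℕ × ℕ) :=
  ({k + 1} ×ˢ Icc 1 ((k + 1) / 2)) ∪ ({k - 1} ×ˢ Icc 1 ((k - 1) / 2))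

lemma mem_adj {k : ℕ} (hk : 1 ≤ k) {u : ℕ × ℕ} :
    u ∈ adj k ↔ RowAdj k u.1 ∧ 1 ≤ u.2 ∧ u.2 ≤ u.1 / 2 := by
  obtain ⟨a, b⟩ := u
  simp only [adj, mem_union, mem_product, mem_singleton, mem_Icc, RowAdj]
  constructor
  · rintro (⟨rfl, h⟩ | ⟨rfl, h⟩)
    · exact ⟨Or.inl rfl, h⟩
    · exact ⟨Or.inr (by omega), h⟩
  · rintro ⟨rfl | rfl, h⟩
    · exact Or.inl ⟨rfl, h⟩
    · exact Or.inr ⟨by omega, by simpa using h⟩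

/-- A move out of the set of tableaux is blocked by an entry of an adjacent row. -/
lemma exists_blocking {k : ℕ} (hk : k + 1 ≤ n) {x : ℕ × ℤˣ} (hx : some x ∈ moves k)
    (hξ : IsClassicalTableau n m ξ) (hn : ¬IsClassicalTableau n m (ξ + mv k (some x))) :
    ∃ u ∈ adj k, ctr ξ u.1 u.2 + sc ξ k x + 1 / 2 = 0 ∨ ctr ξ u.1 u.2 - sc ξ k x - 1 / 2 = 0 := by
  obtain ⟨j, s⟩ := x
  have hj := some_mem_moves.1 hx
  by_contra! hne
  refine hn (isClassicalTableau_iff.2 ⟨hξ.toIsArray.add_mv hk hx,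
    fun l a b hl hln ha ha' hb hb' => ?_⟩)
  have I1 := hξ.interlaces hln ha ha' hb hb'
  have J1 := hξ.isHalfIntegral_sub hln ha ha' hb hb'
  have J2 := hξ.isHalfIntegral_add hln ha ha' hb hb'
  have J3 : IsHalfIntegral (ctr ξ l b - ctr ξ (l + 1) a) := by simpa using J1.neg
  simp only [sc] at hne
  by_contra hcon
  by_cases hlow : l = k ∧ b = j
  · obtain ⟨rfl, rfl⟩ := hlow
    obtain ⟨n1, n2⟩ := hne (l + 1, a) ((mem_adj (by omega)).2 ⟨Or.inl rfl, ha, ha'⟩)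
    rw [ctr_add_mv_self, ctr_add_mv_of_ne _ _ (by omega)] at hcon
    refine hcon ?_
    obtain ⟨a1, a2, a3⟩ := I1
    dsimp only at n1 n2
    refine ⟨?_, fun hab => ?_, fun hab => ?_⟩ <;> rcases sq_cases s with hs | hs <;>
      rw [hs] at n1 n2 ⊢ <;> by_contra hc
    · linarith
    · exact n2 (by linarith [J2.eq_half (by linarith) (by linarith)])
    · exact n2 (by linarith [J1.eq_half (by linarith [a2 hab]) (by linarith)])
    · linarith [a2 hab]
    · linarith [a3 hab]
    · exact n1 (by linarith [J3.eq_half (by linarith [a3 hab]) (by linarith)])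
  by_cases hup : l + 1 = k ∧ a = j
  · obtain ⟨rfl, rfl⟩ := hup
    obtain ⟨n1, n2⟩ := hne (l, b) ((mem_adj (by omega)).2 ⟨Or.inr rfl, hb, hb'⟩)
    rw [ctr_add_mv_self, ctr_add_mv_of_ne _ _ (by omega)] at hcon
    refine hcon ?_
    obtain ⟨a1, a2, a3⟩ := I1
    dsimp only at n1 n2
    refine ⟨?_, fun hab => ?_, fun hab => ?_⟩ <;> rcases sq_cases s with hs | hs <;>
      rw [hs] at n1 n2 ⊢ <;> by_contra hc
    · linarith
    · exact n2 (by linarith [J2.eq_half (by linarith) (by linarith)])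
    · linarith [a2 hab]
    · exact n1 (by linarith [J1.eq_half (by linarith [a2 hab]) (by linarith)])
    · exact n2 (by linarith [J3.eq_half (by linarith [a3 hab]) (by linarith)])
    · linarith [a3 hab]
  · rw [ctr_add_mv_of_ne _ _ hlow, ctr_add_mv_of_ne _ _ hup] at hcon
    exact hcon I1

/-! ### The coefficients in centred coordinates -/

/-- With `f a = [|a|]^{1/2}` this is the root in the coefficient of the move in row `k` that adds a
sign `s` to the `j`-th entry, where `a` is the signed coordinate of that move. The same formula
covers raising and lowering, and both parities of `k`. -/
noncomputable def rt (f : ℚ → ℂ) (ξ : ℕ → ℕ → ℚ) (k j : ℕ) (a : ℚ) : ℂ :=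
  (∏ u ∈ adj k, f (ctr ξ u.1 u.2 + a + 1 / 2) * f (ctr ξ u.1 u.2 - a - 1 / 2)) /
    ∏ i ∈ (Icc 1 (k / 2)).erase j,
      f (ctr ξ k i + a) * f (ctr ξ k i - a) * f (ctr ξ k i + a + 1) * f (ctr ξ k i - a - 1)

/-- The rational factor in the coefficient of a move with signed coordinate `a`. -/
noncomputable def wt (h : ℂ) (k : ℕ) (a : ℚ) : ℂ :=
  if Odd k then 1 / (qNum h (2 * a) * qNumPlus h (a + 1 / 2)) else 1 / (qPow h a - qPow h (-a))

/-- The diagonal coefficient of the operator that acts on an odd row `k`. -/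
noncomputable def dg (h : ℂ) (ε : ℕ → ℤˣ) (k : ℕ) (ξ : ℕ → ℕ → ℚ) : ℂ :=
  sgn (ε (k + 1)) * ((∏ u ∈ adj k, qNumPlus h (ctr ξ u.1 u.2)) /
    ∏ i ∈ Icc 1 (k / 2), qNumPlus h (ctr ξ k i + 1 / 2) * qNumPlus h (ctr ξ k i - 1 / 2))

/-- The coefficient of a move in row `k`, applied to the array `ξ`. -/
noncomputable def coef (h : ℂ) (r : ℚ → ℂ) (ε : ℕ → ℤˣ) (k : ℕ) :
    Option (ℕ × ℤˣ) → (ℕ → ℕ → ℚ) → ℂ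
  | none, ξ => dg h ε k ξ
  | some x, ξ => wt h k (sc ξ k x) * rt (fun a => r |a|) ξ k x.1 (sc ξ k x)

open Classical in
/-- The coefficient of a move, set to zero unless the move connects two classical tableaux. -/
noncomputable def cf (n : ℕ) (m : ℕ → ℚ) (h : ℂ) (r : ℚ → ℂ) (ε : ℕ → ℤˣ) (k : ℕ)
    (x : Option (ℕ × ℤˣ)) (ξ : ℕ → ℕ → ℚ) : ℂ :=
  if IsClassicalTableau n m ξ ∧ IsClassicalTableau n m (ξ + mv k x) then coef h r ε k x ξ else 0

/-- The multiplicative coordinate of a move: `q^a` for the signed coordinate `a`. The diagonal term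
behaves like a move with the coordinate `-1/2 + iπ/(2h)`. -/
noncomputable def tt (h : ℂ) (ξ : ℕ → ℕ → ℚ) (k : ℕ) : Option (ℕ × ℤˣ) → ℂ
  | none => Complex.I * qPow h (-(1 / 2))
  | some x => qPow h (sc ξ k x)

/-- The part of `rt` that does not involve the entry `u₀` of an adjacent row. -/
noncomputable def rtErase (f : ℚ → ℂ) (ξ : ℕ → ℕ → ℚ) (k j : ℕ) (a : ℚ) (u₀ : ℕ × ℕ) : ℂ :=
  (∏ u ∈ (adj k).erase u₀, f (ctr ξ u.1 u.2 + a + 1 / 2) * f (ctr ξ u.1 u.2 - a - 1 / 2)) /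
    ∏ i ∈ (Icc 1 (k / 2)).erase j,
      f (ctr ξ k i + a) * f (ctr ξ k i - a) * f (ctr ξ k i + a + 1) * f (ctr ξ k i - a - 1)

section Formulas

variable {f : ℚ → ℂ} {ξ : ℕ → ℕ → ℚ} {k k' : ℕ}

lemma mv_none (k : ℕ) : mv k none = 0 := rfl

lemma sq_mul_sc (ξ : ℕ → ℕ → ℚ) (k i : ℕ) (t : ℤˣ) : ctr ξ k i = sq t * sc ξ k (i, t) := by
  rw [sc, ← mul_assoc, sq_mul_self, one_mul]

lemma ctr_adj_add_mv {k : ℕ} (hk : 1 ≤ k) (ξ : ℕ → ℕ → ℚ) (x : ℕ × ℤˣ) {u : ℕ × ℕ}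
    (hu : u ∈ adj k) : ctr (ξ + mv k (some x)) u.1 u.2 = ctr ξ u.1 u.2 :=
  ctr_add_mv_of_ne _ _ fun h => ((mem_adj hk).1 hu).1.ne h.1.symm

lemma sq_mul_ctr (ξ : ℕ → ℕ → ℚ) (k i : ℕ) (t : ℤˣ) : sq t * ctr ξ k i = sc ξ k (i, t) := rfl

/-- The coefficients of a move and of the opposite move back contain the same root. -/
lemma rt_opp (hk : 1 ≤ k) (f : ℚ → ℂ) (ξ : ℕ → ℕ → ℚ) (x : ℕ × ℤˣ) (a : ℚ) :
    rt f (ξ + mv k (some x)) k x.1 (-(a + 1)) = rt f ξ k x.1 a := by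
  rw [rt, rt]
  congr 1
  · refine prod_congr rfl fun u hu => ?_
    rw [ctr_adj_add_mv hk ξ x hu, mul_comm]
    congr 2 <;> ring
  · refine prod_congr rfl fun i hi => ?_
    rw [ctr_add_mv_of_ne ξ x.2 fun h => ne_of_mem_erase hi h.2]
    rw [show ctr ξ k i + -(a + 1) = ctr ξ k i - a - 1 by ring,
      show ctr ξ k i - -(a + 1) = ctr ξ k i + a + 1 by ring,
      show ctr ξ k i - a - 1 + 1 = ctr ξ k i - a by ring,
      show ctr ξ k i + a + 1 - 1 = ctr ξ k i + a by ring]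
    ring

lemma rt_eq_mul_rtErase (hf : ∀ x y, f (-x) * f (-y) = f x * f y) (hk : 1 ≤ k)
    (h : RowAdj k k') {y : ℕ × ℤˣ} (hy : some y ∈ moves k') (ξ : ℕ → ℕ → ℚ) (j : ℕ) (a : ℚ) :
    rt f ξ k j a = f (sc ξ k' y + a + 1 / 2) * f (sc ξ k' y - a - 1 / 2) *
      rtErase f ξ k j a (k', y.1) := by
  obtain ⟨i, t⟩ := y
  have hy := some_mem_moves.1 hy
  rw [rt, rtErase, ← mul_prod_erase (adj k) _ ((mem_adj hk (u := (k', i))).2 ⟨h, hy⟩),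
    mul_div_assoc]
  congr 1
  dsimp only
  rw [sq_mul_sc ξ k' i t]
  rcases sq_cases t with ht | ht <;> rw [ht]
  · rw [one_mul]
  · rw [mul_comm, ← hf]
    congr 2 <;> ring

lemma rtErase_add_mv (f : ℚ → ℂ) (ξ : ℕ → ℕ → ℚ) (h : RowAdj k k') (y : ℕ × ℤˣ)
    (j : ℕ) (a : ℚ) : rtErase f (ξ + mv k' (some y)) k j a (k', y.1) =
      rtErase f ξ k j a (k', y.1) := by
  rw [rtErase, rtErase]
  congr 1
  · refine prod_congr rfl fun u hu => ?_
    rw [ctr_add_mv_of_ne ξ y.2 fun h => ne_of_mem_erase hu (Prod.ext h.1 h.2)]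
  · refine prod_congr rfl fun i hi => ?_
    rw [ctr_add_mv_of_ne ξ y.2 fun h' => h.ne h'.1]

/-- The dependence of a root on the signed coordinate of an entry in the same row. -/
lemma exists_rt_same_row (hf : ∀ x y, f (-x) * f (-y) = f x * f y) (hk : 1 ≤ k) {y : ℕ × ℤˣ}
    (hy : some y ∈ moves k) {j : ℕ} (hj : y.1 ≠ j) (ξ : ℕ → ℕ → ℚ) (a : ℚ) : ∃ R,
      rt f ξ k j a = R / (f (sc ξ k y + a) * f (sc ξ k y - a) * f (sc ξ k y + a + 1) *
        f (sc ξ k y - a - 1)) ∧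
      rt f (ξ + mv k (some y)) k j a = R / (f (sc ξ k y + 1 + a) * f (sc ξ k y + 1 - a) *
        f (sc ξ k y + 1 + a + 1) * f (sc ξ k y + 1 - a - 1)) := by
  obtain ⟨i, t⟩ := y
  have hi : i ∈ (Icc 1 (k / 2)).erase j := mem_erase.2 ⟨hj, mem_Icc.2 (some_mem_moves.1 hy)⟩
  have key : ∀ b, f (sq t * b + a) * f (sq t * b - a) * f (sq t * b + a + 1) *
      f (sq t * b - a - 1) = f (b + a) * f (b - a) * f (b + a + 1) * f (b - a - 1) := by
    intro b
    rcases sq_cases t with ht | ht <;> rw [ht]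
    · rw [one_mul]
    · have h1 := hf (b + a) (b - a)
      have h2 := hf (b + a + 1) (b - a - 1)
      rw [show -(b + a) = -1 * b - a by ring, show -(b - a) = -1 * b + a by ring] at h1
      rw [show -(b + a + 1) = -1 * b - a - 1 by ring,
        show -(b - a - 1) = -1 * b + a + 1 by ring] at h2
      linear_combination f (-1 * b + a + 1) * f (-1 * b - a - 1) * h1 +
        f (b + a) * f (b - a) * h2
  refine ⟨(∏ u ∈ adj k, f (ctr ξ u.1 u.2 + a + 1 / 2) * f (ctr ξ u.1 u.2 - a - 1 / 2)) /
    ∏ i ∈ ((Icc 1 (k / 2)).erase j).erase i, f (ctr ξ k i + a) * f (ctr ξ k i - a) *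
      f (ctr ξ k i + a + 1) * f (ctr ξ k i - a - 1), ?_, ?_⟩
  · rw [rt, ← mul_prod_erase _ _ hi, ← key, sq_mul_ctr, div_mul_eq_div_div_swap]
  · rw [rt, ← mul_prod_erase _ _ hi, ← key, sq_mul_ctr, div_mul_eq_div_div_swap, sc_add_mv_self]
    congr 2
    · exact prod_congr rfl fun u hu => by rw [ctr_adj_add_mv hk ξ (i, t) hu]
    · refine prod_congr rfl fun l hl => ?_
      rw [ctr_add_mv_of_ne ξ t fun h => ne_of_mem_erase hl h.2]

lemma exists_dg_adj (h : ℂ) (ε : ℕ → ℤˣ) (hk : 1 ≤ k) (hkk : RowAdj k k') {y : ℕ × ℤˣ}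
    (hy : some y ∈ moves k') (ξ : ℕ → ℕ → ℚ) : ∃ R,
      dg h ε k ξ = qNumPlus h (sc ξ k' y) * R ∧
      dg h ε k (ξ + mv k' (some y)) = qNumPlus h (sc ξ k' y + 1) * R ∧
      R = sgn (ε (k + 1)) * ((∏ u ∈ (adj k).erase (k', y.1), qNumPlus h (ctr ξ u.1 u.2)) /
        ∏ i ∈ Icc 1 (k / 2), qNumPlus h (ctr ξ k i + 1 / 2) * qNumPlus h (ctr ξ k i - 1 / 2)) := by
  obtain ⟨i, t⟩ := y
  have hy := some_mem_moves.1 hy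
  have key : ∀ b, qNumPlus h (sq t * b) = qNumPlus h b := by
    intro b
    rcases sq_cases t with ht | ht <;> rw [ht]
    · rw [one_mul]
    · rw [neg_one_mul, qNumPlus_neg]
  refine ⟨_, ?_, ?_, rfl⟩
  · rw [dg, ← mul_prod_erase (adj k) _ ((mem_adj hk (u := (k', i))).2 ⟨hkk, hy⟩)]
    dsimp only
    rw [sq_mul_sc ξ k' i t, key]
    ring
  · rw [dg, ← mul_prod_erase (adj k) _ ((mem_adj hk (u := (k', i))).2 ⟨hkk, hy⟩)]
    dsimp only
    rw [sq_mul_sc _ k' i t, key, sc_add_mv_self]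
    have e1 : ∏ u ∈ (adj k).erase (k', i), qNumPlus h (ctr (ξ + mv k' (some (i, t))) u.1 u.2) =
        ∏ u ∈ (adj k).erase (k', i), qNumPlus h (ctr ξ u.1 u.2) :=
      prod_congr rfl fun u hu => by
        rw [ctr_add_mv_of_ne ξ t fun h => ne_of_mem_erase hu (Prod.ext h.1 h.2)]
    have e2 : ∏ j ∈ Icc 1 (k / 2), qNumPlus h (ctr (ξ + mv k' (some (i, t))) k j + 1 / 2) *
          qNumPlus h (ctr (ξ + mv k' (some (i, t))) k j - 1 / 2) =
        ∏ j ∈ Icc 1 (k / 2), qNumPlus h (ctr ξ k j + 1 / 2) * qNumPlus h (ctr ξ k j - 1 / 2) :=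
      prod_congr rfl fun u hu => by rw [ctr_add_mv_of_ne ξ t fun h' => hkk.ne h'.1]
    rw [e1, e2]
    ring

lemma exists_dg_same_row (h : ℂ) (ε : ℕ → ℤˣ) (hk : 1 ≤ k) {y : ℕ × ℤˣ}
    (hy : some y ∈ moves k) (ξ : ℕ → ℕ → ℚ) : ∃ R,
      dg h ε k ξ = R / (qNumPlus h (sc ξ k y + 1 / 2) * qNumPlus h (sc ξ k y - 1 / 2)) ∧
      dg h ε k (ξ + mv k (some y)) =
        R / (qNumPlus h (sc ξ k y + 3 / 2) * qNumPlus h (sc ξ k y + 1 / 2)) := by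
  obtain ⟨i, t⟩ := y
  have hi : i ∈ Icc 1 (k / 2) := mem_Icc.2 (some_mem_moves.1 hy)
  have key : ∀ b, qNumPlus h (sq t * b + 1 / 2) * qNumPlus h (sq t * b - 1 / 2) =
      qNumPlus h (b + 1 / 2) * qNumPlus h (b - 1 / 2) := by
    intro b
    rcases sq_cases t with ht | ht <;> rw [ht]
    · rw [one_mul]
    · rw [mul_comm, ← qNumPlus_neg h (b + 1 / 2), ← qNumPlus_neg h (b - 1 / 2)]
      congr 2 <;> ring
  refine ⟨sgn (ε (k + 1)) * ((∏ u ∈ adj k, qNumPlus h (ctr ξ u.1 u.2)) /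
    ∏ i ∈ (Icc 1 (k / 2)).erase i,
      qNumPlus h (ctr ξ k i + 1 / 2) * qNumPlus h (ctr ξ k i - 1 / 2)), ?_, ?_⟩
  · rw [dg, ← mul_prod_erase _ _ hi, ← key, sq_mul_ctr, div_mul_eq_div_div_swap, mul_div_assoc]
  · rw [dg, ← mul_prod_erase _ _ hi, ← key, sq_mul_ctr, div_mul_eq_div_div_swap, mul_div_assoc,
      sc_add_mv_self, show sc ξ k (i, t) + 3 / 2 = sc ξ k (i, t) + 1 + 1 / 2 by ring,
      show sc ξ k (i, t) + 1 / 2 = sc ξ k (i, t) + 1 - 1 / 2 by ring]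
    congr 3
    · exact prod_congr rfl fun u hu => by rw [ctr_adj_add_mv hk ξ (i, t) hu]
    · refine prod_congr rfl fun l hl => ?_
      rw [ctr_add_mv_of_ne ξ t fun h => ne_of_mem_erase hl h.2]

end Formulas

/-! ### The square roots -/

lemma qNum_abs_of_nonneg (h : ℂ) {a : ℚ} (ha : 0 ≤ a) : qNum h |a| = qNum h a := by
  rw [abs_of_nonneg ha]

lemma qNum_abs_of_nonpos (h : ℂ) {a : ℚ} (ha : a ≤ 0) : qNum h |a| = -qNum h a := by
  rw [abs_of_nonpos ha, qNum_neg]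

section Squares

variable {h : ℂ} {r : ℚ → ℂ} {n : ℕ} {m : ℕ → ℚ} {ξ : ℕ → ℕ → ℚ}

lemma prod_sign_le (N j : ℕ) :
    ∏ i ∈ Icc 1 N, (if i ≤ j then (1 : ℂ) else -1) = (-1) ^ (N - j) := by
  rw [prod_ite, prod_const_one, one_mul, prod_const]
  congr 1
  have : (Icc 1 N).filter (fun i => ¬i ≤ j) = Ioc j N := by
    ext i
    simp only [mem_filter, mem_Icc, mem_Ioc]
    omega
  rw [this, Nat.card_Ioc]

lemma qNum_abs_mul_of_above {u x : ℚ} {s : ℤˣ} (h1 : 1 / 2 ≤ u + x) (h2 : 1 / 2 ≤ u - x) :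
    qNum h |u + sq s * x + 1 / 2| * qNum h |u - sq s * x - 1 / 2| =
      qNum h (u + sq s * x + 1 / 2) * qNum h (u - sq s * x - 1 / 2) := by
  rcases sq_cases s with hs | hs <;> rw [hs, qNum_abs_of_nonneg h (by linarith),
    qNum_abs_of_nonneg h (by linarith)]

lemma qNum_abs_mul_of_below {u x : ℚ} {s : ℤˣ} (h1 : 1 / 2 ≤ u + x) (h2 : 1 / 2 ≤ x - u) :
    qNum h |u + sq s * x + 1 / 2| * qNum h |u - sq s * x - 1 / 2| =
      -(qNum h (u + sq s * x + 1 / 2) * qNum h (u - sq s * x - 1 / 2)) := by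
  rcases sq_cases s with hs | hs <;> rw [hs]
  · rw [qNum_abs_of_nonneg h (by linarith), qNum_abs_of_nonpos h (by linarith)]
    ring
  · rw [qNum_abs_of_nonpos h (by linarith), qNum_abs_of_nonneg h (by linarith)]
    ring

lemma qNum_abs_mul_same_row {y x : ℚ} {s : ℤˣ} (h1 : 1 ≤ y + x)
    (h2 : 1 ≤ y - x ∨ 1 ≤ x - y) :
    qNum h |y + sq s * x| * qNum h |y - sq s * x| * qNum h |y + sq s * x + 1| *
        qNum h |y - sq s * x - 1| =
      qNum h (y + sq s * x) * qNum h (y - sq s * x) * qNum h (y + sq s * x + 1) *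
        qNum h (y - sq s * x - 1) := by
  rcases h2 with h2 | h2 <;> rcases sq_cases s with hs | hs <;> rw [hs]
  · rw [qNum_abs_of_nonneg h (by linarith), qNum_abs_of_nonneg h (by linarith),
      qNum_abs_of_nonneg h (by linarith), qNum_abs_of_nonneg h (by linarith)]
  · rw [qNum_abs_of_nonneg h (by linarith), qNum_abs_of_nonneg h (by linarith),
      qNum_abs_of_nonneg h (by linarith), qNum_abs_of_nonneg h (by linarith)]
  · rw [qNum_abs_of_nonneg h (by linarith), qNum_abs_of_nonpos h (by linarith),
      qNum_abs_of_nonneg h (by linarith), qNum_abs_of_nonpos h (by linarith)]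
    ring
  · rw [qNum_abs_of_nonpos h (by linarith), qNum_abs_of_nonneg h (by linarith),
      qNum_abs_of_nonpos h (by linarith), qNum_abs_of_nonneg h (by linarith)]
    ring

/-- The number of negative `q`-numbers under a root is even. -/
lemma rt_abs_sq (hr : ∀ a : ℚ, 0 ≤ a → r a ^ 2 = qNum h a) (hξ : IsClassicalTableau n m ξ) {k : ℕ}
    (hk : k + 1 ≤ n) {x : ℕ × ℤˣ} (hx : some x ∈ moves k) :
    rt (fun a => r |a|) ξ k x.1 (sc ξ k x) ^ 2 = rt (qNum h) ξ k x.1 (sc ξ k x) := by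
  obtain ⟨j, s⟩ := x
  obtain ⟨hj, hj'⟩ := some_mem_moves.1 hx
  rw [rt, rt, div_pow, ← prod_pow, ← prod_pow]
  simp only [mul_pow, hr _ (abs_nonneg _), sc]
  have hden : ∀ i ∈ (Icc 1 (k / 2)).erase j,
      qNum h |ctr ξ k i + sq s * ctr ξ k j| * qNum h |ctr ξ k i - sq s * ctr ξ k j| *
        qNum h |ctr ξ k i + sq s * ctr ξ k j + 1| * qNum h |ctr ξ k i - sq s * ctr ξ k j - 1| =
      qNum h (ctr ξ k i + sq s * ctr ξ k j) * qNum h (ctr ξ k i - sq s * ctr ξ k j) *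
        qNum h (ctr ξ k i + sq s * ctr ξ k j + 1) * qNum h (ctr ξ k i - sq s * ctr ξ k j - 1) := by
    intro i hi
    obtain ⟨hij, hi⟩ := mem_erase.1 hi
    obtain ⟨hi, hi'⟩ := mem_Icc.1 hi
    have i1 := hξ.isInt_add (by omega : k ≤ n) hi hi' hj hj'
    have i2 := hξ.isInt_sub (by omega : k ≤ n) hi hi' hj hj'
    have i3 := hξ.isInt_sub (by omega : k ≤ n) hj hj' hi hi'
    rcases lt_or_gt_of_ne hij with hlt | hlt
    · obtain ⟨b1, b2⟩ := abs_lt.1 (hξ.abs_ctr_lt hk hi hlt hj')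
      exact qNum_abs_mul_same_row (one_le_of_int i1 (by linarith))
        (Or.inl (one_le_of_int i2 (by linarith)))
    · obtain ⟨b1, b2⟩ := abs_lt.1 (hξ.abs_ctr_lt hk hj hlt hi')
      exact qNum_abs_mul_same_row (one_le_of_int i1 (by linarith))
        (Or.inr (one_le_of_int i3 (by linarith)))
  rw [prod_congr rfl hden]
  congr 1
  have hdisj : Disjoint ({k + 1} ×ˢ Icc 1 ((k + 1) / 2) : Finset (ℕ × ℕ))
      ({k - 1} ×ˢ Icc 1 ((k - 1) / 2)) := by
    rw [disjoint_left]
    rintro ⟨a, b⟩ h1 h2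
    simp only [mem_product, mem_singleton] at h1 h2
    omega
  have hup : ∀ i ∈ Icc 1 ((k + 1) / 2),
      qNum h |ctr ξ (k + 1) i + sq s * ctr ξ k j + 1 / 2| *
          qNum h |ctr ξ (k + 1) i - sq s * ctr ξ k j - 1 / 2| =
        (if i ≤ j then 1 else -1) * (qNum h (ctr ξ (k + 1) i + sq s * ctr ξ k j + 1 / 2) *
          qNum h (ctr ξ (k + 1) i - sq s * ctr ξ k j - 1 / 2)) := by
    intro i hi
    obtain ⟨hi, hi'⟩ := mem_Icc.1 hi
    obtain ⟨a1, a2, a3⟩ := hξ.interlaces hk hi hi' hj hj'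
    have i1 := (hξ.isHalfIntegral_add hk hi hi' hj hj').half_le a1
    have i2 := hξ.isHalfIntegral_sub hk hi hi' hj hj'
    split_ifs with hij
    · rw [one_mul, qNum_abs_mul_of_above i1 (i2.half_le (by linarith [a2 hij]))]
    · rw [neg_one_mul, qNum_abs_mul_of_below i1]
      rw [← neg_sub]
      exact i2.neg.half_le (by linarith [a3 (by omega)])
  have hlow : ∀ i ∈ Icc 1 ((k - 1) / 2),
      qNum h |ctr ξ (k - 1) i + sq s * ctr ξ k j + 1 / 2| *
          qNum h |ctr ξ (k - 1) i - sq s * ctr ξ k j - 1 / 2| =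
        (if i ≤ j - 1 then 1 else -1) * (qNum h (ctr ξ (k - 1) i + sq s * ctr ξ k j + 1 / 2) *
          qNum h (ctr ξ (k - 1) i - sq s * ctr ξ k j - 1 / 2)) := by
    intro i hi
    obtain ⟨hi1, hi'⟩ := mem_Icc.1 hi
    obtain ⟨l, rfl⟩ : ∃ l, k = l + 1 := ⟨k - 1, by omega⟩
    rw [Nat.add_sub_cancel] at hi' ⊢
    obtain ⟨a1, a2, a3⟩ := hξ.interlaces (by omega) hj hj' hi1 hi'
    have i1 := (hξ.isHalfIntegral_add (by omega) hj hj' hi1 hi').half_le a1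
    have i2 := hξ.isHalfIntegral_sub (by omega) hj hj' hi1 hi'
    rw [add_comm] at i1
    split_ifs with hij
    · rw [one_mul, qNum_abs_mul_of_above i1]
      rw [← neg_sub]
      exact i2.neg.half_le (by linarith [a3 (by omega)])
    · rw [neg_one_mul, qNum_abs_mul_of_below i1 (i2.half_le (by linarith [a2 (by omega)]))]
  rw [adj, prod_union hdisj, prod_union hdisj]
  simp only [prod_product, prod_singleton]
  rw [prod_congr rfl hup, prod_congr rfl hlow,
    prod_mul_distrib (f := fun i => if i ≤ j then (1 : ℂ) else -1),
    prod_mul_distrib (f := fun i => if i ≤ j - 1 then (1 : ℂ) else -1), prod_sign_le, prod_sign_le,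
    mul_mul_mul_comm, ← pow_add,
    Even.neg_one_pow, one_mul]
  obtain ⟨p, rfl | rfl⟩ := Nat.even_or_odd' k
  · rw [show (2 * p + 1) / 2 - j + ((2 * p - 1) / 2 - (j - 1)) = 2 * (p - j) by omega]
    simp
  · rw [show (2 * p + 1 + 1) / 2 - j + ((2 * p + 1 - 1) / 2 - (j - 1)) = 2 * (p - j + 1) by omega]
    simp

/-- The product of the coefficients of a move and of its opposite. -/
lemma cf_mul_cf_opp {ε : ℕ → ℤˣ} (hr : ∀ a : ℚ, 0 ≤ a → r a ^ 2 = qNum h a)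
    (hξ : IsClassicalTableau n m ξ) {k : ℕ} (hk : k + 1 ≤ n) {x : ℕ × ℤˣ}
    (hx : some x ∈ moves k) :
    cf n m h r ε k (some x) ξ * cf n m h r ε k (opp (some x)) (ξ + mv k (some x)) =
      wt h k (sc ξ k x) * wt h k (-(sc ξ k x + 1)) * rt (qNum h) ξ k x.1 (sc ξ k x) := by
  have hk1 : 1 ≤ k := by
    obtain ⟨j, s⟩ := x
    have := some_mem_moves.1 hx
    omega
  by_cases hP : IsClassicalTableau n m (ξ + mv k (some x))
  · have e1 : sc (ξ + mv k (some x)) k (x.1, -x.2) = -(sc ξ k x + 1) := by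
      rw [sc_neg, ← sc_add_mv_self]
    rw [cf, cf, if_pos ⟨hξ, hP⟩, if_pos ⟨hP, by rw [mv_opp, add_neg_cancel_right]; exact hξ⟩]
    simp only [coef, opp, Option.map_some]
    rw [e1, rt_opp hk1, ← rt_abs_sq hr hξ hk hx]
    ring
  · rw [cf, if_neg (fun hh => hP hh.2), zero_mul, rt]
    obtain ⟨u, hu, hu'⟩ := exists_blocking hk hx hξ hP
    rw [prod_eq_zero hu, zero_div, mul_zero]
    rcases hu' with h0 | h0 <;> rw [h0, qNum_zero]
    · rw [zero_mul]
    · rw [mul_zero]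

end Squares

/-! ### The exchange relations -/

section Exchange

variable {h : ℂ} {r : ℚ → ℂ} {n : ℕ} {m : ℕ → ℚ} {ε : ℕ → ℤˣ} {ξ ξ' : ℕ → ℕ → ℚ} {k k' : ℕ}

lemma br_qPow (hq : ∀ k : ℕ, 0 < k → Complex.exp h ^ k ≠ 1) (a : ℚ) :
    br (qPow h a) = (qPow h 1 - qPow h (-1)) * qNum h a := by
  rw [br, qNum, mul_div_cancel₀ _ (qPow_sub_qPow_neg_ne_zero hq one_ne_zero), qPow_neg]

lemma br_inv (z : ℂ) : br z⁻¹ = -br z := by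
  rw [br, br, inv_inv, neg_sub]

lemma br_qPow_div_I (hq : ∀ k : ℕ, 0 < k → Complex.exp h ^ k ≠ 1) (a : ℚ) :
    br (qPow h a / Complex.I) = -Complex.I * (qPow h 1 - qPow h (-1)) * qNumPlus h a := by
  rw [br, qNumPlus, mul_assoc, mul_div_cancel₀ _ (qPow_sub_qPow_neg_ne_zero hq one_ne_zero),
    inv_div, qPow_neg, div_eq_mul_inv, div_eq_mul_inv, Complex.inv_I]
  ring

lemma tt_ne_zero (h : ℂ) (ξ : ℕ → ℕ → ℚ) (k : ℕ) (x : Option (ℕ × ℤˣ)) : tt h ξ k x ≠ 0 := by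
  rcases x with _ | x
  · exact mul_ne_zero Complex.I_ne_zero (qPow_ne_zero _ _)
  · exact qPow_ne_zero _ _

lemma IsHalfIntegral.exchange {t : ℚ} (ht : IsHalfIntegral t) (h : ℂ) :
    qNum h |t - 1 / 2| * qNum h (t + 1 / 2) = qNum h |t + 1 / 2| * qNum h (t - 1 / 2) := by
  obtain ⟨z, rfl⟩ := ht
  rcases le_or_gt 0 z with hz | hz
  · have : (0 : ℚ) ≤ z := by exact_mod_cast hz
    rw [qNum_abs_of_nonneg h (by linarith), qNum_abs_of_nonneg h (by linarith), mul_comm]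
  · have : (z : ℚ) ≤ -1 := by exact_mod_cast (by omega : z ≤ -1)
    rw [qNum_abs_of_nonpos h (by linarith), qNum_abs_of_nonpos h (by linarith)]
    ring

lemma coef_exchange_none_some (hq : ∀ k : ℕ, 0 < k → Complex.exp h ^ k ≠ 1) (hk : 1 ≤ k)
    (hkk : RowAdj k k') {y : ℕ × ℤˣ} (hy : some y ∈ moves k') :
    dg h ε k ξ * br (qPow h (1 / 2) * (tt h ξ k' (some y) / tt h ξ k none)) =
      dg h ε k (ξ + mv k' (some y)) *
        br ((qPow h (1 / 2))⁻¹ * (tt h ξ k' (some y) / tt h ξ k none)) := by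
  obtain ⟨R, h1, h2, -⟩ := exists_dg_adj h ε hk hkk hy ξ
  have e1 : qPow h (1 / 2) * (tt h ξ k' (some y) / tt h ξ k none) =
      qPow h (sc ξ k' y + 1) / Complex.I := by
    rw [tt, tt, show sc ξ k' y + 1 = 1 / 2 + sc ξ k' y - -(1 / 2) by ring, qPow_sub, qPow_add]
    field_simp
  have e2 : (qPow h (1 / 2))⁻¹ * (tt h ξ k' (some y) / tt h ξ k none) =
      qPow h (sc ξ k' y) / Complex.I := by
    have := qPow_ne_zero h (1 / 2)
    rw [tt, tt, qPow_neg]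
    field_simp
  rw [h1, h2, e1, e2, br_qPow_div_I hq, br_qPow_div_I hq]
  ring

/-- The exchange relation for moves in adjacent rows. -/
lemma cf_exchange (hq : ∀ k : ℕ, 0 < k → Complex.exp h ^ k ≠ 1)
    (hr : ∀ a : ℚ, 0 ≤ a → r a ^ 2 = qNum h a) (hk : 1 ≤ k) (hk' : 1 ≤ k') (hkn : k + 1 ≤ n)
    (hkn' : k' + 1 ≤ n) (hkk : RowAdj k k') {x y : Option (ℕ × ℤˣ)} (hx : x ∈ moves k)
    (hy : y ∈ moves k') (ξ : ℕ → ℕ → ℚ) :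
    cf n m h r ε k x ξ * cf n m h r ε k' y (ξ + mv k x) *
        br (qPow h (1 / 2) * (tt h ξ k' y / tt h ξ k x)) =
      cf n m h r ε k' y ξ * cf n m h r ε k x (ξ + mv k' y) *
        br ((qPow h (1 / 2))⁻¹ * (tt h ξ k' y / tt h ξ k x)) := by
  by_cases hP : IsClassicalTableau n m ξ ∧ IsClassicalTableau n m (ξ + mv k x + mv k' y)
  swap
  · have h1 : cf n m h r ε k x ξ * cf n m h r ε k' y (ξ + mv k x) = 0 := by
      rw [cf, cf]; split_ifs <;> simp_all
    have h2 : cf n m h r ε k' y ξ * cf n m h r ε k x (ξ + mv k' y) = 0 := by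
      rw [cf, cf, add_right_comm]; split_ifs <;> simp_all
    rw [h1, h2, zero_mul, zero_mul]
  obtain ⟨hξ, hξ2⟩ := hP
  have hξ2' : IsClassicalTableau n m (ξ + mv k' y + mv k x) := by rwa [add_right_comm]
  rcases x with _ | x <;> rcases y with _ | y
  · have h1 := none_mem_moves.1 hx
    have h2 := none_mem_moves.1 hy
    rcases hkk with rfl | rfl
    · exact absurd h1 (Nat.odd_add_one.1 h2)
    · exact absurd h2 (Nat.odd_add_one.1 h1)
  · simp only [mv_none, add_zero] at *
    rw [cf, cf, cf, if_pos ⟨hξ, by simpa [mv_none]⟩, if_pos ⟨hξ, hξ2⟩,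
      if_pos ⟨hξ2, by simpa [mv_none]⟩]
    simp only [coef]
    linear_combination wt h k' (sc ξ k' y) * rt (fun a => r |a|) ξ k' y.1 (sc ξ k' y) *
      coef_exchange_none_some (ε := ε) (ξ := ξ) hq hk hkk hy
  · simp only [mv_none, add_zero] at *
    rw [cf, cf, cf, if_pos ⟨hξ, hξ2⟩, if_pos ⟨hξ2, by simpa [mv_none]⟩,
      if_pos ⟨hξ, by simpa [mv_none]⟩]
    simp only [coef]
    have := coef_exchange_none_some (ε := ε) (ξ := ξ) hq hk' hkk.symm hx
    have e1 : qPow h (1 / 2) * (tt h ξ k (some x) / tt h ξ k' none) =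
        ((qPow h (1 / 2))⁻¹ * (tt h ξ k' none / tt h ξ k (some x)))⁻¹ := by
      rw [mul_inv, inv_inv, inv_div]
    have e2 : (qPow h (1 / 2))⁻¹ * (tt h ξ k (some x) / tt h ξ k' none) =
        (qPow h (1 / 2) * (tt h ξ k' none / tt h ξ k (some x)))⁻¹ := by
      rw [mul_inv, inv_div]
    rw [e1, e2, br_inv, br_inv] at this
    linear_combination wt h k (sc ξ k x) * rt (fun a => r |a|) ξ k x.1 (sc ξ k x) * this
  · set t := sc ξ k' y - sc ξ k x with ht
    have hhalf : IsHalfIntegral t := hξ.isHalfIntegral_sc hkk (by omega) (by omega) hx hy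
    have e1 : qPow h (1 / 2) * (tt h ξ k' (some y) / tt h ξ k (some x)) = qPow h (t + 1 / 2) := by
      rw [tt, tt, ← qPow_sub, ← qPow_add, add_comm]
    have e2 : (qPow h (1 / 2))⁻¹ * (tt h ξ k' (some y) / tt h ξ k (some x)) =
        qPow h (t - 1 / 2) := by
      rw [tt, tt, ← qPow_sub, ← qPow_neg, ← qPow_add, add_comm, sub_eq_add_neg _ (1 / 2 : ℚ)]
    rw [e1, e2, br_qPow hq, br_qPow hq]
    by_cases h1 : IsClassicalTableau n m (ξ + mv k (some x))
    swap
    · have h0 := sc_sub_eq_half hkk hkn hx hξ hξ2 h1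
      rw [show cf n m h r ε k (some x) ξ = 0 from if_neg fun hh => h1 hh.2, ht, h0,
        sub_self, qNum_zero]
      ring
    by_cases h2 : IsClassicalTableau n m (ξ + mv k' (some y))
    swap
    · have h0 := sc_sub_eq_half hkk.symm hkn' hy hξ hξ2' h2
      rw [show cf n m h r ε k' (some y) ξ = 0 from if_neg fun hh => h2 hh.2,
        show t + 1 / 2 = 0 by linarith, qNum_zero]
      ring
    rw [cf, cf, cf, cf, if_pos ⟨hξ, h1⟩, if_pos ⟨h1, hξ2⟩, if_pos ⟨hξ, h2⟩, if_pos ⟨h2, hξ2'⟩]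
    simp only [coef]
    have hf : ∀ x y : ℚ, (fun a => r |a|) (-x) * (fun a => r |a|) (-y) =
        (fun a => r |a|) x * (fun a => r |a|) y := by intro x y; simp only [abs_neg]
    have s1 : sc (ξ + mv k (some x)) k' y = sc ξ k' y :=
      sc_add_mv_of_ne _ _ fun hh => hkk.ne hh.1.symm
    have s2 : sc (ξ + mv k' (some y)) k x = sc ξ k x :=
      sc_add_mv_of_ne _ _ fun hh => hkk.ne hh.1
    rw [s1, s2, rt_eq_mul_rtErase hf hk hkk hy ξ, rt_eq_mul_rtErase hf hk hkk hy (ξ + _),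
      rt_eq_mul_rtErase hf hk' hkk.symm hx ξ, rt_eq_mul_rtErase hf hk' hkk.symm hx (ξ + _),
      rtErase_add_mv _ _ hkk, rtErase_add_mv _ _ hkk.symm, sc_add_mv_self, sc_add_mv_self]
    have key := hhalf.exchange h
    rw [← hr _ (abs_nonneg _), ← hr _ (abs_nonneg _)] at key
    rw [show sc ξ k' y + sc ξ k x + 1 / 2 = sc ξ k x + sc ξ k' y + 1 / 2 by ring,
      show sc ξ k' y - sc ξ k x - 1 / 2 = t - 1 / 2 by ring,
      show sc ξ k x + 1 - sc ξ k' y - 1 / 2 = -(t - 1 / 2) by ring,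
      show sc ξ k x - sc ξ k' y - 1 / 2 = -(t + 1 / 2) by ring,
      show sc ξ k' y + 1 + sc ξ k x + 1 / 2 = sc ξ k x + 1 + sc ξ k' y + 1 / 2 by ring,
      show sc ξ k' y + 1 - sc ξ k x - 1 / 2 = t + 1 / 2 by ring, abs_neg, abs_neg]
    linear_combination wt h k (sc ξ k x) * wt h k' (sc ξ k' y) *
      r |sc ξ k x + sc ξ k' y + 1 / 2| * r |sc ξ k x + 1 + sc ξ k' y + 1 / 2| *
      rtErase (fun a => r |a|) ξ k x.1 (sc ξ k x) (k', y.1) *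
      rtErase (fun a => r |a|) ξ k' y.1 (sc ξ k' y) (k, x.1) *
      (qPow h 1 - qPow h (-1)) * key

/-- Two entries of a row that both move while an entry between them does not are at distance at
least two; `d` is the difference of their signed coordinates. -/
lemma sc_sub_ne (hξ : IsClassicalTableau n m ξ) (hξ' : IsClassicalTableau n m ξ') {o : ℕ}
    (ho : RowAdj k o) (hon : o ≤ n) (hkn : k ≤ n) {x y : ℕ × ℤˣ} (hx : some x ∈ moves k)
    (hy : some y ∈ moves k) (hxy : x.1 ≠ y.1) (hoe : ∀ e, ctr ξ' o e = ctr ξ o e)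
    (hx' : ctr ξ' k x.1 = ctr ξ k x.1 + sq x.2) (hy' : ctr ξ' k y.1 = ctr ξ k y.1 + sq y.2)
    {d : ℚ} (hd : d = sc ξ k y - sc ξ k x) : d ≠ 0 ∧ d ≠ 1 ∧ d ≠ -1 := by
  obtain ⟨j, s⟩ := x
  obtain ⟨i, t⟩ := y
  obtain ⟨hj, hj'⟩ := some_mem_moves.1 hx
  obtain ⟨hi, hi'⟩ := some_mem_moves.1 hy
  dsimp only at *
  have key : ∀ {X Y c : ℚ} {s t : ℤˣ}, |Y| < c → c < X → |Y + sq t| < c → c < X + sq s →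
      sq t * Y - sq s * X ≠ 0 ∧ sq t * Y - sq s * X ≠ 1 ∧ sq t * Y - sq s * X ≠ -1 := by
    intro X Y c s t h1 h2 h3 h4
    obtain ⟨a1, a2⟩ := abs_lt.1 h1
    obtain ⟨a3, a4⟩ := abs_lt.1 h3
    rcases sq_cases s with hs | hs <;> rcases sq_cases t with ht | ht <;>
      simp only [hs, ht] at a3 a4 h4 ⊢ <;> refine ⟨?_, ?_, ?_⟩ <;> intro h0 <;> linarith
  simp only [sc] at hd
  rcases lt_or_gt_of_ne hxy with hlt | hlt
  · obtain ⟨e, -, -, he⟩ := exists_between (m := m) ho hon hkn hj hlt hi'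
    obtain ⟨b1, b2⟩ := he ξ hξ
    obtain ⟨b3, b4⟩ := he ξ' hξ'
    rw [hoe, hy'] at b3
    rw [hoe, hx'] at b4
    rw [hd]
    exact key b1 b2 b3 b4
  · obtain ⟨e, -, -, he⟩ := exists_between (m := m) ho hon hkn hi hlt hj'
    obtain ⟨b1, b2⟩ := he ξ hξ
    obtain ⟨b3, b4⟩ := he ξ' hξ'
    rw [hoe, hx'] at b3
    rw [hoe, hy'] at b4
    obtain ⟨c1, c2, c3⟩ := key b1 b2 b3 b4
    rw [hd]
    exact ⟨fun h0 => c1 (by linarith), fun h0 => c3 (by linarith), fun h0 => c2 (by linarith)⟩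

lemma qNum_abs_div_exchange (hq : ∀ k : ℕ, 0 < k → Complex.exp h ^ k ≠ 1) {d : ℚ}
    (hd : ∃ z : ℤ, d = z) (h0 : d ≠ 0) (h1 : d ≠ 1) (h2 : d ≠ -1) :
    qNum h (d - 1) / qNum h |d - 1| = qNum h (d + 1) / qNum h |d + 1| := by
  obtain ⟨z, rfl⟩ := hd
  have z0 : z ≠ 0 := by exact_mod_cast h0
  have z1 : z ≠ 1 := by exact_mod_cast h1
  have z2 : z ≠ -1 := by exact_mod_cast h2
  have n1 : qNum h ((z : ℚ) - 1) ≠ 0 := qNum_ne_zero hq (sub_ne_zero.2 h1)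
  have n2 : qNum h ((z : ℚ) + 1) ≠ 0 := qNum_ne_zero hq (fun hh => h2 (by linarith))
  rcases le_or_gt 2 z with hz | hz
  · have : (2 : ℚ) ≤ z := by exact_mod_cast hz
    rw [qNum_abs_of_nonneg h (by linarith), qNum_abs_of_nonneg h (by linarith), div_self n1,
      div_self n2]
  · have : (z : ℚ) ≤ -2 := by exact_mod_cast (by omega : z ≤ -2)
    rw [qNum_abs_of_nonpos h (by linarith), qNum_abs_of_nonpos h (by linarith), div_neg, div_neg,
      div_self n1, div_self n2]

lemma coef_exchange_none_some_same_row (hq : ∀ k : ℕ, 0 < k → Complex.exp h ^ k ≠ 1) (hk : 1 ≤ k)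
    {y : ℕ × ℤˣ} (hy : some y ∈ moves k) :
    dg h ε k ξ * br ((qPow h 1)⁻¹ * (tt h ξ k (some y) / tt h ξ k none)) =
      dg h ε k (ξ + mv k (some y)) * br (qPow h 1 * (tt h ξ k (some y) / tt h ξ k none)) := by
  obtain ⟨R, h1, h2⟩ := exists_dg_same_row h ε hk hy ξ
  have e1 : qPow h 1 * (tt h ξ k (some y) / tt h ξ k none) =
      qPow h (sc ξ k y + 3 / 2) / Complex.I := by
    rw [tt, tt, show sc ξ k y + 3 / 2 = 1 + sc ξ k y - -(1 / 2) by ring, qPow_sub, qPow_add]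
    field_simp
  have e2 : (qPow h 1)⁻¹ * (tt h ξ k (some y) / tt h ξ k none) =
      qPow h (sc ξ k y - 1 / 2) / Complex.I := by
    rw [tt, tt, show sc ξ k y - 1 / 2 = -1 + sc ξ k y - -(1 / 2) by ring, qPow_sub, qPow_add,
      ← qPow_neg]
    field_simp
  have n1 := qNumPlus_ne_zero hq (sc ξ k y + 1 / 2)
  have n2 := qNumPlus_ne_zero hq (sc ξ k y - 1 / 2)
  have n3 := qNumPlus_ne_zero hq (sc ξ k y + 3 / 2)
  rw [h1, h2, e1, e2, br_qPow_div_I hq, br_qPow_div_I hq]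
  generalize qNumPlus h (sc ξ k y + 1 / 2) = c1 at *
  generalize qNumPlus h (sc ξ k y - 1 / 2) = c2 at *
  generalize qNumPlus h (sc ξ k y + 3 / 2) = c3 at *
  field_simp

/-- The exchange relation for moves of different entries of a row. -/
lemma cf_exchange_same_row (hq : ∀ k : ℕ, 0 < k → Complex.exp h ^ k ≠ 1)
    (hr : ∀ a : ℚ, 0 ≤ a → r a ^ 2 = qNum h a) (hk : 1 ≤ k) (hkn : k + 1 ≤ n)
    {x y : Option (ℕ × ℤˣ)} (hx : x ∈ moves k) (hy : y ∈ moves k) (hxy : x ≠ y) (hop : y ≠ opp x)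
    (ξ : ℕ → ℕ → ℚ) :
    cf n m h r ε k x ξ * cf n m h r ε k y (ξ + mv k x) *
        br ((qPow h 1)⁻¹ * (tt h ξ k y / tt h ξ k x)) =
      cf n m h r ε k y ξ * cf n m h r ε k x (ξ + mv k y) *
        br (qPow h 1 * (tt h ξ k y / tt h ξ k x)) := by
  by_cases hP : IsClassicalTableau n m ξ ∧ IsClassicalTableau n m (ξ + mv k x + mv k y)
  swap
  · have h1 : cf n m h r ε k x ξ * cf n m h r ε k y (ξ + mv k x) = 0 := by
      rw [cf, cf]; split_ifs <;> simp_all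
    have h2 : cf n m h r ε k y ξ * cf n m h r ε k x (ξ + mv k y) = 0 := by
      rw [cf, cf, add_right_comm]; split_ifs <;> simp_all
    rw [h1, h2, zero_mul, zero_mul]
  obtain ⟨hξ, hξ2⟩ := hP
  have hξ2' : IsClassicalTableau n m (ξ + mv k y + mv k x) := by rwa [add_right_comm]
  rcases x with _ | x <;> rcases y with _ | y
  · exact absurd rfl hxy
  · simp only [mv_none, add_zero] at *
    rw [cf, cf, cf, if_pos ⟨hξ, by simpa [mv_none]⟩, if_pos ⟨hξ, hξ2⟩,
      if_pos ⟨hξ2, by simpa [mv_none]⟩]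
    simp only [coef]
    linear_combination wt h k (sc ξ k y) * rt (fun a => r |a|) ξ k y.1 (sc ξ k y) *
      coef_exchange_none_some_same_row (ε := ε) (ξ := ξ) hq hk hy
  · simp only [mv_none, add_zero] at *
    rw [cf, cf, cf, if_pos ⟨hξ, hξ2⟩, if_pos ⟨hξ2, by simpa [mv_none]⟩,
      if_pos ⟨hξ, by simpa [mv_none]⟩]
    simp only [coef]
    have := coef_exchange_none_some_same_row (ε := ε) (ξ := ξ) hq hk hx
    have e1 : qPow h 1 * (tt h ξ k (some x) / tt h ξ k none) =
        ((qPow h 1)⁻¹ * (tt h ξ k none / tt h ξ k (some x)))⁻¹ := by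
      rw [mul_inv, inv_inv, inv_div]
    have e2 : (qPow h 1)⁻¹ * (tt h ξ k (some x) / tt h ξ k none) =
        (qPow h 1 * (tt h ξ k none / tt h ξ k (some x)))⁻¹ := by
      rw [mul_inv, inv_div]
    rw [e1, e2, br_inv, br_inv] at this
    linear_combination wt h k (sc ξ k x) * rt (fun a => r |a|) ξ k x.1 (sc ξ k x) * this
  · have hne : x.1 ≠ y.1 := by
      intro h1
      obtain ⟨j, s⟩ := x
      obtain ⟨i, t⟩ := y
      dsimp only at h1
      subst h1
      rcases Int.units_eq_one_or s with rfl | rfl <;>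
      rcases Int.units_eq_one_or t with rfl | rfl <;>
        simp [opp] at hxy hop
    set d := sc ξ k y - sc ξ k x with hd
    have hint : ∃ z : ℤ, d = z := by
      obtain ⟨j, s⟩ := x
      obtain ⟨i, t⟩ := y
      obtain ⟨hj, hj'⟩ := some_mem_moves.1 hx
      obtain ⟨hi, hi'⟩ := some_mem_moves.1 hy
      obtain ⟨a, ha⟩ := hξ.isInt_sub (by omega : k ≤ n) hi hi' hj hj'
      obtain ⟨b, hb⟩ := hξ.isInt_add (by omega : k ≤ n) hi hi' hj hj'
      simp only [hd, sc]
      rcases sq_cases s with hs | hs <;> rcases sq_cases t with ht | ht <;> rw [hs, ht]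
      · exact ⟨a, by linarith⟩
      · exact ⟨-b, by push_cast; linarith⟩
      · exact ⟨b, by linarith⟩
      · exact ⟨-a, by push_cast; linarith⟩
    obtain ⟨d0, d1, d2⟩ := sc_sub_ne hξ hξ2 (Or.inl rfl) hkn (by omega) hx hy hne
      (fun e => by
        rw [ctr_add_mv_of_ne _ _ (by omega), ctr_add_mv_of_ne _ _ (by omega)])
      (by rw [ctr_add_mv_of_ne _ _ (fun hh => hne hh.2), ctr_add_mv_self])
      (by rw [ctr_add_mv_self, ctr_add_mv_of_ne _ _ (fun hh => hne hh.2.symm)]) hd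
    have e1 : qPow h 1 * (tt h ξ k (some y) / tt h ξ k (some x)) = qPow h (d + 1) := by
      rw [tt, tt, ← qPow_sub, ← qPow_add, add_comm]
    have e2 : (qPow h 1)⁻¹ * (tt h ξ k (some y) / tt h ξ k (some x)) = qPow h (d - 1) := by
      rw [tt, tt, ← qPow_sub, ← qPow_neg, ← qPow_add, add_comm, sub_eq_add_neg _ (1 : ℚ)]
    rw [e1, e2, br_qPow hq, br_qPow hq]
    have h1 := isClassicalTableau_of_same_row hkn hx hne hξ hξ2
    have h2 := isClassicalTableau_of_same_row hkn hy hne.symm hξ hξ2'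
    rw [cf, cf, cf, cf, if_pos ⟨hξ, h1⟩, if_pos ⟨h1, hξ2⟩, if_pos ⟨hξ, h2⟩, if_pos ⟨h2, hξ2'⟩]
    simp only [coef]
    have hf : ∀ x y : ℚ, (fun a => r |a|) (-x) * (fun a => r |a|) (-y) =
        (fun a => r |a|) x * (fun a => r |a|) y := by intro x y; simp only [abs_neg]
    have s1 : sc (ξ + mv k (some x)) k y = sc ξ k y :=
      sc_add_mv_of_ne _ _ fun hh => hne hh.2.symm
    have s2 : sc (ξ + mv k (some y)) k x = sc ξ k x :=
      sc_add_mv_of_ne _ _ fun hh => hne hh.2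
    obtain ⟨R, r1, r2⟩ := exists_rt_same_row (f := fun a => r |a|) hf hk hy hne.symm ξ (sc ξ k x)
    obtain ⟨R', r3, r4⟩ := exists_rt_same_row (f := fun a => r |a|) hf hk hx hne ξ (sc ξ k y)
    rw [s1, s2, r1, r2, r3, r4]
    have key := qNum_abs_div_exchange hq hint d0 d1 d2
    rw [← hr _ (abs_nonneg _), ← hr _ (abs_nonneg _)] at key
    rw [show sc ξ k y + sc ξ k x = sc ξ k x + sc ξ k y by ring,
      show sc ξ k y - sc ξ k x = d by ring,
      show sc ξ k x + 1 - sc ξ k y = -(d - 1) by ring,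
      show sc ξ k x - sc ξ k y = -d by ring,
      show sc ξ k y + 1 + sc ξ k x = sc ξ k x + sc ξ k y + 1 by ring,
      show sc ξ k y + 1 - sc ξ k x = d + 1 by ring,
      show sc ξ k x + 1 + sc ξ k y = sc ξ k x + sc ξ k y + 1 by ring,
      show -(d - 1) - 1 = -d by ring, show -d - 1 = -(d + 1) by ring,
      show d + 1 - 1 = d by ring, abs_neg, abs_neg, abs_neg]
    simp only [div_eq_mul_inv, mul_inv] at key ⊢
    rw [← inv_pow, ← inv_pow] at key
    linear_combination wt h k (sc ξ k x) * wt h k (sc ξ k y) * R * R' *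
      (r |sc ξ k x + sc ξ k y|)⁻¹ * (r |sc ξ k x + sc ξ k y + 1|)⁻¹ ^ 2 *
      (r |sc ξ k x + sc ξ k y + 1 + 1|)⁻¹ * (r |d|)⁻¹ ^ 2 * (qPow h 1 - qPow h (-1)) * key

end Exchange

/-! ### Paths along two moves that are not opposite -/

section Paths

variable {h : ℂ} {r : ℚ → ℂ} {n : ℕ} {m : ℕ → ℚ} {ε : ℕ → ℤˣ} {ξ ξ' : ℕ → ℕ → ℚ} {k k' : ℕ}

lemma cf_eq_zero_of_not_source {x : Option (ℕ × ℤˣ)} (hξ : ¬IsClassicalTableau n m ξ) :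
    cf n m h r ε k x ξ = 0 := if_neg fun hh => hξ hh.1

lemma cf_eq_zero_of_not_target {x : Option (ℕ × ℤˣ)}
    (hξ : ¬IsClassicalTableau n m (ξ + mv k x)) : cf n m h r ε k x ξ = 0 :=
  if_neg fun hh => hξ hh.2

lemma tt_add_mv_of_ne (h : ℂ) (ξ : ℕ → ℕ → ℚ) (hkk : k ≠ k') (x y : Option (ℕ × ℤˣ)) :
    tt h (ξ + mv k' y) k x = tt h ξ k x := by
  rcases x with _ | x
  · rfl
  rcases y with _ | y
  · rw [mv_none, add_zero]
  · rw [tt, tt, sc_add_mv_of_ne _ _ fun hh => hkk hh.1]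

lemma fst_ne_of_ne {x y : ℕ × ℤˣ} (hxy : some x ≠ some y) (hop : some y ≠ opp (some x)) :
    x.1 ≠ y.1 := by
  intro h1
  obtain ⟨j, s⟩ := x
  obtain ⟨i, t⟩ := y
  dsimp only at h1
  subst h1
  rcases Int.units_eq_one_or s with rfl | rfl <;> rcases Int.units_eq_one_or t with rfl | rfl <;>
    simp [opp] at hxy hop

lemma tt_add_mv_same_row (h : ℂ) (ξ : ℕ → ℕ → ℚ) {x y : Option (ℕ × ℤˣ)} (hxy : x ≠ y)
    (hop : y ≠ opp x) : tt h (ξ + mv k x) k y = tt h ξ k y := by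
  rcases y with _ | y
  · rfl
  rcases x with _ | x
  · rw [mv_none, add_zero]
  · rw [tt, tt, sc_add_mv_of_ne _ _ fun hh => fst_ne_of_ne hxy hop hh.2.symm]

lemma br_qPow_ne_zero (hq : ∀ k : ℕ, 0 < k → Complex.exp h ^ k ≠ 1) {a : ℚ} (ha : a ≠ 0) :
    br (qPow h a) ≠ 0 := by
  rw [br_qPow hq]
  exact mul_ne_zero (qPow_sub_qPow_neg_ne_zero hq one_ne_zero) (qNum_ne_zero hq ha)

lemma br_qPow_div_I_ne_zero (hq : ∀ k : ℕ, 0 < k → Complex.exp h ^ k ≠ 1) (a : ℚ) :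
    br (qPow h a / Complex.I) ≠ 0 := by
  rw [br_qPow_div_I hq]
  exact mul_ne_zero (mul_ne_zero (neg_ne_zero.2 Complex.I_ne_zero)
    (qPow_sub_qPow_neg_ne_zero hq one_ne_zero)) (qNumPlus_ne_zero hq a)

lemma br_ne_zero_of_inv {z : ℂ} (hz : br z⁻¹ ≠ 0) : br z ≠ 0 := by
  rw [br_inv] at hz
  exact neg_ne_zero.1 hz

lemma qPow_half_sq (h : ℂ) : qPow h (1 / 2) ^ 2 = qPow h 1 := by
  rw [← qPow_two_mul]
  norm_num

/-- The coordinates of two moves in a row that can both be performed are not neighbours, up to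
the exchange with moves in one adjacent row. -/
lemma br_tt_ne_zero (hq : ∀ k : ℕ, 0 < k → Complex.exp h ^ k ≠ 1) {o : ℕ} (ho : RowAdj k o)
    (hon : o ≤ n) (hkn : k ≤ n) (hko : o ≠ k') (hkk : k ≠ k') {x z y : Option (ℕ × ℤˣ)}
    (hx : x ∈ moves k) (hz : z ∈ moves k) (hxz : x ≠ z) (hop : z ≠ opp x)
    (hξ : IsClassicalTableau n m ξ)
    (hξ' : IsClassicalTableau n m (ξ + mv k x + mv k z + mv k' y)) {c : ℚ} (hc : c = 1 ∨ c = -1) :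
    br (qPow h c * (tt h ξ k z / tt h ξ k x)) ≠ 0 := by
  rcases x with _ | x <;> rcases z with _ | z
  · exact absurd rfl hxz
  · have e : qPow h c * (tt h ξ k (some z) / tt h ξ k none) =
        qPow h (c + sc ξ k z - -(1 / 2)) / Complex.I := by
      rw [tt, tt, qPow_sub, qPow_add]
      field_simp
    rw [e]
    exact br_qPow_div_I_ne_zero hq _
  · have e : (qPow h c * (tt h ξ k none / tt h ξ k (some x)))⁻¹ =
        qPow h (-c + sc ξ k x - -(1 / 2)) / Complex.I := by
      rw [tt, tt, qPow_sub, qPow_add, qPow_neg h c, mul_inv, inv_div]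
      field_simp
    apply br_ne_zero_of_inv
    rw [e]
    exact br_qPow_div_I_ne_zero hq _
  · have hne := fst_ne_of_ne hxz hop
    have hy : ∀ l e, l ≠ k' → ctr (ξ + mv k (some x) + mv k (some z) + mv k' y) l e =
        ctr (ξ + mv k (some x) + mv k (some z)) l e := by
      intro l e hl
      rcases y with _ | y
      · rw [mv_none, add_zero]
      · rw [ctr_add_mv_of_ne _ _ fun hh => hl hh.1]
    obtain ⟨-, d1, d2⟩ := sc_sub_ne hξ hξ' ho hon hkn hx hz hne
      (fun e => by
        rw [hy _ _ hko, ctr_add_mv_of_ne _ _ fun hh => ho.ne hh.1.symm,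
          ctr_add_mv_of_ne _ _ fun hh => ho.ne hh.1.symm])
      (by rw [hy _ _ hkk, ctr_add_mv_of_ne _ _ fun hh => hne hh.2, ctr_add_mv_self])
      (by rw [hy _ _ hkk, ctr_add_mv_self, ctr_add_mv_of_ne _ _ fun hh => hne hh.2.symm]) rfl
    rw [tt, tt, ← qPow_sub, ← qPow_add]
    apply br_qPow_ne_zero hq
    rcases hc with rfl | rfl <;> intro h0
    · exact d2 (by linarith)
    · exact d1 (by linarith)

/-- The three paths along a move `x` in a row, performed twice, and a move in an adjacent row. -/
lemma double_move {s u : ℂ} (hs : s ≠ 0) (hu : u ≠ 0) (h0 : br (s⁻¹ * u) ≠ 0) {pxxn pxnx pnxx : ℂ}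
    (e1 : pxnx * br (s * u) = pnxx * br (s⁻¹ * u))
    (e2 : pxxn * br (s⁻¹ * u) = pxnx * br (s⁻¹ ^ 3 * u)) :
    pxxn - (s ^ 2 + (s ^ 2)⁻¹) * pxnx + pnxx = 0 := by
  have key : br (s⁻¹ ^ 3 * u) - (s ^ 2 + (s ^ 2)⁻¹) * br (s⁻¹ * u) + br (s * u) = 0 := by
    simp only [br]
    field_simp
    ring
  refine (mul_eq_zero.1 ?_).resolve_right h0
  linear_combination e2 - e1 + pxnx * key

lemma sum_paths_eq_zero (hq : ∀ k : ℕ, 0 < k → Complex.exp h ^ k ≠ 1)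
    (hr : ∀ a : ℚ, 0 ≤ a → r a ^ 2 = qNum h a) (hk : 1 ≤ k) (hk' : 1 ≤ k') (hkn : k + 1 ≤ n)
    (hkn' : k' + 1 ≤ n) (hkk : RowAdj k k') {x z y : Option (ℕ × ℤˣ)} (hx : x ∈ moves k)
    (hz : z ∈ moves k) (hop : z ≠ opp x) (hy : y ∈ moves k') (ξ : ℕ → ℕ → ℚ) :
    (cf n m h r ε k x ξ * cf n m h r ε k z (ξ + mv k x) * cf n m h r ε k' y (ξ + mv k x + mv k z)
        - (Complex.exp h + (Complex.exp h)⁻¹) * (cf n m h r ε k x ξ *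
          cf n m h r ε k' y (ξ + mv k x) * cf n m h r ε k z (ξ + mv k x + mv k' y))
        + cf n m h r ε k' y ξ * cf n m h r ε k x (ξ + mv k' y) *
          cf n m h r ε k z (ξ + mv k' y + mv k x)) +
      (cf n m h r ε k z ξ * cf n m h r ε k x (ξ + mv k z) * cf n m h r ε k' y (ξ + mv k z + mv k x)
        - (Complex.exp h + (Complex.exp h)⁻¹) * (cf n m h r ε k z ξ *
          cf n m h r ε k' y (ξ + mv k z) * cf n m h r ε k x (ξ + mv k z + mv k' y))
        + cf n m h r ε k' y ξ * cf n m h r ε k z (ξ + mv k' y) *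
          cf n m h r ε k x (ξ + mv k' y + mv k z)) = 0 := by
  by_cases hξ : IsClassicalTableau n m ξ
  swap
  · simp [cf_eq_zero_of_not_source hξ]
  by_cases hξ' : IsClassicalTableau n m (ξ + mv k x + mv k z + mv k' y)
  swap
  · have c1 : cf n m h r ε k' y (ξ + mv k x + mv k z) = 0 := cf_eq_zero_of_not_target hξ'
    have c2 : cf n m h r ε k z (ξ + mv k x + mv k' y) = 0 :=
      cf_eq_zero_of_not_target (by rwa [add_right_comm (ξ + mv k x)])
    have c3 : cf n m h r ε k z (ξ + mv k' y + mv k x) = 0 :=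
      cf_eq_zero_of_not_target (by rwa [show ξ + mv k' y + mv k x + mv k z =
        ξ + mv k x + mv k z + mv k' y by abel])
    have c4 : cf n m h r ε k' y (ξ + mv k z + mv k x) = 0 :=
      cf_eq_zero_of_not_target (by rwa [add_right_comm ξ (mv k z)])
    have c5 : cf n m h r ε k x (ξ + mv k z + mv k' y) = 0 :=
      cf_eq_zero_of_not_target (by rwa [show ξ + mv k z + mv k' y + mv k x =
        ξ + mv k x + mv k z + mv k' y by abel])
    have c6 : cf n m h r ε k x (ξ + mv k' y + mv k z) = 0 :=
      cf_eq_zero_of_not_target (by rwa [show ξ + mv k' y + mv k z + mv k x =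
        ξ + mv k x + mv k z + mv k' y by abel])
    rw [c1, c2, c3, c4, c5, c6]
    ring
  have hs := qPow_ne_zero h (1 / 2)
  have tx := tt_ne_zero h ξ k x
  have tz := tt_ne_zero h ξ k z
  have ty := tt_ne_zero h ξ k' y
  rw [← qPow_one, ← qPow_half_sq]
  by_cases hxz : x = z
  · subst hxz
    rcases x with _ | x
    · exact absurd rfl hop
    have e1 := cf_exchange (ε := ε) (m := m) hq hr hk hk' hkn hkn' hkk hx hy ξ
    have e2 := cf_exchange (ε := ε) (m := m) hq hr hk hk' hkn hkn' hkk hx hy (ξ + mv k (some x))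
    rw [tt_add_mv_of_ne h ξ hkk.ne.symm] at e2
    have t1 : tt h (ξ + mv k (some x)) k (some x) = qPow h (1 / 2) ^ 2 * tt h ξ k (some x) := by
      rw [tt, tt, sc_add_mv_self, qPow_half_sq, qPow_add, mul_comm]
    have u1 : qPow h (1 / 2) * (tt h ξ k' y / tt h (ξ + mv k (some x)) k (some x)) =
        (qPow h (1 / 2))⁻¹ * (tt h ξ k' y / tt h ξ k (some x)) := by
      rw [t1]; field_simp
    have u2 : (qPow h (1 / 2))⁻¹ * (tt h ξ k' y / tt h (ξ + mv k (some x)) k (some x)) =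
        (qPow h (1 / 2))⁻¹ ^ 3 * (tt h ξ k' y / tt h ξ k (some x)) := by
      rw [t1]; field_simp
    rw [u1, u2] at e2
    have h0 : br ((qPow h (1 / 2))⁻¹ * (tt h ξ k' y / tt h ξ k (some x))) ≠ 0 := by
      rcases y with _ | y
      · have e : ((qPow h (1 / 2))⁻¹ * (tt h ξ k' none / tt h ξ k (some x)))⁻¹ =
            qPow h (1 / 2 + sc ξ k x - -(1 / 2)) / Complex.I := by
          rw [tt, tt, qPow_sub, qPow_add, mul_inv, inv_inv, inv_div]
          field_simp
        apply br_ne_zero_of_inv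
        rw [e]
        exact br_qPow_div_I_ne_zero hq _
      · rw [tt, tt, ← qPow_sub, ← qPow_neg, ← qPow_add]
        apply br_qPow_ne_zero hq
        intro h0
        have h1 := (sc_lt_iff hξ hξ' hkk (by omega) (by omega) hx hy).1 (by linarith)
        rw [sc_add_mv_self, sc_add_mv_of_ne _ _ fun hh => hkk.ne hh.1, sc_add_mv_self,
          sc_add_mv_self, sc_add_mv_of_ne _ _ fun hh => hkk.ne hh.1.symm,
          sc_add_mv_of_ne _ _ fun hh => hkk.ne hh.1.symm] at h1
        linarith
    have key := double_move hs (div_ne_zero ty tx) h0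
      (pxnx := cf n m h r ε k (some x) ξ * cf n m h r ε k' y (ξ + mv k (some x)) *
        cf n m h r ε k (some x) (ξ + mv k (some x) + mv k' y))
      (pnxx := cf n m h r ε k' y ξ * cf n m h r ε k (some x) (ξ + mv k' y) *
          cf n m h r ε k (some x) (ξ + mv k' y + mv k (some x)))
      (pxxn := cf n m h r ε k (some x) ξ * cf n m h r ε k (some x) (ξ + mv k (some x)) *
        cf n m h r ε k' y (ξ + mv k (some x) + mv k (some x)))
      (by rw [add_right_comm ξ (mv k' y)]
          linear_combination cf n m h r ε k (some x) (ξ + mv k (some x) + mv k' y) * e1)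
      (by linear_combination cf n m h r ε k (some x) ξ * e2)
    rw [key, add_zero]
  · obtain ⟨o, ho, hon, hok⟩ : ∃ o, RowAdj k o ∧ o ≤ n ∧ o ≠ k' := by
      rcases hkk with rfl | rfl
      · exact ⟨k - 1, Or.inr (by omega), by omega, by omega⟩
      · exact ⟨k' + 1 + 1, Or.inl rfl, hkn, by omega⟩
    have hzx : x ≠ opp z := fun hh => hop (by rw [hh, opp_opp])
    have uv : tt h ξ k' y / tt h ξ k x / (tt h ξ k' y / tt h ξ k z) = tt h ξ k z / tt h ξ k x := by
      field_simp
    have a1 := cf_exchange (ε := ε) (m := m) hq hr hk hk' hkn hkn' hkk hx hy ξ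
    have a2 := cf_exchange (ε := ε) (m := m) hq hr hk hk' hkn hkn' hkk hz hy ξ
    have a3 := cf_exchange (ε := ε) (m := m) hq hr hk hk' hkn hkn' hkk hz hy (ξ + mv k x)
    have a4 := cf_exchange (ε := ε) (m := m) hq hr hk hk' hkn hkn' hkk hx hy (ξ + mv k z)
    have a5 := cf_exchange_same_row (ε := ε) (m := m) hq hr hk hkn hx hz hxz hop (ξ + mv k' y)
    have a6 := cf_exchange_same_row (ε := ε) (m := m) hq hr hk hkn hx hz hxz hop ξ
    rw [tt_add_mv_of_ne h ξ hkk.ne.symm, tt_add_mv_same_row h ξ hxz hop] at a3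
    rw [tt_add_mv_of_ne h ξ hkk.ne.symm, tt_add_mv_same_row h ξ (Ne.symm hxz) hzx] at a4
    rw [tt_add_mv_of_ne h ξ hkk.ne, tt_add_mv_of_ne h ξ hkk.ne] at a5
    rw [← qPow_half_sq] at a5 a6
    have n1 := br_tt_ne_zero hq ho hon (by omega) hok hkk.ne hx hz hxz hop hξ hξ' (Or.inl rfl)
    have n2 := br_tt_ne_zero hq ho hon (by omega) hok hkk.ne hx hz hxz hop hξ hξ' (Or.inr rfl)
    have n3 := br_qPow_ne_zero hq (one_ne_zero (α := ℚ))
    rw [qPow_neg] at n2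
    rw [← qPow_half_sq] at n1 n2 n3
    refine hexagon hs (div_ne_zero ty tx) (div_ne_zero ty tz) n3 (by rwa [uv]) (by rwa [uv])
      ?_ ?_ ?_ ?_ ?_ ?_
    · rw [add_right_comm ξ (mv k' y)]
      linear_combination cf n m h r ε k z (ξ + mv k x + mv k' y) * a1
    · rw [add_right_comm ξ (mv k' y)]
      linear_combination cf n m h r ε k x (ξ + mv k z + mv k' y) * a2
    · linear_combination cf n m h r ε k x ξ * a3
    · linear_combination cf n m h r ε k z ξ * a4
    · rw [uv]
      linear_combination cf n m h r ε k' y ξ * a5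
    · rw [uv, add_right_comm ξ (mv k z)]
      linear_combination cf n m h r ε k' y (ξ + mv k x + mv k z) * a6

end Paths

/-! ### Paths along opposite moves: the nodes -/

/-- The interpolation node `q^{2a+1} + q^{-2a-1}` of a move with signed coordinate `a`. -/
noncomputable def nd (h : ℂ) (a : ℚ) : ℂ := qPow h (2 * a + 1) + qPow h (-(2 * a + 1))

/-- The zero `q^{2u} + q^{-2u}` that an entry `u` of an adjacent row contributes to the
interpolated polynomial. -/
noncomputable def zr (h : ℂ) (u : ℚ) : ℂ := qPow h (2 * u) + qPow h (-(2 * u))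

section Nodes

variable {h : ℂ} {n : ℕ} {m : ℕ → ℚ} {ξ ξ' : ℕ → ℕ → ℚ} {k : ℕ}

lemma qNum_mul_qNum (h : ℂ) (a b : ℚ) : qNum h a * qNum h b =
    (qPow h (a + b) + qPow h (-(a + b)) - (qPow h (a - b) + qPow h (-(a - b)))) *
      (qPow h 1 - qPow h (-1))⁻¹ ^ 2 := by
  rw [qNum, qNum, neg_add, neg_sub, sub_eq_add_neg a b, sub_eq_add_neg b a, qPow_add, qPow_add,
    qPow_add, qPow_add]
  ring

lemma qNumPlus_sq (h : ℂ) (a : ℚ) : qNumPlus h a ^ 2 =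
    (zr h a + 2) * (qPow h 1 - qPow h (-1))⁻¹ ^ 2 := by
  have h1 : qPow h a * qPow h (-a) = 1 := by rw [← qPow_add, add_neg_cancel, qPow_zero]
  rw [qNumPlus, zr, show -(2 * a) = 2 * (-a) by ring, qPow_two_mul, qPow_two_mul, div_eq_mul_inv]
  linear_combination (2 * (qPow h 1 - qPow h (-1))⁻¹ ^ 2) * h1

lemma nd_eq_zr (h : ℂ) (a : ℚ) : nd h a = zr h (a + 1 / 2) := by
  rw [nd, zr]
  congr 2 <;> ring

lemma zr_neg (h : ℂ) (a : ℚ) : zr h (-a) = zr h a := by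
  rw [zr, zr, add_comm]
  congr 2 <;> ring

lemma zr_sub_zr (h : ℂ) (hκ : qPow h 1 - qPow h (-1) ≠ 0) (a b : ℚ) :
    zr h a - zr h b = qNum h (a + b) * qNum h (a - b) * (qPow h 1 - qPow h (-1)) ^ 2 := by
  rw [qNum_mul_qNum, zr, zr, show a + b + (a - b) = 2 * a by ring,
    show a + b - (a - b) = 2 * b by ring]
  field_simp

lemma zr_eq_zr_iff (hq : ∀ k : ℕ, 0 < k → Complex.exp h ^ k ≠ 1) {a b : ℚ} :
    zr h a = zr h b ↔ a = b ∨ a = -b := by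
  have hκ := qPow_sub_qPow_neg_ne_zero hq one_ne_zero
  constructor
  · intro h1
    have h2 := zr_sub_zr h hκ a b
    rw [h1, sub_self] at h2
    by_contra! hne
    exact mul_ne_zero (mul_ne_zero (qNum_ne_zero hq fun h0 => hne.2 (by linarith))
      (qNum_ne_zero hq fun h0 => hne.1 (by linarith))) (pow_ne_zero 2 hκ) h2.symm
  · rintro (rfl | rfl)
    · rfl
    · rw [zr_neg]

lemma nd_ne_neg_two (hq : ∀ k : ℕ, 0 < k → Complex.exp h ^ k ≠ 1) (a : ℚ) : nd h a ≠ -2 := by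
  intro h0
  have h1 := qNumPlus_sq h (a + 1 / 2)
  rw [← nd_eq_zr, h0, neg_add_cancel, zero_mul] at h1
  exact pow_ne_zero 2 (qNumPlus_ne_zero hq _) h1

/-- Different moves in a row have the same node only if they try to bring two neighbouring entries
to the same place; then an entry of each adjacent row blocks both of them, and so it does for
all tableaux with the same row `k`. -/
lemma exists_of_nd_eq (hq : ∀ k : ℕ, 0 < k → Complex.exp h ^ k ≠ 1)
    (hξ : IsClassicalTableau n m ξ) (hkn : k + 1 ≤ n) {x y : ℕ × ℤˣ} (hx : some x ∈ moves k)
    (hy : some y ∈ moves k) (hxy : x ≠ y) (hnd : nd h (sc ξ k x) = nd h (sc ξ k y)) :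
    (|ctr ξ k x.1| - |ctr ξ k y.1| = 1 ∨ |ctr ξ k y.1| - |ctr ξ k x.1| = 1) ∧
      ∀ o, RowAdj k o → ∃ e, 1 ≤ e ∧ e ≤ o / 2 ∧ zr h (ctr ξ o e) = nd h (sc ξ k x) ∧
        ∀ ξ', IsClassicalTableau n m ξ' → (∀ j, ctr ξ' k j = ctr ξ k j) →
          ctr ξ' o e = ctr ξ o e := by
  rw [nd_eq_zr, nd_eq_zr, zr_eq_zr_iff hq] at hnd
  obtain ⟨j, s⟩ := x
  obtain ⟨i, t⟩ := y
  have hx' := some_mem_moves.1 hx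
  have hy' := some_mem_moves.1 hy
  have key : ∀ {i j : ℕ} {s t : ℤˣ}, 1 ≤ i → i < j → j ≤ k / 2 →
      (sq s * ctr ξ k i + 1 / 2 = sq t * ctr ξ k j + 1 / 2 ∨
        sq s * ctr ξ k i + 1 / 2 = -(sq t * ctr ξ k j + 1 / 2)) →
      |ctr ξ k i| - |ctr ξ k j| = 1 ∧ ctr ξ k i - 1 / 2 = -(sq s * ctr ξ k i + 1 / 2) ∧
        ∀ o, RowAdj k o → ∃ e, 1 ≤ e ∧ e ≤ o / 2 ∧ ctr ξ o e = ctr ξ k i - 1 / 2 ∧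
          ∀ ξ', IsClassicalTableau n m ξ' → (∀ j, ctr ξ' k j = ctr ξ k j) →
            ctr ξ' o e = ctr ξ o e := by
    intro i j s t hi hij hj hst
    have hlt := hξ.abs_ctr_lt hkn hi hij hj
    have hpos : 0 < ctr ξ k i := (abs_nonneg _).trans_lt hlt
    obtain ⟨h1, h2⟩ := abs_lt.1 hlt
    have i1 := one_le_of_int (hξ.isInt_add (by omega : k ≤ n) hi (by omega) (by omega) hj)
      (by linarith)
    have i2 := one_le_of_int (hξ.isInt_sub (by omega : k ≤ n) hi (by omega) (by omega) hj)
      (by linarith)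
    have habs : |ctr ξ k j| = ctr ξ k i - 1 ∧ ctr ξ k i - 1 / 2 = -(sq s * ctr ξ k i + 1 / 2) := by
      rcases sq_cases s with hs | hs <;> rcases sq_cases t with ht | ht <;>
        simp only [hs, ht] at hst ⊢ <;> rcases hst with hst | hst <;> try (exfalso; linarith)
      · exact ⟨by rw [abs_of_nonneg (by linarith)]; linarith, by linarith⟩
      · exact ⟨by rw [abs_of_nonpos (by linarith)]; linarith, by linarith⟩
    refine ⟨by rw [habs.1, abs_of_pos hpos]; ring, habs.2, fun o ho => ?_⟩
    have hon : o ≤ n := by rcases ho with h | h <;> omega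
    obtain ⟨e, he, he', H⟩ := exists_between (m := m) ho hon (by omega) hi hij hj
    have place : ∀ ξ', IsClassicalTableau n m ξ' → (∀ j, ctr ξ' k j = ctr ξ k j) →
        ctr ξ' o e = ctr ξ k i - 1 / 2 := by
      intro ξ' hξ' hrow
      obtain ⟨b1, b2⟩ := H ξ' hξ'
      rw [hrow] at b1 b2
      rw [habs.1] at b1
      have hhalf := hξ'.isHalfIntegral_sc ho.symm hon (by omega) (x := (e, 1)) (y := (i, 1))
        (some_mem_moves.2 ⟨he, he'⟩) (some_mem_moves.2 ⟨hi, by omega⟩)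
      simp only [sc, sq, Units.val_one, Int.cast_one, one_mul, hrow] at hhalf
      linarith [hhalf.eq_half (by linarith) (by linarith)]
    exact ⟨e, he, he', place ξ hξ fun _ => rfl, fun ξ' hξ' hrow => by
      rw [place ξ' hξ' hrow, place ξ hξ fun _ => rfl]⟩
  have hji : j ≠ i := by
    rintro rfl
    have hst : s ≠ t := fun hh => hxy (by rw [hh])
    have h0 := hξ.ctr_ne_zero hkn hx'.1 hx'.2
    have hs : sq t = -sq s := by
      rcases Int.units_eq_one_or s with rfl | rfl <;>
        rcases Int.units_eq_one_or t with rfl | rfl <;> simp [sq] at hst ⊢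
    simp only [sc, hs] at hnd
    rcases hnd with hnd | hnd
    · have : sq s * ctr ξ k j = 0 := by linarith
      rcases mul_eq_zero.1 this with h1 | h1
      · rcases sq_cases s with h2 | h2 <;> rw [h2] at h1 <;> norm_num at h1
      · exact h0 h1
    · linarith
  simp only [sc] at hnd ⊢
  rcases lt_or_gt_of_ne hji with hlt | hlt
  · obtain ⟨a1, a2, a3⟩ := key hx'.1 hlt hy'.2 hnd
    refine ⟨Or.inl a1, fun o ho => ?_⟩
    obtain ⟨e, h1, h2, h3, h4⟩ := a3 o ho
    exact ⟨e, h1, h2, by rw [h3, a2, zr_neg, nd_eq_zr], h4⟩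
  · obtain ⟨a1, a2, a3⟩ := key hy'.1 hlt hx'.2 (s := t) (t := s)
      (by rcases hnd with h | h
          · exact Or.inl h.symm
          · exact Or.inr (by linarith))
    refine ⟨Or.inr a1, fun o ho => ?_⟩
    obtain ⟨e, h1, h2, h3, h4⟩ := a3 o ho
    refine ⟨e, h1, h2, ?_, h4⟩
    rw [h3, a2, zr_neg, nd_eq_zr, zr_eq_zr_iff hq]
    rcases hnd with h | h
    · exact Or.inl h.symm
    · exact Or.inr (by linarith)

/-- The node of a move; the diagonal term has the node `-2`. -/
noncomputable def node (h : ℂ) (ξ : ℕ → ℕ → ℚ) (k : ℕ) : Option (ℕ × ℤˣ) → ℂ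
  | none => -2
  | some x => nd h (sc ξ k x)

/-- The hypothesis on coinciding nodes in `sum_prod_div_prod_eq_one`. -/
lemma node_eq_node (hq : ∀ k : ℕ, 0 < k → Complex.exp h ^ k ≠ 1) (hk : 1 ≤ k)
    (hξ : IsClassicalTableau n m ξ) (hkn : k + 1 ≤ n) {x y : Option (ℕ × ℤˣ)} (hx : x ∈ moves k)
    (hy : y ∈ moves k) (hxy : x ≠ y) (hnd : node h ξ k x = node h ξ k y) :
    (∀ z ∈ moves k, node h ξ k z = node h ξ k x → z = x ∨ z = y) ∧
      ∃ u ∈ adj k, ∃ v ∈ adj k, u ≠ v ∧ zr h (ctr ξ u.1 u.2) = node h ξ k x ∧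
        zr h (ctr ξ v.1 v.2) = node h ξ k x ∧
        ∀ ξ', IsClassicalTableau n m ξ' → (∀ j, ctr ξ' k j = ctr ξ k j) →
          ctr ξ' u.1 u.2 = ctr ξ u.1 u.2 ∧ ctr ξ' v.1 v.2 = ctr ξ v.1 v.2 := by
  rcases x with _ | x
  · rcases y with _ | y
    · exact absurd rfl hxy
    · exact absurd hnd.symm (nd_ne_neg_two hq _)
  rcases y with _ | y
  · exact absurd hnd (nd_ne_neg_two hq _)
  have hxy' : x ≠ y := fun hh => hxy (by rw [hh])
  obtain ⟨a1, a2⟩ := exists_of_nd_eq hq hξ hkn hx hy hxy' hnd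
  refine ⟨fun z hz hzx => ?_, ?_⟩
  · rcases z with _ | z
    · exact absurd hzx.symm (nd_ne_neg_two hq _)
    by_contra! hne
    have hzx' : z ≠ x := fun hh => hne.1 (by rw [hh])
    have hzy' : z ≠ y := fun hh => hne.2 (by rw [hh])
    -- three absolute values cannot pairwise differ by one
    obtain ⟨b1, -⟩ := exists_of_nd_eq hq hξ hkn hz hx hzx' hzx
    obtain ⟨c1, -⟩ := exists_of_nd_eq hq hξ hkn hz hy hzy' (hzx.trans hnd)
    rcases a1 with a1 | a1 <;> rcases b1 with b1 | b1 <;> rcases c1 with c1 | c1 <;> linarith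
  · obtain ⟨e, e1, e2, e3, e4⟩ := a2 (k + 1) (Or.inl rfl)
    obtain ⟨f, f1, f2, f3, f4⟩ := a2 (k - 1) (Or.inr (by omega))
    refine ⟨(k + 1, e), (mem_adj hk).2 ⟨Or.inl rfl, e1, e2⟩, (k - 1, f),
      (mem_adj hk).2 ⟨Or.inr (by dsimp only; omega), f1, f2⟩, ?_, e3, f3, fun ξ' h1 h2 =>
        ⟨e4 ξ' h1 h2, f4 ξ' h1 h2⟩⟩
    intro hh
    have := congrArg Prod.fst hh
    dsimp only at this
    omega

/-! ### Products over nodes and zeros -/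

lemma prod_moves (k : ℕ) (g : Option (ℕ × ℤˣ) → ℂ) : ∏ x ∈ moves k, g x =
    (if Odd k then g none else 1) * ∏ i ∈ Icc 1 (k / 2), g (some (i, 1)) * g (some (i, -1)) := by
  have huniv : (univ : Finset ℤˣ) = {1, -1} := rfl
  rw [moves]
  split_ifs with hodd
  · rw [prod_insertNone, prod_product]
    congr 1
    refine prod_congr rfl fun i _ => ?_
    rw [huniv, prod_pair (by decide)]
  · rw [prod_map, prod_product, one_mul]
    refine prod_congr rfl fun i _ => ?_
    rw [huniv, prod_pair (by decide)]
    rfl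

lemma card_moves (k : ℕ) : #(moves k) = (if Odd k then 1 else 0) + 2 * (k / 2) := by
  rw [moves]
  have huniv : #(univ : Finset ℤˣ) = 2 := rfl
  split_ifs
  · rw [card_insertNone, card_product, huniv, Nat.card_Icc]
    omega
  · rw [card_map, card_product, huniv, Nat.card_Icc]
    omega

lemma card_adj {k : ℕ} (hk : 1 ≤ k) : #(adj k) = (k + 1) / 2 + (k - 1) / 2 := by
  have hdisj : Disjoint ({k + 1} ×ˢ Icc 1 ((k + 1) / 2) : Finset (ℕ × ℕ))
      ({k - 1} ×ˢ Icc 1 ((k - 1) / 2)) := by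
    rw [disjoint_left]
    rintro ⟨a, b⟩ h1 h2
    simp only [mem_product, mem_singleton] at h1 h2
    omega
  rw [adj, card_union_of_disjoint hdisj, card_product, card_product]
  simp

lemma sc_one (ξ : ℕ → ℕ → ℚ) (k i : ℕ) : sc ξ k (i, 1) = ctr ξ k i := by simp [sc, sq]

lemma sc_neg_one (ξ : ℕ → ℕ → ℚ) (k i : ℕ) : sc ξ k (i, -1) = -ctr ξ k i := by simp [sc, sq]

lemma prod_erase_some (g : Option (ℕ × ℤˣ) → ℂ) {x : ℕ × ℤˣ} (hx : some x ∈ moves k) :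
    ∏ y ∈ (moves k).erase (some x), g y = (if Odd k then g none else 1) *
      (g (opp (some x)) * ∏ i ∈ (Icc 1 (k / 2)).erase x.1, g (some (i, 1)) * g (some (i, -1))) := by
  obtain ⟨j, s⟩ := x
  have hj : j ∈ Icc 1 (k / 2) := mem_Icc.2 (some_mem_moves.1 hx)
  set g' : Option (ℕ × ℤˣ) → ℂ := Function.update g (some (j, s)) 1 with hg'
  have h1 : ∏ y ∈ (moves k).erase (some (j, s)), g y = ∏ y ∈ moves k, g' y := by
    rw [← mul_prod_erase _ _ hx, hg', Function.update_self, one_mul]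
    exact prod_congr rfl fun y hy => (Function.update_of_ne (ne_of_mem_erase hy) _ _).symm
  rw [h1, prod_moves, ← mul_prod_erase _ _ hj, hg', Function.update_of_ne (by simp)]
  congr 2
  · rcases Int.units_eq_one_or s with rfl | rfl
    · rw [Function.update_self, Function.update_of_ne (by simp), one_mul]
      rfl
    · rw [Function.update_self, Function.update_of_ne (by simp), mul_one]
      simp [opp]
  · refine prod_congr rfl fun i hi => ?_
    have := ne_of_mem_erase hi
    rw [Function.update_of_ne (by simp [this]), Function.update_of_ne (by simp [this])]

lemma qNum_adj_eq (h : ℂ) (u a : ℚ) : qNum h (u + a + 1 / 2) * qNum h (u - a - 1 / 2) =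
    -(qPow h 1 - qPow h (-1))⁻¹ ^ 2 * (nd h a - zr h u) := by
  rw [qNum_mul_qNum, nd_eq_zr, zr, zr,
    show u + a + 1 / 2 + (u - a - 1 / 2) = 2 * u by ring,
    show u + a + 1 / 2 - (u - a - 1 / 2) = 2 * (a + 1 / 2) by ring]
  ring

lemma qNum_same_row_eq (h : ℂ) (x a : ℚ) :
    qNum h (x + a) * qNum h (x - a) * qNum h (x + a + 1) * qNum h (x - a - 1) =
      (qPow h 1 - qPow h (-1))⁻¹ ^ 4 * ((nd h a - nd h x) * (nd h a - nd h (-x))) := by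
  have h1 := qNum_mul_qNum h (x + a) (x - a - 1)
  have h2 := qNum_mul_qNum h (x + a + 1) (x - a)
  rw [show x + a + (x - a - 1) = -(2 * (-x + 1 / 2)) by ring, neg_neg,
    show x + a - (x - a - 1) = 2 * (a + 1 / 2) by ring] at h1
  rw [show x + a + 1 + (x - a) = 2 * (x + 1 / 2) by ring,
    show x + a + 1 - (x - a) = 2 * (a + 1 / 2) by ring] at h2
  have e : qNum h (x + a) * qNum h (x - a) * qNum h (x + a + 1) * qNum h (x - a - 1) =
    qNum h (x + a) * qNum h (x - a - 1) * (qNum h (x + a + 1) * qNum h (x - a)) := by ring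
  rw [e, h1, h2, nd_eq_zr, nd_eq_zr, nd_eq_zr, zr, zr, zr]
  ring

/-- `rt` without the factors of the entries outside `U`, in terms of the nodes. -/
lemma prod_qNum_div_eq (h : ℂ) (ξ : ℕ → ℕ → ℚ) (U : Finset (ℕ × ℕ)) (j : ℕ) (a : ℚ) :
    (∏ u ∈ U, qNum h (ctr ξ u.1 u.2 + a + 1 / 2) * qNum h (ctr ξ u.1 u.2 - a - 1 / 2)) /
      ∏ i ∈ (Icc 1 (k / 2)).erase j, qNum h (ctr ξ k i + a) * qNum h (ctr ξ k i - a) *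
        qNum h (ctr ξ k i + a + 1) * qNum h (ctr ξ k i - a - 1) =
    (-(qPow h 1 - qPow h (-1))⁻¹ ^ 2) ^ #U /
        ((qPow h 1 - qPow h (-1))⁻¹ ^ 4) ^ #((Icc 1 (k / 2)).erase j) *
      ((∏ u ∈ U, (nd h a - zr h (ctr ξ u.1 u.2))) / ∏ i ∈ (Icc 1 (k / 2)).erase j,
        (nd h a - node h ξ k (some (i, 1))) * (nd h a - node h ξ k (some (i, -1)))) := by
  simp only [qNum_adj_eq, qNum_same_row_eq, node, sc_one, sc_neg_one, prod_mul_distrib, prod_const]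
  rw [mul_div_mul_comm]

end Nodes

/-! ### Paths along opposite moves: the terms -/

section Terms

variable {h : ℂ} {r : ℚ → ℂ} {n : ℕ} {m : ℕ → ℚ} {ε : ℕ → ℤˣ} {ξ ξ' : ℕ → ℕ → ℚ} {k k' : ℕ}

lemma nd_sub_nd_neg (hq : ∀ k : ℕ, 0 < k → Complex.exp h ^ k ≠ 1) (a : ℚ) :
    nd h a - nd h (-a) = qNum h (2 * a) * (qPow h 1 - qPow h (-1)) ^ 2 := by
  have hκ := qPow_sub_qPow_neg_ne_zero hq one_ne_zero
  rw [nd_eq_zr, nd_eq_zr, ← zr_neg h (-a + 1 / 2), zr_sub_zr h hκ]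
  rw [show a + 1 / 2 + -(-a + 1 / 2) = 2 * a by ring,
    show a + 1 / 2 - -(-a + 1 / 2) = 1 by ring, qNum, qNum, div_self hκ, mul_one]

lemma node_opp (h : ℂ) (ξ : ℕ → ℕ → ℚ) (k : ℕ) (x : ℕ × ℤˣ) :
    node h ξ k (opp (some x)) = nd h (-sc ξ k x) := by
  obtain ⟨j, s⟩ := x
  simp only [opp, Option.map_some, node, sc_neg]

/-- A root with some of the entries of the adjacent rows omitted, in terms of the nodes. -/
lemma prod_qNum_div_eq_nodes (hq : ∀ k : ℕ, 0 < k → Complex.exp h ^ k ≠ 1) (U : Finset (ℕ × ℕ))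
    {x : ℕ × ℤˣ} (hx : some x ∈ moves k) (h0 : sc ξ k x ≠ 0) :
    (∏ u ∈ U, qNum h (ctr ξ u.1 u.2 + sc ξ k x + 1 / 2) *
        qNum h (ctr ξ u.1 u.2 - sc ξ k x - 1 / 2)) /
      ∏ i ∈ (Icc 1 (k / 2)).erase x.1, qNum h (ctr ξ k i + sc ξ k x) *
        qNum h (ctr ξ k i - sc ξ k x) * qNum h (ctr ξ k i + sc ξ k x + 1) *
        qNum h (ctr ξ k i - sc ξ k x - 1) =
    (-(qPow h 1 - qPow h (-1))⁻¹ ^ 2) ^ #U * ((qPow h 1 - qPow h (-1)) ^ 4) ^ (k / 2 - 1) *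
      ((if Odd k then nd h (sc ξ k x) + 2 else 1) * (nd h (sc ξ k x) - nd h (-sc ξ k x))) *
      ((∏ u ∈ U, (node h ξ k (some x) - zr h (ctr ξ u.1 u.2))) /
        ∏ y ∈ (moves k).erase (some x), (node h ξ k (some x) - node h ξ k y)) := by
  have hκ := qPow_sub_qPow_neg_ne_zero hq one_ne_zero
  have h1 : nd h (sc ξ k x) - nd h (-sc ξ k x) ≠ 0 := by
    rw [nd_sub_nd_neg hq]
    exact mul_ne_zero (qNum_ne_zero hq (by simpa using h0)) (pow_ne_zero 2 hκ)
  have h2 : (if Odd k then nd h (sc ξ k x) + 2 else 1) ≠ 0 := by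
    split_ifs
    · exact fun h3 => nd_ne_neg_two hq _ (eq_neg_of_add_eq_zero_left h3)
    · exact one_ne_zero
  have hj : x.1 ∈ Icc 1 (k / 2) := by
    obtain ⟨j, s⟩ := x
    exact mem_Icc.2 (some_mem_moves.1 hx)
  rw [prod_qNum_div_eq, prod_erase_some _ hx, node_opp, card_erase_of_mem hj, Nat.card_Icc,
    Nat.add_sub_cancel]
  have h3 : (if Odd k then node h ξ k (some x) - node h ξ k none else 1) =
      if Odd k then nd h (sc ξ k x) + 2 else 1 := by
    simp only [node, sub_neg_eq_add]
  rw [h3, show node h ξ k (some x) = nd h (sc ξ k x) from rfl]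
  generalize (if Odd k then nd h (sc ξ k x) + 2 else 1) = c at h2 ⊢
  generalize nd h (sc ξ k x) - nd h (-sc ξ k x) = d at h1 ⊢
  rw [inv_pow, inv_pow, inv_pow, div_inv_eq_mul]
  field_simp

lemma wt_mul_wt_of_even (hq : ∀ k : ℕ, 0 < k → Complex.exp h ^ k ≠ 1) (hk : ¬Odd k) (a : ℚ) :
    wt h k a * wt h k (-(a + 1)) =
      -1 / ((qPow h 1 - qPow h (-1)) ^ 2 * qNum h a * qNum h (a + 1)) := by
  have hκ := qPow_sub_qPow_neg_ne_zero hq one_ne_zero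
  rw [wt, wt, if_neg hk, if_neg hk, neg_neg, qNum, qNum, ← neg_sub (qPow h (a + 1))]
  rw [show (qPow h 1 - qPow h (-1)) ^ 2 * ((qPow h a - qPow h (-a)) / (qPow h 1 - qPow h (-1))) *
    ((qPow h (a + 1) - qPow h (-(a + 1))) / (qPow h 1 - qPow h (-1))) =
    (qPow h a - qPow h (-a)) * (qPow h (a + 1) - qPow h (-(a + 1))) by field_simp]
  rw [div_mul_div_comm, one_mul, mul_neg, div_neg, neg_div]

lemma wt_mul_wt_of_odd (hk : Odd k) (a : ℚ) : wt h k a * wt h k (-(a + 1)) =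
    -1 / (qNum h (2 * a) * qNum h (2 * a + 2) * qNumPlus h (a + 1 / 2) ^ 2) := by
  rw [wt, wt, if_pos hk, if_pos hk, show 2 * -(a + 1) = -(2 * a + 2) by ring,
    show -(a + 1) + 1 / 2 = -(a + 1 / 2) by ring, qNum_neg, qNumPlus_neg, div_mul_div_comm, one_mul,
    show qNum h (2 * a) * qNumPlus h (a + 1 / 2) * (-qNum h (2 * a + 2) * qNumPlus h (a + 1 / 2)) =
      -(qNum h (2 * a) * qNum h (2 * a + 2) * qNumPlus h (a + 1 / 2) ^ 2) by ring, div_neg, neg_div]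

lemma qNum_two_mul (hq : ∀ k : ℕ, 0 < k → Complex.exp h ^ k ≠ 1) (a : ℚ) :
    qNum h (2 * a) = (qPow h 1 - qPow h (-1)) * (qNum h a * qNumPlus h a) := by
  have hκ := qPow_sub_qPow_neg_ne_zero hq one_ne_zero
  rw [qNum, qNum, qNumPlus, show -(2 * a) = 2 * (-a) by ring, qPow_two_mul, qPow_two_mul]
  field_simp
  ring

lemma nd_add_eq (hq : ∀ k : ℕ, 0 < k → Complex.exp h ^ k ≠ 1) (a : ℚ) :
    nd h a + (Complex.exp h + (Complex.exp h)⁻¹) =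
      (qPow h 1 - qPow h (-1)) ^ 2 * (qNumPlus h a * qNumPlus h (a + 1)) := by
  have hκ := qPow_sub_qPow_neg_ne_zero hq one_ne_zero
  rw [nd, qNumPlus, qNumPlus, ← qPow_one, ← qPow_neg,
    show 2 * a + 1 = a + (a + 1) by ring, neg_add a, qPow_add h a, qPow_add h (-a)]
  have e1 : qPow h 1 = qPow h (-a) * qPow h (a + 1) := by rw [← qPow_add]; congr 1; ring
  have e2 : qPow h (-1) = qPow h a * qPow h (-(a + 1)) := by rw [← qPow_add]; congr 1; ring
  generalize hκ' : qPow h 1 - qPow h (-1) = κ at hκ ⊢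
  rw [e1, e2]
  field_simp
  ring

lemma qNum_identity (hq : ∀ k : ℕ, 0 < k → Complex.exp h ^ k ≠ 1) (a b : ℚ) :
    qNum h (b + a + 1 / 2) * qNum h (b - a - 1 / 2) +
      qNum h (b + 1 + a + 1 / 2) * qNum h (b + 1 - a - 1 / 2) -
      (Complex.exp h + (Complex.exp h)⁻¹) *
        (qNum h (b + 1 + a + 1 / 2) * qNum h (b - a - 1 / 2)) = qNum h (2 * a + 2) := by
  have hκ := qPow_sub_qPow_neg_ne_zero hq one_ne_zero
  rw [qNum_mul_qNum, qNum_mul_qNum, qNum_mul_qNum, ← qPow_one, ← qPow_neg, qNum]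
  rw [show b + a + 1 / 2 + (b - a - 1 / 2) = b + b by ring,
    show b + a + 1 / 2 - (b - a - 1 / 2) = a + a + 1 by ring,
    show b + 1 + a + 1 / 2 + (b + 1 - a - 1 / 2) = b + b + 1 + 1 by ring,
    show b + 1 + a + 1 / 2 - (b + 1 - a - 1 / 2) = a + a + 1 by ring,
    show b + 1 + a + 1 / 2 + (b - a - 1 / 2) = b + b + 1 by ring,
    show b + 1 + a + 1 / 2 - (b - a - 1 / 2) = a + a + 1 + 1 by ring,
    show 2 * a + 2 = a + a + 1 + 1 by ring]
  have h1 := qPow_ne_zero h 1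
  have ha := qPow_ne_zero h a
  have hb := qPow_ne_zero h b
  simp only [qPow_neg, qPow_add] at hκ ⊢
  field_simp
  have hκ2 : qPow h 1 ^ 2 - 1 ≠ 0 := by
    intro h2
    apply hκ
    field_simp
    rw [h2, mul_zero]
  field_simp
  ring

lemma qNumPlus_identity (hq : ∀ k : ℕ, 0 < k → Complex.exp h ^ k ≠ 1) (b : ℚ) :
    qNumPlus h b ^ 2 + qNumPlus h (b + 1) ^ 2 -
      (Complex.exp h + (Complex.exp h)⁻¹) * (qNumPlus h b * qNumPlus h (b + 1)) = -1 := by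
  have hκ := qPow_sub_qPow_neg_ne_zero hq one_ne_zero
  have h1 := qPow_ne_zero h 1
  have hb := qPow_ne_zero h b
  rw [← qPow_one]
  simp only [qNumPlus, qPow_neg, qPow_add] at hκ ⊢
  have hκ2 : qPow h 1 ^ 2 - 1 ≠ 0 := by
    intro h2
    apply hκ
    field_simp
    rw [h2, mul_zero]
  field_simp
  ring

lemma qNumPlus_identity_two (hq : ∀ k : ℕ, 0 < k → Complex.exp h ^ k ≠ 1) (a : ℚ) :
    2 * qNumPlus h a - (Complex.exp h + (Complex.exp h)⁻¹) * qNumPlus h (a + 1) =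
      -(qPow h 1 - qPow h (-1)) * qNum h (a + 1) := by
  have hκ := qPow_sub_qPow_neg_ne_zero hq one_ne_zero
  have h1 := qPow_ne_zero h 1
  have hb := qPow_ne_zero h a
  rw [← qPow_one]
  simp only [qNumPlus, qNum, qPow_neg, qPow_add] at hκ ⊢
  have hκ2 : qPow h 1 ^ 2 - 1 ≠ 0 := by
    intro h2
    apply hκ
    field_simp
    rw [h2, mul_zero]
  field_simp
  ring

lemma add_mv_opp (ξ : ℕ → ℕ → ℚ) (k : ℕ) (x : Option (ℕ × ℤˣ)) (η : ℕ → ℕ → ℚ) :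
    ξ + mv k x + η + mv k (opp x) = ξ + η := by
  rw [mv_opp]
  abel

/-- The paths along a move, its opposite, and a move in an adjacent row. -/
lemma path_some_some (hq : ∀ k : ℕ, 0 < k → Complex.exp h ^ k ≠ 1)
    (hr : ∀ a : ℚ, 0 ≤ a → r a ^ 2 = qNum h a) (hk : 1 ≤ k) (hk' : 1 ≤ k') (hkn : k + 1 ≤ n)
    (hkn' : k' + 1 ≤ n) (hkk : RowAdj k k') {x y : ℕ × ℤˣ} (hx : some x ∈ moves k)
    (hy : some y ∈ moves k') (hξ : IsClassicalTableau n m ξ)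
    (hξ' : IsClassicalTableau n m (ξ + mv k' (some y))) :
    cf n m h r ε k (some x) ξ * cf n m h r ε k (opp (some x)) (ξ + mv k (some x)) *
          cf n m h r ε k' (some y) ξ
        - (Complex.exp h + (Complex.exp h)⁻¹) * (cf n m h r ε k (some x) ξ *
          cf n m h r ε k' (some y) (ξ + mv k (some x)) *
          cf n m h r ε k (opp (some x)) (ξ + mv k (some x) + mv k' (some y)))
        + cf n m h r ε k' (some y) ξ * cf n m h r ε k (some x) (ξ + mv k' (some y)) *
          cf n m h r ε k (opp (some x)) (ξ + mv k' (some y) + mv k (some x)) =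
      cf n m h r ε k' (some y) ξ * (wt h k (sc ξ k x) * wt h k (-(sc ξ k x + 1)) *
        qNum h (2 * sc ξ k x + 2) * rtErase (qNum h) ξ k x.1 (sc ξ k x) (k', y.1)) := by
  have hκ := qPow_sub_qPow_neg_ne_zero hq one_ne_zero
  have hf : ∀ x y : ℚ, qNum h (-x) * qNum h (-y) = qNum h x * qNum h y := by
    intro x y; rw [qNum_neg, qNum_neg, neg_mul_neg]
  have s1 : sc (ξ + mv k' (some y)) k x = sc ξ k x := sc_add_mv_of_ne _ _ fun hh => hkk.ne hh.1
  have w1 := cf_mul_cf_opp (ε := ε) hr hξ hkn hx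
  have w2 := cf_mul_cf_opp (ε := ε) hr hξ' hkn hx
  rw [rt_eq_mul_rtErase hf hk hkk hy] at w1 w2
  rw [rtErase_add_mv _ _ hkk, sc_add_mv_self, s1] at w2
  have ex := cf_exchange (ε := ε) (m := m) hq hr hk hk' hkn hkn' hkk hx hy ξ
  have e1 : qPow h (1 / 2) * (tt h ξ k' (some y) / tt h ξ k (some x)) =
      qPow h (sc ξ k' y + 1 - sc ξ k x - 1 / 2) := by
    rw [tt, tt, ← qPow_sub, ← qPow_add]; congr 1; ring
  have e2 : (qPow h (1 / 2))⁻¹ * (tt h ξ k' (some y) / tt h ξ k (some x)) =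
      qPow h (sc ξ k' y - sc ξ k x - 1 / 2) := by
    rw [tt, tt, ← qPow_sub, ← qPow_neg, ← qPow_add]; congr 1; ring
  rw [e1, e2, br_qPow hq, br_qPow hq] at ex
  have hne : qNum h (sc ξ k' y + 1 - sc ξ k x - 1 / 2) ≠ 0 := by
    apply qNum_ne_zero hq
    intro h0
    have h1 := (sc_lt_iff hξ hξ' hkk (by omega) (by omega) hx hy).2
      (by rw [s1, sc_add_mv_self]; linarith)
    linarith
  have mid : cf n m h r ε k (some x) ξ * cf n m h r ε k' (some y) (ξ + mv k (some x)) *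
      cf n m h r ε k (opp (some x)) (ξ + mv k (some x) + mv k' (some y)) =
      cf n m h r ε k' (some y) ξ * (wt h k (sc ξ k x) * wt h k (-(sc ξ k x + 1)) *
        (qNum h (sc ξ k' y + 1 + sc ξ k x + 1 / 2) * qNum h (sc ξ k' y - sc ξ k x - 1 / 2)) *
        rtErase (qNum h) ξ k x.1 (sc ξ k x) (k', y.1)) := by
    refine mul_right_cancel₀ (mul_ne_zero hκ hne) ?_
    rw [add_right_comm ξ (mv k (some x))]
    linear_combination
      cf n m h r ε k (opp (some x)) (ξ + mv k' (some y) + mv k (some x)) * ex +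
      cf n m h r ε k' (some y) ξ * (qPow h 1 - qPow h (-1)) *
        qNum h (sc ξ k' y - sc ξ k x - 1 / 2) * w2
  have id := qNum_identity hq (sc ξ k x) (sc ξ k' y)
  rw [mid]
  linear_combination cf n m h r ε k' (some y) ξ * w1 + cf n m h r ε k' (some y) ξ * w2 +
    cf n m h r ε k' (some y) ξ * wt h k (sc ξ k x) * wt h k (-(sc ξ k x + 1)) *
        rtErase (qNum h) ξ k x.1 (sc ξ k x) (k', y.1) * id

/-- A lowest entry of an odd row that equals one forces an entry `±1/2` in both adjacent rows. -/
lemma exists_abs_eq_half (hξ : IsClassicalTableau n m ξ) (hkn : k + 1 ≤ n) (hodd : Odd k) {j : ℕ}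
    (hj : 1 ≤ j) (hj' : j ≤ k / 2) (h1 : ctr ξ k j = 1) {o : ℕ} (ho : RowAdj k o) :
    ∃ e, 1 ≤ e ∧ e ≤ o / 2 ∧ zr h (ctr ξ o e) = zr h (1 / 2) := by
  obtain ⟨p, hp⟩ := hodd
  have hjp : j = p := by
    by_contra hne
    have h2 := hξ.abs_ctr_lt hkn hj (show j < p by omega) (by omega)
    have h3 := hξ.ctr_pos hkn ⟨p, hp⟩ (show 1 ≤ p by omega) (by omega)
    have h4 := one_le_of_int (hξ.isInt_sub (by omega : k ≤ n) hj hj' (show 1 ≤ p by omega)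
      (by omega)) (by linarith [le_abs_self (ctr ξ k p)])
    linarith
  have key : ∀ e, 1 ≤ e → e ≤ o / 2 → |ctr ξ o e| < 1 →
      ∃ e, 1 ≤ e ∧ e ≤ o / 2 ∧ zr h (ctr ξ o e) = zr h (1 / 2) := by
    intro e he he' habs
    refine ⟨e, he, he', ?_⟩
    obtain ⟨b1, b2⟩ := abs_lt.1 habs
    have hhalf := hξ.isHalfIntegral_sc ho (by omega) (by rcases ho with h | h <;> omega)
      (x := (j, 1)) (y := (e, 1)) (some_mem_moves.2 ⟨hj, hj'⟩) (some_mem_moves.2 ⟨he, he'⟩)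
    simp only [sc, sq, Units.val_one, Int.cast_one, one_mul, h1] at hhalf
    obtain ⟨z, hz⟩ := hhalf
    have c1 : (-3 : ℚ) < z := by linarith
    have c2 : (z : ℚ) < 0 := by linarith
    have c3 : -3 < z := by exact_mod_cast c1
    have c4 : z < 0 := by exact_mod_cast c2
    obtain rfl | rfl : z = -1 ∨ z = -2 := by omega
    · rw [show ctr ξ o e = 1 / 2 by push_cast at hz; linarith]
    · rw [show ctr ξ o e = -(1 / 2) by push_cast at hz; linarith, zr_neg]
  rcases ho with rfl | rfl
  · obtain ⟨a1, -, a3⟩ := hξ.interlaces hkn (i := p + 1) (j := j) (by omega) (by omega) hj hj'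
    exact key (p + 1) (by omega) (by omega)
      (abs_lt.2 ⟨by linarith, by linarith [a3 (by omega)]⟩)
  · obtain ⟨a1, a2, -⟩ := hξ.interlaces (show o + 1 ≤ n by omega) (i := j) (j := p) hj hj'
      (by omega) (by omega)
    exact key p (by omega) (by omega)
      (abs_lt.2 ⟨by linarith, by linarith [a2 (by omega)]⟩)

lemma IsClassicalTableau.sc_ne_zero (hξ : IsClassicalTableau n m ξ) (hkn : k + 1 ≤ n)
    {x : ℕ × ℤˣ} (hx : some x ∈ moves k) : sc ξ k x ≠ 0 := by
  obtain ⟨j, s⟩ := x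
  obtain ⟨hj, hj'⟩ := some_mem_moves.1 hx
  have h0 := hξ.ctr_ne_zero hkn hj hj'
  rcases sq_cases s with hs | hs <;> simp [sc, hs, h0]

lemma IsClassicalTableau.ctr_eq_one_of_sc (hξ : IsClassicalTableau n m ξ) (hkn : k + 1 ≤ n)
    {x : ℕ × ℤˣ} (hx : some x ∈ moves k) (h1 : sc ξ k x + 1 = 0) :
    Odd k ∧ ctr ξ k x.1 = 1 := by
  obtain ⟨j, s⟩ := x
  obtain ⟨hj, hj'⟩ := some_mem_moves.1 hx
  have hodd : Odd k := by
    by_contra hne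
    obtain ⟨p, rfl⟩ := Nat.not_odd_iff_even.1 hne
    obtain ⟨z, hz⟩ := hξ.exists_ctr_eq (by omega) hj hj'
    simp only [sc] at h1
    have h2 : ctr ξ (p + p) j = 1 ∨ ctr ξ (p + p) j = -1 := by
      rcases sq_cases s with hs | hs <;> rw [hs] at h1
      · right; linarith
      · left; linarith
    push_cast at hz
    rcases h2 with h2 | h2 <;> rw [h2] at hz
    · have h3 : ((2 * z + 2 * p + 1 : ℤ) : ℚ) = ((2 : ℤ) : ℚ) := by push_cast; linarith
      have h4 : 2 * z + 2 * p + 1 = 2 := by exact_mod_cast h3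
      omega
    · have h3 : ((2 * z + 2 * p + 1 : ℤ) : ℚ) = ((-2 : ℤ) : ℚ) := by push_cast; linarith
      have h4 : 2 * z + 2 * p + 1 = -2 := by exact_mod_cast h3
      omega
  refine ⟨hodd, ?_⟩
  have hpos := hξ.ctr_pos hkn hodd hj hj'
  simp only [sc] at h1
  rcases sq_cases s with hs | hs <;> rw [hs] at h1 <;> dsimp only <;> linarith

/-- The diagonal term as a path, next to a move in an adjacent row. -/
lemma dg_sq_eq (hq : ∀ k : ℕ, 0 < k → Complex.exp h ^ k ≠ 1) (hk : 1 ≤ k) (hodd : Odd k)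
    (hkk : RowAdj k k') {y : ℕ × ℤˣ} (hy : some y ∈ moves k') :
    dg h ε k ξ ^ 2 + dg h ε k (ξ + mv k' (some y)) ^ 2 -
      (Complex.exp h + (Complex.exp h)⁻¹) * (dg h ε k ξ * dg h ε k (ξ + mv k' (some y))) =
    -((∏ u ∈ (adj k).erase (k', y.1), (node h ξ k none - zr h (ctr ξ u.1 u.2))) /
      ∏ z ∈ (moves k).erase none, (node h ξ k none - node h ξ k z)) := by
  have hκ := qPow_sub_qPow_neg_ne_zero hq one_ne_zero
  obtain ⟨R, h1, h2, h3⟩ := exists_dg_adj h ε hk hkk hy ξ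
  have hy' : (k', y.1) ∈ adj k := by
    obtain ⟨i, t⟩ := y
    exact (mem_adj hk).2 ⟨hkk, some_mem_moves.1 hy⟩
  have id := qNumPlus_identity hq (sc ξ k' y)
  have hR : R ^ 2 = (∏ u ∈ (adj k).erase (k', y.1), (node h ξ k none - zr h (ctr ξ u.1 u.2))) /
      ∏ z ∈ (moves k).erase none, (node h ξ k none - node h ξ k z) := by
    have hmem : none ∈ moves k := none_mem_moves.2 hodd
    have m1 : ∏ z ∈ (moves k).erase none, (node h ξ k none - node h ξ k z) =
        ∏ i ∈ Icc 1 (k / 2), (-2 - nd h (ctr ξ k i)) * (-2 - nd h (-ctr ξ k i)) := by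
      set g : Option (ℕ × ℤˣ) → ℂ := Function.update
        (fun z => node h ξ k none - node h ξ k z) none 1 with hg
      have : ∏ z ∈ (moves k).erase none, (node h ξ k none - node h ξ k z) =
          ∏ z ∈ moves k, g z := by
        rw [← mul_prod_erase _ _ hmem, hg, Function.update_self, one_mul]
        exact prod_congr rfl fun y hy => by rw [Function.update_of_ne (ne_of_mem_erase hy)]
      rw [this, prod_moves, if_pos hodd, hg, Function.update_self, one_mul]
      refine prod_congr rfl fun i _ => ?_
      rw [Function.update_of_ne (by simp), Function.update_of_ne (by simp)]
      simp only [node, sc_one, sc_neg_one]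
    have hs : sgn (ε (k + 1)) ^ 2 = 1 := by
      rcases Int.units_eq_one_or (ε (k + 1)) with h | h <;> simp [h, sgn]
    obtain ⟨p, hp⟩ := hodd
    have c1 : #((adj k).erase (k', y.1)) = 2 * p := by
      rw [card_erase_of_mem hy', card_adj hk]
      omega
    have c2 : k / 2 = p := by omega
    have n1 : ∏ u ∈ (adj k).erase (k', y.1), qNumPlus h (ctr ξ u.1 u.2) ^ 2 =
        (∏ u ∈ (adj k).erase (k', y.1), (node h ξ k none - zr h (ctr ξ u.1 u.2))) *
          ((qPow h 1 - qPow h (-1))⁻¹ ^ 4) ^ p := by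
      simp only [qNumPlus_sq, node]
      rw [prod_mul_distrib, prod_const, c1, ← pow_mul, ← pow_mul]
      congr 1
      · rw [show ∏ u ∈ (adj k).erase (k', y.1), (zr h (ctr ξ u.1 u.2) + 2) =
          ∏ u ∈ (adj k).erase (k', y.1), (-1) * (-2 - zr h (ctr ξ u.1 u.2)) from
            prod_congr rfl fun u _ => by ring, prod_mul_distrib, prod_const, c1, pow_mul]
        simp
      · congr 1
        ring
    have n2 : ∏ i ∈ Icc 1 (k / 2),
        (qNumPlus h (ctr ξ k i + 1 / 2) * qNumPlus h (ctr ξ k i - 1 / 2)) ^ 2 =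
        (∏ i ∈ Icc 1 (k / 2), (-2 - nd h (ctr ξ k i)) * (-2 - nd h (-ctr ξ k i))) *
          ((qPow h 1 - qPow h (-1))⁻¹ ^ 4) ^ p := by
      have : ((qPow h 1 - qPow h (-1))⁻¹ ^ 4) ^ p =
          ∏ i ∈ Icc 1 (k / 2), (qPow h 1 - qPow h (-1))⁻¹ ^ 4 := by
        rw [prod_const, Nat.card_Icc, c2, Nat.add_sub_cancel]
      rw [this, ← prod_mul_distrib]
      refine prod_congr rfl fun i _ => ?_
      rw [mul_pow, qNumPlus_sq, qNumPlus_sq, nd_eq_zr, nd_eq_zr,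
        ← zr_neg h (ctr ξ k i - 1 / 2), show -(ctr ξ k i - 1 / 2) = -ctr ξ k i + 1 / 2 by ring]
      ring
    rw [h3, mul_pow, hs, one_mul, div_pow, ← prod_pow, ← prod_pow, n1, n2, m1,
      mul_div_mul_right _ _ (pow_ne_zero _ (pow_ne_zero _ (inv_ne_zero hκ)))]
  rw [h1, h2, ← hR]
  linear_combination R ^ 2 * id

end Terms

/-! ### Paths along opposite moves: the sums -/

section Sums

variable {h : ℂ} {r : ℚ → ℂ} {n : ℕ} {m : ℕ → ℚ} {ε : ℕ → ℤˣ} {ξ ξ' : ℕ → ℕ → ℚ} {k k' : ℕ}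

lemma neg_inv_sq_pow_mul {c : ℂ} (hc : c ≠ 0) (N : ℕ) :
    (-c⁻¹ ^ 2) ^ (2 * N) * (c ^ 4) ^ N = 1 := by
  rw [pow_mul, ← mul_pow, neg_sq, ← pow_mul, inv_pow, inv_mul_cancel₀ (pow_ne_zero 4 hc), one_pow]

/-- Interpolation for an even row `k`, with all the entries of the adjacent rows. -/
lemma sum_nodes_adj (hq : ∀ k : ℕ, 0 < k → Complex.exp h ^ k ≠ 1) (hk : 1 ≤ k) (hkn : k + 1 ≤ n)
    (heven : ¬Odd k) (hξ : IsClassicalTableau n m ξ) :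
    ∑ x ∈ moves k, (∏ u ∈ adj k, (node h ξ k x - zr h (ctr ξ u.1 u.2))) /
      ∏ y ∈ (moves k).erase x, (node h ξ k x - node h ξ k y) = 1 := by
  refine sum_prod_div_prod_eq_one (node h ξ k) (fun u : ℕ × ℕ => zr h (ctr ξ u.1 u.2)) (moves k)
    (adj k) ?_ fun x hx y hy hxy hnd => ?_
  · rw [card_adj hk, card_moves, if_neg heven]
    obtain ⟨p, rfl⟩ := Nat.not_odd_iff_even.1 heven
    omega
  · obtain ⟨h1, u, hu, v, hv, huv, h2, h3, -⟩ := node_eq_node hq hk hξ hkn hx hy hxy hnd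
    exact ⟨h1, u, hu, v, hv, huv, h2, h3⟩

/-- Interpolation for an odd row `k`; one movable entry of the adjacent rows is omitted. -/
lemma sum_nodes_erase_of_odd (hq : ∀ k : ℕ, 0 < k → Complex.exp h ^ k ≠ 1) (hk : 1 ≤ k)
    (hkn : k + 1 ≤ n) (hodd : Odd k) (hξ : IsClassicalTableau n m ξ)
    (hξ' : IsClassicalTableau n m ξ') (hrow : ∀ j, ctr ξ' k j = ctr ξ k j) {e : ℕ × ℕ}
    (he : e ∈ adj k) (hne : ctr ξ' e.1 e.2 ≠ ctr ξ e.1 e.2) :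
    ∑ x ∈ moves k, (∏ u ∈ (adj k).erase e, (node h ξ k x - zr h (ctr ξ u.1 u.2))) /
      ∏ y ∈ (moves k).erase x, (node h ξ k x - node h ξ k y) = 1 := by
  refine sum_prod_div_prod_eq_one (node h ξ k) (fun u : ℕ × ℕ => zr h (ctr ξ u.1 u.2)) (moves k)
    ((adj k).erase e) ?_ fun x hx y hy hxy hnd => ?_
  · rw [card_erase_of_mem he, card_adj hk, card_moves, if_pos hodd]
    obtain ⟨p, rfl⟩ := hodd
    omega
  · obtain ⟨h1, u, hu, v, hv, huv, h2, h3, h4⟩ := node_eq_node hq hk hξ hkn hx hy hxy hnd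
    obtain ⟨i1, i2⟩ := h4 ξ' hξ' hrow
    exact ⟨h1, u, mem_erase.2 ⟨fun hh => hne (hh ▸ i1), hu⟩, v,
      mem_erase.2 ⟨fun hh => hne (hh ▸ i2), hv⟩, huv, h2, h3⟩

/-- Interpolation for an even row `k`; one movable entry of the adjacent rows is replaced by an
arbitrary zero. -/
lemma sum_nodes_erase_of_even (hq : ∀ k : ℕ, 0 < k → Complex.exp h ^ k ≠ 1) (hk : 1 ≤ k)
    (hkn : k + 1 ≤ n) (heven : ¬Odd k) (hξ : IsClassicalTableau n m ξ)
    (hξ' : IsClassicalTableau n m ξ') (hrow : ∀ j, ctr ξ' k j = ctr ξ k j) {e : ℕ × ℕ}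
    (he : e ∈ adj k) (hne : ctr ξ' e.1 e.2 ≠ ctr ξ e.1 e.2) (c : ℂ) :
    ∑ x ∈ moves k, (node h ξ k x - c) *
      ((∏ u ∈ (adj k).erase e, (node h ξ k x - zr h (ctr ξ u.1 u.2))) /
        ∏ y ∈ (moves k).erase x, (node h ξ k x - node h ξ k y)) = 1 := by
  have key := sum_prod_div_prod_eq_one (node h ξ k)
    (fun u : Option (ℕ × ℕ) => u.elim c fun u => zr h (ctr ξ u.1 u.2)) (moves k)
    (insertNone ((adj k).erase e)) ?_ fun x hx y hy hxy hnd => ?_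
  · rw [← key]
    refine sum_congr rfl fun x _ => ?_
    rw [prod_insertNone, mul_div_assoc]
    rfl
  · rw [card_insertNone, card_erase_of_mem he, card_adj hk, card_moves, if_neg heven]
    obtain ⟨p, rfl⟩ := Nat.not_odd_iff_even.1 heven
    omega
  · obtain ⟨h1, u, hu, v, hv, huv, h2, h3, h4⟩ := node_eq_node hq hk hξ hkn hx hy hxy hnd
    obtain ⟨i1, i2⟩ := h4 ξ' hξ' hrow
    exact ⟨h1, some u, some_mem_insertNone.2 (mem_erase.2 ⟨fun hh => hne (hh ▸ i1), hu⟩), some v,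
      some_mem_insertNone.2 (mem_erase.2 ⟨fun hh => hne (hh ▸ i2), hv⟩),
      fun hh => huv (Option.some.inj hh), h2, h3⟩

/-- The paths along opposite moves next to the diagonal term of an adjacent row. -/
lemma sum_opposite_paths_none (hq : ∀ k : ℕ, 0 < k → Complex.exp h ^ k ≠ 1)
    (hr : ∀ a : ℚ, 0 ≤ a → r a ^ 2 = qNum h a) (hk : 1 ≤ k) (hk' : 1 ≤ k') (hkn : k + 1 ≤ n)
    (hkk : RowAdj k k') (hodd' : Odd k') (hξ : IsClassicalTableau n m ξ) :
    ∑ x ∈ moves k, (cf n m h r ε k x ξ * cf n m h r ε k (opp x) (ξ + mv k x) *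
          cf n m h r ε k' none ξ
        - (Complex.exp h + (Complex.exp h)⁻¹) * (cf n m h r ε k x ξ *
          cf n m h r ε k' none (ξ + mv k x) * cf n m h r ε k (opp x) (ξ + mv k x))
        + cf n m h r ε k' none ξ * cf n m h r ε k x ξ *
          cf n m h r ε k (opp x) (ξ + mv k x)) = -cf n m h r ε k' none ξ := by
  have hκ := qPow_sub_qPow_neg_ne_zero hq one_ne_zero
  have heven : ¬Odd k := by
    rcases hkk with rfl | rfl
    · exact fun hodd => Nat.odd_add_one.1 hodd' hodd
    · exact fun hodd => Nat.odd_add_one.1 hodd hodd'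
  refine Eq.trans ?_ (mul_neg_one _)
  rw [← sum_nodes_adj hq hk hkn heven hξ,
    ← sum_neg_distrib, mul_sum]
  refine sum_congr rfl fun x hx => ?_
  rcases x with _ | x
  · exact absurd (none_mem_moves.1 hx) heven
  have h0 := hξ.sc_ne_zero hkn hx
  have h1 : sc ξ k x + 1 ≠ 0 := fun hh => heven (hξ.ctr_eq_one_of_sc hkn hx hh).1
  have w := cf_mul_cf_opp (ε := ε) hr hξ hkn hx
  have hdiag : cf n m h r ε k (some x) ξ * cf n m h r ε k' none (ξ + mv k (some x)) *
      qNumPlus h (sc ξ k x) = cf n m h r ε k (some x) ξ * (cf n m h r ε k' none ξ *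
      qNumPlus h (sc ξ k x + 1)) := by
    by_cases hP : IsClassicalTableau n m (ξ + mv k (some x))
    · obtain ⟨R, e1, e2, -⟩ := exists_dg_adj h ε hk' hkk.symm hx ξ
      rw [show cf n m h r ε k' none ξ = dg h ε k' ξ from if_pos ⟨hξ, by simpa [mv_none]⟩,
        show cf n m h r ε k' none (ξ + mv k (some x)) = dg h ε k' (ξ + mv k (some x)) from
          if_pos ⟨hP, by simpa [mv_none]⟩, e1, e2]
      ring
    · rw [cf_eq_zero_of_not_target hP, zero_mul, zero_mul, zero_mul]
  have hrt := prod_qNum_div_eq_nodes hq (adj k) hx h0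
  rw [← rt, if_neg heven, one_mul, nd_sub_nd_neg hq, qNum_two_mul hq] at hrt
  have hcard : #(adj k) = 2 * (k / 2 - 1) + 1 := by
    rw [card_adj hk]
    obtain ⟨p, rfl⟩ := Nat.not_odd_iff_even.1 heven
    omega
  have hpow : (-(qPow h 1 - qPow h (-1))⁻¹ ^ 2) ^ (2 * (k / 2 - 1) + 1) *
      ((qPow h 1 - qPow h (-1)) ^ 4) ^ (k / 2 - 1) = -(qPow h 1 - qPow h (-1))⁻¹ ^ 2 := by
    rw [pow_succ, mul_right_comm, neg_inv_sq_pow_mul hκ, one_mul]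
  rw [hcard, hpow] at hrt
  rw [wt_mul_wt_of_even hq heven, hrt] at w
  generalize (∏ u ∈ adj k, (node h ξ k (some x) - zr h (ctr ξ u.1 u.2))) /
    ∏ y ∈ (moves k).erase (some x), (node h ξ k (some x) - node h ξ k y) = P at w ⊢
  have hp := qNumPlus_ne_zero hq (sc ξ k x)
  have n0 := qNum_ne_zero hq h0
  have n1 := qNum_ne_zero hq h1
  have id := qNumPlus_identity_two hq (sc ξ k x)
  refine mul_right_cancel₀ hp ?_
  have step : (cf n m h r ε k (some x) ξ * cf n m h r ε k (opp (some x)) (ξ + mv k (some x)) *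
          cf n m h r ε k' none ξ
        - (Complex.exp h + (Complex.exp h)⁻¹) * (cf n m h r ε k (some x) ξ *
          cf n m h r ε k' none (ξ + mv k (some x)) *
          cf n m h r ε k (opp (some x)) (ξ + mv k (some x)))
        + cf n m h r ε k' none ξ * cf n m h r ε k (some x) ξ *
          cf n m h r ε k (opp (some x)) (ξ + mv k (some x))) * qNumPlus h (sc ξ k x) =
      cf n m h r ε k (some x) ξ * cf n m h r ε k (opp (some x)) (ξ + mv k (some x)) *
        cf n m h r ε k' none ξ * (-(qPow h 1 - qPow h (-1)) * qNum h (sc ξ k x + 1)) := by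
    rw [← id]
    linear_combination -(Complex.exp h + (Complex.exp h)⁻¹) *
      cf n m h r ε k (opp (some x)) (ξ + mv k (some x)) * hdiag
  rw [step, w]
  field_simp

/-- The paths along opposite moves next to a proper move in an adjacent row. -/
lemma sum_opposite_paths_some (hq : ∀ k : ℕ, 0 < k → Complex.exp h ^ k ≠ 1)
    (hr : ∀ a : ℚ, 0 ≤ a → r a ^ 2 = qNum h a) (hk : 1 ≤ k) (hk' : 1 ≤ k') (hkn : k + 1 ≤ n)
    (hkn' : k' + 1 ≤ n) (hkk : RowAdj k k') {y : ℕ × ℤˣ} (hy : some y ∈ moves k')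
    (hξ : IsClassicalTableau n m ξ) (hξ' : IsClassicalTableau n m (ξ + mv k' (some y))) :
    ∑ x ∈ moves k, (cf n m h r ε k x ξ * cf n m h r ε k (opp x) (ξ + mv k x) *
          cf n m h r ε k' (some y) ξ
        - (Complex.exp h + (Complex.exp h)⁻¹) * (cf n m h r ε k x ξ *
          cf n m h r ε k' (some y) (ξ + mv k x) *
          cf n m h r ε k (opp x) (ξ + mv k x + mv k' (some y)))
        + cf n m h r ε k' (some y) ξ * cf n m h r ε k x (ξ + mv k' (some y)) *
          cf n m h r ε k (opp x) (ξ + mv k' (some y) + mv k x)) =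
      -cf n m h r ε k' (some y) ξ := by
  have hκ := qPow_sub_qPow_neg_ne_zero hq one_ne_zero
  have hy' : (k', y.1) ∈ adj k := by
    obtain ⟨i, t⟩ := y
    exact (mem_adj hk).2 ⟨hkk, some_mem_moves.1 hy⟩
  have hrow : ∀ j, ctr (ξ + mv k' (some y)) k j = ctr ξ k j := fun j =>
    ctr_add_mv_of_ne ξ y.2 fun hh => hkk.ne hh.1
  have hne : ctr (ξ + mv k' (some y)) k' y.1 ≠ ctr ξ k' y.1 := by
    obtain ⟨i, t⟩ := y
    rw [ctr_add_mv_self]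
    rcases sq_cases t with ht | ht <;> rw [ht] <;> intro h0 <;> linarith
  by_cases hodd : Odd k
  · refine Eq.trans ?_ (mul_neg_one _)
    rw [← sum_nodes_erase_of_odd hq hk hkn hodd hξ hξ' hrow hy' hne, ← sum_neg_distrib, mul_sum]
    refine sum_congr rfl fun x hx => ?_
    rcases x with _ | x
    · simp only [mv_none, add_zero, opp, Option.map_none]
      rw [show cf n m h r ε k none ξ = dg h ε k ξ from if_pos ⟨hξ, by simpa [mv_none]⟩,
        show cf n m h r ε k none (ξ + mv k' (some y)) = dg h ε k (ξ + mv k' (some y)) from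
          if_pos ⟨hξ', by simpa [mv_none]⟩]
      linear_combination cf n m h r ε k' (some y) ξ *
        dg_sq_eq (ξ := ξ) (ε := ε) hq hk hodd hkk hy
    have h0 := hξ.sc_ne_zero hkn hx
    rw [path_some_some hq hr hk hk' hkn hkn' hkk hx hy hξ hξ', wt_mul_wt_of_odd hodd]
    congr 1
    by_cases h1 : sc ξ k x + 1 = 0
    · -- the entry is `1` and moves to `0`; the other adjacent row blocks this move
      obtain ⟨-, hc⟩ := hξ.ctr_eq_one_of_sc hkn hx h1
      obtain ⟨j, s⟩ := x
      obtain ⟨hj, hj'⟩ := some_mem_moves.1 hx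
      obtain ⟨o, ho, hok⟩ : ∃ o, RowAdj k o ∧ o ≠ k' := by
        rcases hkk with rfl | rfl
        · exact ⟨k - 1, Or.inr (by omega), by omega⟩
        · exact ⟨k' + 1 + 1, Or.inl rfl, by omega⟩
      obtain ⟨e, he, he', hz⟩ := exists_abs_eq_half (h := h) hξ hkn hodd hj hj' hc ho
      have hmem : (o, e) ∈ (adj k).erase (k', y.1) :=
        mem_erase.2 ⟨fun hh => hok (congrArg Prod.fst hh), (mem_adj hk).2 ⟨ho, he, he'⟩⟩
      rw [prod_eq_zero hmem, show 2 * sc ξ k (j, s) + 2 = 0 by linarith, qNum_zero]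
      · simp
      · dsimp only
        rw [hz, node, nd_eq_zr, show sc ξ k (j, s) + 1 / 2 = -(1 / 2) by linarith, zr_neg, sub_self]
    · have hrt := prod_qNum_div_eq_nodes hq ((adj k).erase (k', y.1)) hx h0
      rw [← rtErase, if_pos hodd, nd_sub_nd_neg hq] at hrt
      have h2 : 1 ≤ k / 2 := by
        obtain ⟨j, s⟩ := x
        have := some_mem_moves.1 hx
        omega
      have hcard : #((adj k).erase (k', y.1)) = 2 * (k / 2 - 1 + 1) := by
        rw [card_erase_of_mem hy', card_adj hk]
        obtain ⟨p, rfl⟩ := hodd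
        omega
      have hpow : (-(qPow h 1 - qPow h (-1))⁻¹ ^ 2) ^ (2 * (k / 2 - 1 + 1)) *
          ((qPow h 1 - qPow h (-1)) ^ 4) ^ (k / 2 - 1) = (qPow h 1 - qPow h (-1))⁻¹ ^ 4 := by
        rw [mul_add, mul_one, pow_add, mul_right_comm, neg_inv_sq_pow_mul hκ, one_mul]
        ring
      rw [hcard, hpow] at hrt
      rw [hrt]
      have hp := qNumPlus_sq h (sc ξ k x + 1 / 2)
      rw [← nd_eq_zr] at hp
      have n0 := qNum_ne_zero hq (a := 2 * sc ξ k x) (by simpa using h0)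
      have n1 := qNum_ne_zero hq (a := 2 * sc ξ k x + 2) (fun hh => h1 (by linarith))
      have n2 : nd h (sc ξ k x) + 2 ≠ 0 :=
        fun h3 => nd_ne_neg_two hq _ (eq_neg_of_add_eq_zero_left h3)
      rw [hp]
      generalize qNum h (2 * sc ξ k x + 2) = z at n1 ⊢
      field_simp
  · refine Eq.trans ?_ (mul_neg_one _)
    rw [← sum_nodes_erase_of_even hq hk hkn hodd hξ hξ' hrow hy' hne
        (-(Complex.exp h + (Complex.exp h)⁻¹)), ← sum_neg_distrib, mul_sum]
    refine sum_congr rfl fun x hx => ?_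
    rcases x with _ | x
    · exact absurd (none_mem_moves.1 hx) hodd
    have h0 := hξ.sc_ne_zero hkn hx
    have h1 : sc ξ k x + 1 ≠ 0 := fun hh => hodd (hξ.ctr_eq_one_of_sc hkn hx hh).1
    rw [path_some_some hq hr hk hk' hkn hkn' hkk hx hy hξ hξ', wt_mul_wt_of_even hq hodd]
    congr 1
    have hrt := prod_qNum_div_eq_nodes hq ((adj k).erase (k', y.1)) hx h0
    rw [← rtErase, if_neg hodd, one_mul, nd_sub_nd_neg hq, qNum_two_mul hq] at hrt
    have hcard : #((adj k).erase (k', y.1)) = 2 * (k / 2 - 1) := by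
      rw [card_erase_of_mem hy', card_adj hk]
      obtain ⟨p, rfl⟩ := Nat.not_odd_iff_even.1 hodd
      omega
    rw [hcard, neg_inv_sq_pow_mul hκ, one_mul] at hrt
    rw [hrt, show 2 * sc ξ k x + 2 = 2 * (sc ξ k x + 1) by ring, qNum_two_mul hq, sub_neg_eq_add,
      show node h ξ k (some x) + (Complex.exp h + (Complex.exp h)⁻¹) = _ from nd_add_eq hq _]
    have n0 := qNum_ne_zero hq h0
    have n1 := qNum_ne_zero hq h1
    field_simp

/-- The paths along opposite moves in a row, next to a move in an adjacent row, add up to the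
right-hand side of the cubic relation. -/
lemma sum_opposite_paths (hq : ∀ k : ℕ, 0 < k → Complex.exp h ^ k ≠ 1)
    (hr : ∀ a : ℚ, 0 ≤ a → r a ^ 2 = qNum h a) (hk : 1 ≤ k) (hk' : 1 ≤ k') (hkn : k + 1 ≤ n)
    (hkn' : k' + 1 ≤ n) (hkk : RowAdj k k') {y : Option (ℕ × ℤˣ)} (hy : y ∈ moves k')
    (ξ : ℕ → ℕ → ℚ) :
    ∑ x ∈ moves k, (cf n m h r ε k x ξ * cf n m h r ε k (opp x) (ξ + mv k x) *
          cf n m h r ε k' y ξ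
        - (Complex.exp h + (Complex.exp h)⁻¹) * (cf n m h r ε k x ξ *
          cf n m h r ε k' y (ξ + mv k x) *
          cf n m h r ε k (opp x) (ξ + mv k x + mv k' y))
        + cf n m h r ε k' y ξ * cf n m h r ε k x (ξ + mv k' y) *
          cf n m h r ε k (opp x) (ξ + mv k' y + mv k x)) =
      -cf n m h r ε k' y ξ := by
  by_cases hξ : IsClassicalTableau n m ξ
  swap
  · simp [cf_eq_zero_of_not_source hξ]
  by_cases hξ' : IsClassicalTableau n m (ξ + mv k' y)
  swap
  · have c1 : cf n m h r ε k' y ξ = 0 := cf_eq_zero_of_not_target hξ'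
    have c2 : ∀ x, cf n m h r ε k (opp x) (ξ + mv k x + mv k' y) = 0 := fun x =>
      cf_eq_zero_of_not_target (by rwa [add_mv_opp])
    simp [c1, c2]
  rcases y with _ | y
  · have := sum_opposite_paths_none (ε := ε) hq hr hk hk' hkn hkk (none_mem_moves.1 hy) hξ
    simpa only [mv_none, add_zero] using this
  · exact sum_opposite_paths_some hq hr hk hk' hkn hkn' hkk hy hξ hξ'

end Sums

/-! ### The operators as sums over moves -/

section Operators

variable {h : ℂ} {r : ℚ → ℂ} {n : ℕ} {m : ℕ → ℚ} {ε : ℕ → ℤˣ} {ξ : ℕ → ℕ → ℚ} {k k' : ℕ}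

lemma sum_moves {V : Type*} [AddCommMonoid V] (k : ℕ) (g : Option (ℕ × ℤˣ) → V) :
    ∑ x ∈ moves k, g x =
      (if Odd k then g none else 0) +
        ∑ i ∈ Icc 1 (k / 2), (g (some (i, 1)) + g (some (i, -1))) := by
  have huniv : (univ : Finset ℤˣ) = {1, -1} := rfl
  rw [moves]
  split_ifs with hodd
  · rw [sum_insertNone, sum_product]
    congr 1
    refine sum_congr rfl fun i _ => ?_
    rw [huniv, sum_pair (by decide)]
  · rw [sum_map, sum_product, zero_add]
    refine sum_congr rfl fun i _ => ?_
    rw [huniv, sum_pair (by decide)]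
    rfl

lemma prod_adj (k : ℕ) (hk : 1 ≤ k) (g : ℕ × ℕ → ℂ) : ∏ u ∈ adj k, g u =
    (∏ i ∈ Icc 1 ((k + 1) / 2), g (k + 1, i)) * ∏ i ∈ Icc 1 ((k - 1) / 2), g (k - 1, i) := by
  rw [adj, prod_union, prod_product, prod_product, prod_singleton, prod_singleton]
  rw [disjoint_left]
  rintro ⟨a, b⟩ h1 h2
  simp only [mem_product, mem_singleton] at h1 h2
  omega

lemma exprA_eq_rt (f : ℚ → ℂ) {p : ℕ} (hp : 1 ≤ p) (j : ℕ) (ξ : ℕ → ℕ → ℚ) :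
    exprA f p j ξ = rt f ξ (2 * p) j (ctr ξ (2 * p) j) := by
  rw [exprA, rt, prod_adj _ (by omega)]
  simp only [lc_even, lc_odd, lc_odd' _ _ _ hp]
  rw [show (2 * p + 1) / 2 = p by omega, show (2 * p - 1) / 2 = p - 1 by omega,
    show 2 * p / 2 = p by omega]
  congr 2 <;> refine prod_congr rfl fun i _ => ?_ <;> congr 2 <;> ring

lemma exprB_eq_rt (f : ℚ → ℂ) {p : ℕ} (hp : 1 ≤ p) (j : ℕ) (ξ : ℕ → ℕ → ℚ) :
    exprB f p j ξ = rt f ξ (2 * p - 1) j (ctr ξ (2 * p - 1) j) := by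
  rw [exprB, rt, prod_adj _ (by omega), show 2 * p - 1 + 1 = 2 * p by omega,
    show 2 * p - 1 - 1 = 2 * (p - 1) by omega, show 2 * p - 2 = 2 * (p - 1) by omega]
  simp only [lc_even, lc_odd' _ _ _ hp]
  rw [show 2 * p / 2 = p by omega, show (2 * p - 1) / 2 = p - 1 by omega,
    show 2 * (p - 1) / 2 = p - 1 by omega]
  congr 1
  · congr 1 <;> refine prod_congr rfl fun i _ => ?_ <;> congr 2 <;> ring
  · refine prod_congr rfl fun i _ => ?_
    rw [show ctr ξ (2 * p - 1) i + 1 / 2 + (ctr ξ (2 * p - 1) j + 1 / 2) =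
        ctr ξ (2 * p - 1) i + ctr ξ (2 * p - 1) j + 1 by ring,
      show ctr ξ (2 * p - 1) i + 1 / 2 - (ctr ξ (2 * p - 1) j + 1 / 2) =
        ctr ξ (2 * p - 1) i - ctr ξ (2 * p - 1) j by ring, add_sub_cancel_right]
    ring

lemma shift_one (ξ : ℕ → ℕ → ℚ) (k j : ℕ) : shift ξ k j 1 = ξ + mv k (some (j, 1)) := by
  rw [← shift_eq_add_mv, sq, Units.val_one, Int.cast_one]

lemma shift_neg_one (ξ : ℕ → ℕ → ℚ) (k j : ℕ) : shift ξ k j (-1) = ξ + mv k (some (j, -1)) := by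
  rw [← shift_eq_add_mv]
  simp [sq]

lemma rt_lower (hk : 1 ≤ k) (f : ℚ → ℂ) (ξ : ℕ → ℕ → ℚ) (j : ℕ) :
    rt f (ξ + mv k (some (j, -1))) k j (ctr (ξ + mv k (some (j, -1))) k j) =
      rt f ξ k j (-ctr ξ k j) := by
  rw [← rt_opp hk f ξ (j, -1) (-ctr ξ k j), ctr_add_mv_self]
  congr 1
  simp [sq]
  ring

lemma oddPart_eq (P : (ℕ → ℕ → ℚ) → Prop) (h : ℂ) (r : ℚ → ℂ) (ε : ℕ → ℤˣ) {p : ℕ} (hp : 1 ≤ p)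
    (ξ : ℕ → ℕ → ℚ) : oddPart P h r p ξ =
      ∑ x ∈ moves (2 * p), coef h r ε (2 * p) x ξ • ket P (ξ + mv (2 * p) x) := by
  have hodd : ¬Odd (2 * p) := by simp
  rw [sum_moves, if_neg hodd, zero_add, show 2 * p / 2 = p by omega, oddPart,
    ← sum_sub_distrib]
  refine sum_congr rfl fun j _ => ?_
  rw [shift_one, shift_neg_one, sub_eq_add_neg, ← neg_smul, coefA, coefA, exprA_eq_rt _ hp,
    exprA_eq_rt _ hp, rt_lower (by omega), lc_even]
  simp only [coef, sc_one, sc_neg_one, wt, if_neg hodd, neg_neg]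
  congr 2
  · ring
  · rw [← neg_sub, div_neg, neg_neg, one_div, div_eq_inv_mul]

lemma evenPart_eq (P : (ℕ → ℕ → ℚ) → Prop) (h : ℂ) (r : ℚ → ℂ) (ε : ℕ → ℤˣ) {p : ℕ} (hp : 1 ≤ p)
    (ξ : ℕ → ℕ → ℚ) : evenPart P h r ε p ξ =
      ∑ x ∈ moves (2 * p - 1), coef h r ε (2 * p - 1) x ξ • ket P (ξ + mv (2 * p - 1) x) := by
  have hodd : Odd (2 * p - 1) := ⟨p - 1, by omega⟩
  rw [sum_moves, if_pos hodd, show (2 * p - 1) / 2 = p - 1 by omega, evenPart,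
    ← sum_sub_distrib, add_comm]
  congr 1
  · rw [mv_none, add_zero, coef, dg, prod_adj _ (by omega), show 2 * p - 1 + 1 = 2 * p by omega,
      coefC, show 2 * p - 1 - 1 = 2 * (p - 1) by omega, show 2 * p - 2 = 2 * (p - 1) by omega]
    simp only [lc_even, lc_odd' _ _ _ hp]
    rw [show 2 * p / 2 = p by omega, show (2 * p - 1) / 2 = p - 1 by omega,
      show 2 * (p - 1) / 2 = p - 1 by omega]
    congr 3
    refine prod_congr rfl fun i _ => ?_
    congr 2
    ring
  · refine sum_congr rfl fun j _ => ?_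
    rw [shift_one, shift_neg_one, sub_eq_add_neg, ← neg_smul, coefB, coefB, exprB_eq_rt _ hp,
      exprB_eq_rt _ hp, rt_lower (by omega), lc_odd' _ _ _ hp]
    simp only [coef, sc_one, sc_neg_one, wt, if_pos hodd]
    rw [show 2 * (ctr ξ (2 * p - 1) j + 1 / 2) - 1 = 2 * ctr ξ (2 * p - 1) j by ring,
      show ctr ξ (2 * p - 1) j + 1 / 2 - 1 = -(-ctr ξ (2 * p - 1) j + 1 / 2) by ring, qNumPlus_neg,
      mul_neg, qNum_neg, neg_mul, one_div_neg_eq_neg_one_div]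
    congr 2 <;> ring

lemma ket_eq_zero {P : (ℕ → ℕ → ℚ) → Prop} (hξ : ¬P ξ) : ket P ξ = 0 := dif_neg hξ

lemma ket_eq_single {P : (ℕ → ℕ → ℚ) → Prop} (hξ : P ξ) : ket P ξ = Finsupp.single ⟨ξ, hξ⟩ 1 :=
  dif_pos hξ

lemma hom_ext_ket {P : (ℕ → ℕ → ℚ) → Prop} {V : Type*} [AddCommMonoid V] [Module ℂ V]
    {A B : TabSpace P →ₗ[ℂ] V} (hAB : ∀ ξ, P ξ → A (ket P ξ) = B (ket P ξ)) : A = B := by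
  refine Finsupp.lhom_ext' fun ξ => LinearMap.ext_ring ?_
  have := hAB ξ.1 ξ.2
  rwa [ket_eq_single ξ.2] at this

lemma linearCombination_ket {P : (ℕ → ℕ → ℚ) → Prop} {V : Type*} [AddCommMonoid V] [Module ℂ V]
    (g : {ξ // P ξ} → V) (hξ : P ξ) : Finsupp.linearCombination ℂ g (ket P ξ) = g ⟨ξ, hξ⟩ := by
  rw [ket_eq_single hξ, Finsupp.linearCombination_single, one_smul]

lemma opT'_ket_of_mem (hk : 1 ≤ k) (hξ : IsClassicalTableau n m ξ) :
    opT' h r n m ε (k + 1) (ket (IsClassicalTableau n m) ξ) =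
      ∑ x ∈ moves k, coef h r ε k x ξ • ket (IsClassicalTableau n m) (ξ + mv k x) := by
  rw [opT', linearCombination_ket _ hξ]
  obtain ⟨p, rfl | rfl⟩ := Nat.even_or_odd' k
  · rw [if_pos ⟨p, rfl⟩, show (2 * p + 1) / 2 = p by omega, oddPart_eq _ _ _ ε (by omega)]
  · rw [if_neg (by simp [Nat.odd_add_one]), show (2 * p + 1 + 1) / 2 = p + 1 by omega,
      evenPart_eq _ _ _ _ (by omega), show 2 * (p + 1) - 1 = 2 * p + 1 by omega]

lemma opT'_ket (hk : 1 ≤ k) (ξ : ℕ → ℕ → ℚ) :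
    opT' h r n m ε (k + 1) (ket (IsClassicalTableau n m) ξ) =
      ∑ x ∈ moves k, cf n m h r ε k x ξ • ket (IsClassicalTableau n m) (ξ + mv k x) := by
  by_cases hξ : IsClassicalTableau n m ξ
  · rw [opT'_ket_of_mem hk hξ]
    refine sum_congr rfl fun x _ => ?_
    by_cases hx : IsClassicalTableau n m (ξ + mv k x)
    · rw [cf, if_pos ⟨hξ, hx⟩]
    · rw [ket_eq_zero hx, smul_zero, smul_zero]
  · rw [ket_eq_zero hξ, map_zero]
    exact (sum_eq_zero fun x _ => by rw [cf_eq_zero_of_not_source hξ, zero_smul]).symm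

/-- The coefficients of a row only depend on this row and on the adjacent ones. -/
lemma coef_congr (hk : 1 ≤ k) {η : ℕ → ℕ → ℚ} (h1 : ∀ j, ctr η k j = ctr ξ k j)
    (h2 : ∀ o j, RowAdj k o → ctr η o j = ctr ξ o j) (x : Option (ℕ × ℤˣ)) :
    coef h r ε k x η = coef h r ε k x ξ := by
  have h3 : ∀ u ∈ adj k, ctr η u.1 u.2 = ctr ξ u.1 u.2 := fun u hu =>
    h2 _ _ ((mem_adj hk).1 hu).1
  rcases x with _ | x
  · simp only [coef, dg, h1]
    rw [prod_congr rfl fun u hu => by rw [h3 u hu]]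
  · simp only [coef, rt, sc, h1]
    congr 2
    exact prod_congr rfl fun u hu => by rw [h3 u hu]

lemma ctr_add_mv_of_row_ne (ξ : ℕ → ℕ → ℚ) (x : Option (ℕ × ℤˣ)) {o : ℕ} (ho : o ≠ k) (j : ℕ) :
    ctr (ξ + mv k x) o j = ctr ξ o j := by
  rcases x with _ | x
  · rw [mv_none, add_zero]
  · exact ctr_add_mv_of_ne _ _ fun hh => ho hh.1

lemma cf_comm (hk : 1 ≤ k) (hk' : 1 ≤ k') (hkn : k + 1 ≤ n) (hkn' : k' + 1 ≤ n)
    (hkk : 1 < |(k : ℤ) - k'|) {x y : Option (ℕ × ℤˣ)} (hx : x ∈ moves k) (hy : y ∈ moves k')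
    (ξ : ℕ → ℕ → ℚ) :
    cf n m h r ε k x ξ * cf n m h r ε k' y (ξ + mv k x) =
      cf n m h r ε k' y ξ * cf n m h r ε k x (ξ + mv k' y) := by
  by_cases hξ : IsClassicalTableau n m ξ
  swap
  · rw [cf_eq_zero_of_not_source hξ, cf_eq_zero_of_not_source hξ, zero_mul, zero_mul]
  by_cases hξ2 : IsClassicalTableau n m (ξ + mv k x + mv k' y)
  swap
  · rw [cf_eq_zero_of_not_target hξ2, mul_zero, cf_eq_zero_of_not_target (k := k)
      (by rwa [add_right_comm]), mul_zero]
  have hne : k ≠ k' := by rintro rfl; simp at hkk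
  have hfar : ∀ o, RowAdj k o → o ≠ k' := by
    rintro o (rfl | rfl) rfl <;> rw [lt_abs] at hkk <;> omega
  have hfar' : ∀ o, RowAdj k' o → o ≠ k := by
    rintro o (rfl | rfl) rfl <;> rw [lt_abs] at hkk <;> omega
  have hx1 := isClassicalTableau_of_far hkk hkn hx hξ hξ2
  have hξ3 : IsClassicalTableau n m (ξ + mv k' y + mv k x) := by rwa [add_right_comm]
  have hy1 := isClassicalTableau_of_far (by rwa [abs_sub_comm]) hkn' hy hξ hξ3
  rw [cf, cf, cf, cf, if_pos ⟨hξ, hx1⟩, if_pos ⟨hx1, hξ2⟩, if_pos ⟨hξ, hy1⟩, if_pos ⟨hy1, hξ3⟩,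
    coef_congr hk' (fun j => ctr_add_mv_of_row_ne ξ x hne.symm j)
      (fun o j ho => ctr_add_mv_of_row_ne ξ x (hfar' o ho) j),
    coef_congr hk (fun j => ctr_add_mv_of_row_ne ξ y hne j)
      (fun o j ho => ctr_add_mv_of_row_ne ξ y (hfar o ho) j), mul_comm]

/-- The cubic relation between the operators that act on two adjacent rows. -/
lemma opT'_cubic (hq : ∀ k : ℕ, 0 < k → Complex.exp h ^ k ≠ 1)
    (hr : ∀ a : ℚ, 0 ≤ a → r a ^ 2 = qNum h a) (hk : 1 ≤ k) (hk' : 1 ≤ k') (hkn : k + 1 ≤ n)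
    (hkn' : k' + 1 ≤ n) (hkk : RowAdj k k') :
    opT' h r n m ε (k' + 1) * opT' h r n m ε (k + 1) ^ 2 -
        (Complex.exp h + (Complex.exp h)⁻¹) •
          (opT' h r n m ε (k + 1) * opT' h r n m ε (k' + 1) * opT' h r n m ε (k + 1)) +
        opT' h r n m ε (k + 1) ^ 2 * opT' h r n m ε (k' + 1) = -opT' h r n m ε (k' + 1) :=
  hom_ext_ket fun ξ _ => cubic_of_paths _ _ (ket (IsClassicalTableau n m)) (moves k) (moves k')
    (mv k) (mv k') (cf n m h r ε k) (cf n m h r ε k') opp _ (opT'_ket hk) (opT'_ket hk')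
    (fun _ => opp_mem_moves) (fun x _ => opp_opp x) (fun x _ => mv_opp k x)
    (fun ξ _ hy _ hx _ hz hop => sum_paths_eq_zero hq hr hk hk' hkn hkn' hkk hx hz hop hy ξ)
    (fun ξ _ hy => sum_opposite_paths hq hr hk hk' hkn hkn' hkk hy ξ) ξ

/-- Operators that act on rows which are not adjacent commute. -/
lemma opT'_comm (hk : 1 ≤ k) (hk' : 1 ≤ k') (hkn : k + 1 ≤ n) (hkn' : k' + 1 ≤ n)
    (hkk : 1 < |(k : ℤ) - k'|) :
    opT' h r n m ε (k + 1) * opT' h r n m ε (k' + 1) =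
      opT' h r n m ε (k' + 1) * opT' h r n m ε (k + 1) := by
  refine hom_ext_ket fun ξ _ => ?_
  simp only [Module.End.mul_apply, opT'_ket hk, opT'_ket hk', map_sum, map_smul, smul_sum,
    smul_smul]
  rw [sum_comm]
  refine sum_congr rfl fun x hx => sum_congr rfl fun y hy => ?_
  rw [cf_comm hk hk' hkn hkn' hkk hx hy, add_right_comm]

theorem satisfiesRelations_opT' (hq : ∀ k : ℕ, 0 < k → Complex.exp h ^ k ≠ 1)
    (hr : ∀ a : ℚ, 0 ≤ a → r a ^ 2 = qNum h a) (n : ℕ) (m : ℕ → ℚ) (ε : ℕ → ℤˣ) :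
    SatisfiesRelations (Complex.exp h) n (fun k : Set.Icc 2 n => opT' h r n m ε k) where
  cubic_left := by
    rintro ⟨i, hi, hin⟩ ⟨j, hj, hjn⟩ hij
    obtain ⟨k, rfl⟩ := Nat.exists_eq_add_of_le' (show 1 ≤ i by omega)
    dsimp only at hij
    subst hij
    exact opT'_cubic hq hr (by omega) (by omega) hin hjn (Or.inl rfl)
  cubic_right := by
    rintro ⟨i, hi, hin⟩ ⟨j, hj, hjn⟩ hij
    obtain ⟨k, rfl⟩ := Nat.exists_eq_add_of_le' (show 1 ≤ i by omega)
    dsimp only at hij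
    subst hij
    have := opT'_cubic (ε := ε) (m := m) hq hr (k := k + 1) (k' := k) (by omega) (by omega) hjn
      hin (Or.inr rfl)
    rw [← this]
    abel
  comm := by
    rintro ⟨i, hi, hin⟩ ⟨j, hj, hjn⟩ hij
    obtain ⟨k, rfl⟩ := Nat.exists_eq_add_of_le' (show 1 ≤ i by omega)
    obtain ⟨k', rfl⟩ := Nat.exists_eq_add_of_le' (show 1 ≤ j by omega)
    refine sub_eq_zero.2 (opT'_comm (by omega) (by omega) hin hjn ?_)
    simpa using hij

lemma coefA_sq (hr : ∀ a : ℚ, 0 ≤ a → r a ^ 2 = qNum h a) {p j : ℕ} (hp : 2 * p + 1 ≤ n)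
    (hj : 1 ≤ j) (hjp : j ≤ p) (hξ : IsClassicalTableau n m ξ) :
    coefA r p j ξ ^ 2 = exprA (qNum h) p j ξ := by
  have := rt_abs_sq hr hξ hp (x := (j, 1)) (some_mem_moves.2 ⟨hj, by omega⟩)
  rw [sc_one] at this
  rw [coefA, exprA_eq_rt _ (by omega), exprA_eq_rt _ (by omega), this]

lemma coefB_sq (hr : ∀ a : ℚ, 0 ≤ a → r a ^ 2 = qNum h a) {p j : ℕ} (hp : 2 * p ≤ n)
    (hj : 1 ≤ j) (hjp : j < p) (hξ : IsClassicalTableau n m ξ) :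
    coefB r p j ξ ^ 2 = exprB (qNum h) p j ξ := by
  have := rt_abs_sq hr hξ (k := 2 * p - 1) (by omega) (x := (j, 1))
    (some_mem_moves.2 ⟨hj, by omega⟩)
  rw [sc_one] at this
  rw [coefB, exprB_eq_rt _ (by omega), exprB_eq_rt _ (by omega), this]

end Operators

/-! ### Sign changes of the last entries of the even rows -/

/-- The sign by which `flip S` multiplies an entry. -/
def flipSign (S : Finset ℕ) (k j : ℕ) : ℤˣ := if Even k ∧ k / 2 ∈ S ∧ j = k / 2 then -1 else 1

/-- The move that `flip S` turns a move into. -/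
def flipMove (S : Finset ℕ) (k : ℕ) : Option (ℕ × ℤˣ) → Option (ℕ × ℤˣ) :=
  Option.map fun x => (x.1, flipSign S k x.1 * x.2)

section Flip

variable {h : ℂ} {r : ℚ → ℂ} {n : ℕ} {m : ℕ → ℚ} {ε : ℕ → ℤˣ} {ξ : ℕ → ℕ → ℚ} {k : ℕ}
  {S : Finset ℕ}

lemma flip_apply (S : Finset ℕ) (ξ : ℕ → ℕ → ℚ) (k j : ℕ) :
    flip S ξ k j = sq (flipSign S k j) * ξ k j := by
  rw [flip, flipSign]
  split_ifs <;> simp [sq]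

lemma flipSign_mul_self (S : Finset ℕ) (k j : ℕ) : flipSign S k j * flipSign S k j = 1 :=
  Int.units_mul_self _

lemma flip_empty (ξ : ℕ → ℕ → ℚ) : flip ∅ ξ = ξ := by
  ext k j
  simp [flip]

lemma flip_flip (S T : Finset ℕ) (ξ : ℕ → ℕ → ℚ) : flip S (flip T ξ) = flip (symmDiff S T) ξ := by
  ext k j
  simp only [flip, mem_symmDiff]
  by_cases h1 : k / 2 ∈ S <;> by_cases h2 : k / 2 ∈ T <;> simp [h1, h2]
  by_cases h3 : Even k ∧ j = k / 2 <;> simp [h3]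

lemma ctr_flip (S : Finset ℕ) (ξ : ℕ → ℕ → ℚ) (k j : ℕ) :
    ctr (flip S ξ) k j = sq (flipSign S k j) * ctr ξ k j := by
  rw [ctr, ctr, flip, flipSign]
  split_ifs with hc
  · obtain ⟨⟨p, rfl⟩, -, rfl⟩ := hc
    rw [show (p + p) / 2 = p by omega]
    simp [sq]
  · simp [sq]

lemma flip_add_mv (S : Finset ℕ) (ξ : ℕ → ℕ → ℚ) (k : ℕ) (x : Option (ℕ × ℤˣ)) :
    flip S (ξ + mv k x) = flip S ξ + mv k (flipMove S k x) := by
  rcases x with _ | ⟨j, s⟩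
  · simp [flipMove, mv_none]
  ext k' i
  rw [flip_apply, Pi.add_apply, Pi.add_apply, Pi.add_apply, Pi.add_apply, flip_apply, mul_add]
  congr 1
  simp only [flipMove, Option.map_some, mv]
  by_cases h1 : k' = k
  · subst h1
    by_cases h2 : i = j
    · subst h2
      simp [sq]
    · simp [h2]
  · simp [h1]

lemma flipMove_mem (S : Finset ℕ) {x : Option (ℕ × ℤˣ)} (hx : x ∈ moves k) :
    flipMove S k x ∈ moves k := by
  rcases x with _ | ⟨j, s⟩
  · exact hx
  · exact some_mem_moves.2 (some_mem_moves.1 hx)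

lemma flipMove_flipMove (S : Finset ℕ) (k : ℕ) (x : Option (ℕ × ℤˣ)) :
    flipMove S k (flipMove S k x) = x := by
  rcases x with _ | ⟨j, s⟩
  · rfl
  · simp only [flipMove, Option.map_some, ← mul_assoc, flipSign_mul_self, one_mul]

lemma sc_flip (S : Finset ℕ) (ξ : ℕ → ℕ → ℚ) (k : ℕ) (x : ℕ × ℤˣ) :
    sc (flip S ξ) k (x.1, flipSign S k x.1 * x.2) = sc ξ k x := by
  simp only [sc, ctr_flip]
  rw [show sq (flipSign S k x.1 * x.2) = sq (flipSign S k x.1) * sq x.2 by simp [sq]]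
  linear_combination sq x.2 * ctr ξ k x.1 * sq_mul_self (flipSign S k x.1)

lemma even_mul_even {f : ℚ → ℂ} (hf : ∀ x y, f (-x) * f (-y) = f x * f y) (t : ℤˣ) (u b : ℚ) :
    f (sq t * u + b) * f (sq t * u - b) = f (u + b) * f (u - b) := by
  rcases sq_cases t with ht | ht <;> rw [ht]
  · rw [one_mul]
  · rw [← hf (u + b), mul_comm]
    congr 2 <;> ring

lemma rt_flip {f : ℚ → ℂ} (hf : ∀ x y, f (-x) * f (-y) = f x * f y) (S : Finset ℕ)
    (ξ : ℕ → ℕ → ℚ) (k j : ℕ) (a : ℚ) : rt f (flip S ξ) k j a = rt f ξ k j a := by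
  rw [rt, rt]
  congr 1
  · refine prod_congr rfl fun u _ => ?_
    rw [ctr_flip, add_assoc, sub_sub, even_mul_even hf, add_assoc, sub_sub]
  · refine prod_congr rfl fun i _ => ?_
    have h1 := even_mul_even hf (flipSign S k i) (ctr ξ k i) a
    have h2 := even_mul_even hf (flipSign S k i) (ctr ξ k i) (a + 1)
    rw [ctr_flip, h1, mul_assoc, mul_assoc (f _ * f _), add_assoc, sub_sub, add_assoc, sub_sub, h2]

lemma coef_flip (S : Finset ℕ) (ξ : ℕ → ℕ → ℚ) {k : ℕ} {x : Option (ℕ × ℤˣ)} (hx : x ∈ moves k) :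
    coef h r ε k (flipMove S k x) (flip S ξ) = coef h r ε k x ξ := by
  rcases x with _ | x
  · have hodd := none_mem_moves.1 hx
    simp only [flipMove, Option.map_none, coef, dg]
    congr 2
    · refine prod_congr rfl fun u _ => ?_
      rw [ctr_flip]
      rcases sq_cases (flipSign S u.1 u.2) with ht | ht <;> rw [ht]
      · rw [one_mul]
      · rw [neg_one_mul, qNumPlus_neg]
    · refine prod_congr rfl fun i _ => ?_
      rw [ctr_flip, flipSign, if_neg fun hh => Nat.not_odd_iff_even.2 hh.1 hodd]
      simp [sq]
  · simp only [flipMove, Option.map_some, coef, sc_flip]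
    rw [rt_flip fun x y => by simp only [abs_neg]]

lemma flipSign_eq_one_or (S : Finset ℕ) (k j : ℕ) : sq (flipSign S k j) = 1 ∨
    (Even k ∧ j = k / 2 ∧ k / 2 ∈ S ∧ sq (flipSign S k j) = -1) := by
  rw [flipSign]
  split_ifs with hc
  · exact Or.inr ⟨hc.1, hc.2.2, hc.2.1, by simp [sq]⟩
  · exact Or.inl (by simp [sq])

lemma IsClassicalTableau.flip (hξ : IsClassicalTableau n m ξ) (hS : S ⊆ Icc 1 ((n - 1) / 2)) :
    IsClassicalTableau n m (flip S ξ) := by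
  have hA := hξ.toIsArray
  refine isClassicalTableau_iff.2 ⟨⟨fun k j hkj => ?_, fun j hj hj' => ?_,
    fun k j hk hkn hj hj' => ?_⟩, fun k i j hk hkn hi hi' hj hj' => ?_⟩
  · rw [flip_apply, hA.zero k j hkj, mul_zero]
  · rw [QSo.flip, if_neg, hA.top j hj hj']
    rintro ⟨⟨p, hp⟩, h2, -⟩
    have := mem_Icc.1 (hS h2)
    omega
  · have := hA.half k j hk hkn hj hj'
    rw [flip_apply]
    rcases sq_cases (flipSign S k j) with ht | ht <;> rw [ht]
    · rwa [one_mul]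
    · rw [neg_one_mul]
      exact this.neg
  · obtain ⟨a1, a2, a3⟩ := hξ.interlaces hkn hi hi' hj hj'
    rw [ctr_flip, ctr_flip]
    rcases flipSign_eq_one_or S (k + 1) i with h1 | ⟨h1, h2, -, h3⟩ <;>
      rcases flipSign_eq_one_or S k j with h4 | ⟨h4, h5, -, h6⟩
    · rw [h1, h4, one_mul, one_mul]
      exact ⟨a1, a2, a3⟩
    · rw [h1, h6]
      obtain ⟨p, rfl⟩ := h4
      have := a2 (by omega)
      exact ⟨by linarith, fun _ => by linarith, fun _ => by omega⟩
    · rw [h3, h4]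
      obtain ⟨p, hp⟩ := h1
      have := a3 (by omega)
      exact ⟨by linarith, fun _ => by omega, fun _ => by linarith⟩
    · obtain ⟨p, hp⟩ := h1
      obtain ⟨p', hp'⟩ := h4
      omega

lemma isClassicalTableau_flip_iff (hS : S ⊆ Icc 1 ((n - 1) / 2)) :
    IsClassicalTableau n m (flip S ξ) ↔ IsClassicalTableau n m ξ := by
  refine ⟨fun h1 => ?_, fun h1 => h1.flip hS⟩
  have := h1.flip hS
  rwa [flip_flip, symmDiff_self, bot_eq_empty, flip_empty] at this

/-! ### Tableaux of the nonclassical type -/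

/-- The tableaux of the nonclassical type are the classical ones in which the last entries of all
even rows below the top row are positive. -/
lemma isTableau_iff (hm : IsDominant n m) : IsTableau n m ξ ↔ IsClassicalTableau n m ξ ∧
    ∀ p, 1 ≤ p → 2 * p + 1 ≤ n → 0 < ξ (2 * p) p := by
  constructor
  · intro hξ
    refine ⟨⟨hξ.toIsArray, hξ.odd_upper, hξ.odd_lower, fun p hp hpn => ?_, hξ.even_upper,
      fun p j hp hj hjp => hξ.even_lower p j hp hj (by omega), fun p hp hpn => ?_⟩,
      fun p hp hpn => by linarith [hξ.odd_last p hp hpn]⟩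
    · linarith [hξ.odd_last p hp hpn, hξ.odd_upper p p hpn hp le_rfl]
    · have h1 := hξ.even_lower p (p - 1) hpn (by omega) (by omega)
      rw [show p - 1 + 1 = p by omega] at h1
      rw [abs_of_nonneg]
      · exact h1
      · rcases Nat.lt_or_ge (2 * p) n with hlt | hge
        · linarith [hξ.odd_last p (by omega) hlt]
        · obtain rfl : n = 2 * p := by omega
          rw [hξ.top p (by omega) (by omega)]
          have := hm.last
          rw [show 2 * p / 2 = p by omega] at this
          linarith
  · rintro ⟨hξ, hpos⟩
    refine ⟨hξ.toIsArray, hξ.odd_upper, hξ.odd_lower, fun p hp hpn =>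
      (hξ.half (2 * p) p (by omega) (by omega) hp (by omega)).half_le (hpos p hp hpn),
      hξ.even_upper, fun p j hp hj hjp => ?_⟩
    rcases Nat.lt_or_ge (j + 1) p with hlt | hge
    · exact hξ.even_lower p j hp hj hlt
    · have := hξ.even_last p (by omega) hp
      rw [show p - 1 = j by omega] at this
      rw [show j + 1 = p by omega]
      exact (le_abs_self _).trans this

/-- Every classical tableau arises from one of the nonclassical type by sign changes. -/
lemma exists_flip_eq (hm : IsDominant n m) (hξ : IsClassicalTableau n m ξ) :
    ∃ S ⊆ Icc 1 ((n - 1) / 2), ∃ η, IsTableau n m η ∧ flip S η = ξ := by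
  set S := (Icc 1 ((n - 1) / 2)).filter fun p => ξ (2 * p) p < 0 with hSdef
  have hS : S ⊆ Icc 1 ((n - 1) / 2) := filter_subset _ _
  refine ⟨S, hS, flip S ξ, (isTableau_iff hm).2 ⟨hξ.flip hS, fun p hp hpn => ?_⟩, ?_⟩
  · have h0 := hξ.ctr_ne_zero (k := 2 * p) hpn hp (by omega)
    have h1 : ctr ξ (2 * p) p = ξ (2 * p) p := by
      rw [ctr]
      push_cast
      ring
    rw [h1] at h0
    rw [QSo.flip, show 2 * p / 2 = p by omega]
    split_ifs with hc
    · have := (mem_filter.1 hc.2.1).2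
      linarith
    · refine lt_of_le_of_ne (not_lt.1 fun hlt => hc ⟨even_two_mul p, mem_filter.2 ⟨mem_Icc.2
        ⟨hp, by omega⟩, hlt⟩, rfl⟩) (Ne.symm h0)
  · rw [flip_flip, symmDiff_self, bot_eq_empty, flip_empty]

/-- A nontrivial sign change of a tableau of the nonclassical type is not of that type. -/
lemma not_isTableau_flip (hm : IsDominant n m) (hξ : IsTableau n m ξ)
    (hS : S ⊆ Icc 1 ((n - 1) / 2)) (hne : S ≠ ∅) : ¬IsTableau n m (flip S ξ) := by
  obtain ⟨p, hp⟩ := nonempty_iff_ne_empty.2 hne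
  have hp' := mem_Icc.1 (hS hp)
  intro h1
  have h2 := ((isTableau_iff hm).1 h1).2 p hp'.1 (by omega)
  have h3 := ((isTableau_iff hm).1 hξ).2 p hp'.1 (by omega)
  rw [QSo.flip, show 2 * p / 2 = p by omega, if_pos ⟨even_two_mul p, hp, rfl⟩] at h2
  linarith

/-- A move leads from a tableau of the nonclassical type to one that is only of the classical type
exactly when it changes a last entry `1/2` of an even row to `-1/2`, and this is a sign change. -/
lemma add_mv_eq_flip_of_not_isTableau (hm : IsDominant n m) (hξ : IsTableau n m ξ)
    (hkn : k + 1 ≤ n) {x : Option (ℕ × ℤˣ)} (hx : x ∈ moves k)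
    (h1 : IsClassicalTableau n m (ξ + mv k x)) (h2 : ¬IsTableau n m (ξ + mv k x)) :
    Even k ∧ x = some (k / 2, -1) ∧ ξ k (k / 2) = 1 / 2 := by
  rw [isTableau_iff hm, not_and] at h2
  have h3 := h2 h1
  push Not at h3
  obtain ⟨p, hp, hpn, hle⟩ := h3
  have h4 := hξ.odd_last p hp hpn
  rcases x with _ | ⟨j, s⟩
  · rw [mv_none, add_zero] at hle
    linarith
  have h5 : ctr ξ (2 * p) p = ξ (2 * p) p := by
    rw [ctr]
    push_cast
    ring
  have h6 : ctr (ξ + mv k (some (j, s))) (2 * p) p = (ξ + mv k (some (j, s))) (2 * p) p := by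
    rw [ctr]
    push_cast
    ring
  rw [← h6, ctr_add_mv, h5] at hle
  by_cases hc : 2 * p = k ∧ p = j
  · obtain ⟨rfl, rfl⟩ := hc
    rw [if_pos ⟨rfl, rfl⟩] at hle
    rw [show 2 * p / 2 = p by omega]
    rcases Int.units_eq_one_or s with rfl | rfl
    · simp [sq] at hle
      linarith
    · refine ⟨even_two_mul p, rfl, ?_⟩
      simp only [sq, Units.val_neg, Units.val_one, Int.cast_neg, Int.cast_one] at hle
      exact (hξ.half (2 * p) p (by omega) (by omega) hp (by omega)).eq_half (by linarith)
        (by linarith)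
  · rw [if_neg hc] at hle
    linarith

lemma add_mv_eq_flip {p : ℕ} (hξ : ξ (2 * p) p = 1 / 2) :
    ξ + mv (2 * p) (some (p, -1)) = flip {p} ξ := by
  ext k j
  by_cases h1 : k = 2 * p
  · subst h1
    by_cases h2 : j = p
    · subst h2
      simp [mv, QSo.flip, hξ]
      norm_num
    · simp [mv, QSo.flip, h2]
  · have : ¬(Even k ∧ k / 2 = p) := by
      rintro ⟨⟨l, rfl⟩, h3⟩
      omega
    simp only [mv, QSo.flip, Pi.add_apply, mem_singleton]
    rw [if_neg (by tauto)]
    simp [h1]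

end Flip

/-! ### The splitting of the classical representation -/

/-- The character of the group of sign changes that belongs to the signs `ε_{2p+1}`. -/
noncomputable def chi (ε : ℕ → ℤˣ) (S : Finset ℕ) : ℂ := ∏ p ∈ S, -sgn (ε (2 * p + 1))

/-- The operator `|ξ⟩ ↦ |flip S ξ⟩`. -/
noncomputable def flipOp (n : ℕ) (m : ℕ → ℚ) (S : Finset ℕ) :
    Module.End ℂ (TabSpace (IsClassicalTableau n m)) :=
  Finsupp.linearCombination ℂ fun ξ : {ξ // IsClassicalTableau n m ξ} =>
    ket (IsClassicalTableau n m) (flip S ξ.1)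

/-- A multiple of the projection to the isotypic part of the character `chi ε`. -/
noncomputable def chiOp (n : ℕ) (m : ℕ → ℚ) (ε : ℕ → ℤˣ) :
    Module.End ℂ (TabSpace (IsClassicalTableau n m)) :=
  ∑ S ∈ (Icc 1 ((n - 1) / 2)).powerset, chi ε S • flipOp n m S

section Split

variable {h : ℂ} {r : ℚ → ℂ} {n : ℕ} {m : ℕ → ℚ} {ε ε' : ℕ → ℤˣ} {ξ : ℕ → ℕ → ℚ} {k : ℕ}
  {S T : Finset ℕ}

lemma sgn_mul_self (e : ℤˣ) : sgn e * sgn e = 1 := by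
  rcases Int.units_eq_one_or e with rfl | rfl <;> simp [sgn]

lemma chi_mul_chi (ε : ℕ → ℤˣ) (S T : Finset ℕ) : chi ε S * chi ε T = chi ε (symmDiff S T) := by
  have h1 : ∀ U V : Finset ℕ, chi ε U = chi ε (U \ V) * chi ε (U ∩ V) := fun U V => by
    rw [chi, chi, chi, mul_comm, ← prod_union (disjoint_sdiff_inter U V).symm, union_comm,
      sdiff_union_inter]
  have h2 : chi ε (S ∩ T) * chi ε (S ∩ T) = 1 := by
    rw [chi, ← prod_mul_distrib]
    exact prod_eq_one fun p _ => by rw [neg_mul_neg, sgn_mul_self]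
  have h3 : chi ε (symmDiff S T) = chi ε (S \ T) * chi ε (T \ S) := by
    rw [symmDiff_def, sup_eq_union, chi, prod_union disjoint_sdiff_sdiff]
    rfl
  rw [h1 S T, h1 T S, h3, inter_comm T S]
  linear_combination chi ε (S \ T) * chi ε (T \ S) * h2

lemma symmDiff_subset {U : Finset ℕ} (hS : S ⊆ U) (hT : T ⊆ U) : symmDiff S T ⊆ U := fun _ hp =>
  (mem_symmDiff.1 hp).elim (fun h => hS h.1) fun h => hT h.1

lemma flipOp_ket (hS : S ⊆ Icc 1 ((n - 1) / 2)) (ξ : ℕ → ℕ → ℚ) :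
    flipOp n m S (ket (IsClassicalTableau n m) ξ) = ket (IsClassicalTableau n m) (flip S ξ) := by
  by_cases hξ : IsClassicalTableau n m ξ
  · rw [flipOp, linearCombination_ket _ hξ]
  · rw [ket_eq_zero hξ, map_zero, ket_eq_zero fun h1 => hξ ((isClassicalTableau_flip_iff hS).1 h1)]

lemma flipOp_mul_flipOp (hS : S ⊆ Icc 1 ((n - 1) / 2)) (hT : T ⊆ Icc 1 ((n - 1) / 2)) :
    flipOp n m S * flipOp n m T = flipOp n m (symmDiff S T) :=
  hom_ext_ket fun ξ _ => by
    rw [Module.End.mul_apply, flipOp_ket hT, flipOp_ket hS, flip_flip,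
      flipOp_ket (symmDiff_subset hS hT)]

lemma flipOp_empty : flipOp n m ∅ = 1 :=
  hom_ext_ket fun ξ _ => by
    rw [flipOp_ket (empty_subset _), flip_empty, Module.End.one_apply]

lemma sum_powerset_symmDiff {V : Type*} [AddCommMonoid V] {U : Finset ℕ} (hS : S ⊆ U)
    (g : Finset ℕ → V) : ∑ T ∈ U.powerset, g (symmDiff S T) = ∑ T ∈ U.powerset, g T := by
  refine sum_nbij' (symmDiff S) (symmDiff S) (fun T hT => ?_) (fun T hT => ?_)
    (fun T _ => symmDiff_symmDiff_cancel_left S T) (fun T _ => symmDiff_symmDiff_cancel_left S T)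
    fun T _ => rfl
  all_goals exact mem_powerset.2 (symmDiff_subset hS (mem_powerset.1 hT))

lemma chi_mul_self (ε : ℕ → ℤˣ) (S : Finset ℕ) : chi ε S * chi ε S = 1 := by
  rw [chi_mul_chi, symmDiff_self, bot_eq_empty, chi, prod_empty]

lemma flipOp_mul_chiOp (ε : ℕ → ℤˣ) (hS : S ⊆ Icc 1 ((n - 1) / 2)) :
    flipOp n m S * chiOp n m ε = chi ε S • chiOp n m ε := by
  rw [chiOp, mul_sum, ← sum_powerset_symmDiff hS fun T => chi ε T • flipOp n m T, smul_sum]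
  refine sum_congr rfl fun T hT => ?_
  rw [mul_smul_comm, flipOp_mul_flipOp hS (mem_powerset.1 hT), smul_smul, ← chi_mul_chi,
    ← mul_assoc, chi_mul_self, one_mul]

lemma chiOp_mul_flipOp (ε : ℕ → ℤˣ) (hS : S ⊆ Icc 1 ((n - 1) / 2)) :
    chiOp n m ε * flipOp n m S = chi ε S • chiOp n m ε := by
  rw [← flipOp_mul_chiOp ε hS, chiOp, mul_sum, sum_mul]
  refine sum_congr rfl fun T hT => ?_
  rw [mul_smul_comm, smul_mul_assoc, flipOp_mul_flipOp hS (mem_powerset.1 hT),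
    flipOp_mul_flipOp (mem_powerset.1 hT) hS, symmDiff_comm]

lemma sum_chi_mul_chi (ε ε' : ℕ → ℤˣ) (U : Finset ℕ) : ∑ S ∈ U.powerset, chi ε S * chi ε' S =
    ∏ p ∈ U, (1 + sgn (ε (2 * p + 1)) * sgn (ε' (2 * p + 1))) := by
  rw [prod_one_add]
  refine sum_congr rfl fun S _ => ?_
  rw [chi, chi, ← prod_mul_distrib]
  exact prod_congr rfl fun p _ => neg_mul_neg _ _

lemma chiOp_mul_chiOp (ε ε' : ℕ → ℤˣ) : chiOp n m ε * chiOp n m ε' =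
    (∏ p ∈ Icc 1 ((n - 1) / 2), (1 + sgn (ε (2 * p + 1)) * sgn (ε' (2 * p + 1)))) •
      chiOp n m ε' := by
  rw [← sum_chi_mul_chi, sum_smul]
  nth_rewrite 1 [chiOp]
  rw [sum_mul]
  refine sum_congr rfl fun S hS => ?_
  rw [smul_mul_assoc, flipOp_mul_chiOp ε' (mem_powerset.1 hS), smul_smul]

/-- Sign changes commute with the operators of the classical representation. -/
lemma opT'_mul_flipOp (hk : 1 ≤ k) (hS : S ⊆ Icc 1 ((n - 1) / 2)) :
    opT' h r n m ε (k + 1) * flipOp n m S = flipOp n m S * opT' h r n m ε (k + 1) := by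
  refine hom_ext_ket fun ξ hξ => ?_
  rw [Module.End.mul_apply, Module.End.mul_apply, flipOp_ket hS,
    opT'_ket_of_mem hk hξ, opT'_ket_of_mem hk (hξ.flip hS), map_sum]
  refine (sum_nbij' (flipMove S k) (flipMove S k) (fun x => flipMove_mem S)
    (fun x => flipMove_mem S) (fun x _ => flipMove_flipMove S k x)
    (fun x _ => flipMove_flipMove S k x) fun x hx => ?_).symm
  rw [map_smul, flipOp_ket hS, coef_flip S ξ hx, flip_add_mv]

lemma opT'_mul_chiOp (hk : 1 ≤ k) :
    opT' h r n m ε (k + 1) * chiOp n m ε' = chiOp n m ε' * opT' h r n m ε (k + 1) := by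
  rw [chiOp, mul_sum, sum_mul]
  refine sum_congr rfl fun S hS => ?_
  rw [mul_smul_comm, smul_mul_assoc, opT'_mul_flipOp hk (mem_powerset.1 hS)]

lemma splitMap_ket (hξ : IsTableau n m ξ) : splitMap n m ε (ket (IsTableau n m) ξ) =
    chiOp n m ε (ket (IsClassicalTableau n m) ξ) := by
  rw [splitMap, linearCombination_ket _ hξ, chiOp, LinearMap.sum_apply]
  refine sum_congr rfl fun S hS => ?_
  rw [LinearMap.smul_apply, flipOp_ket (mem_powerset.1 hS)]
  rfl

lemma chiOp_ket_mem_range (hm : IsDominant n m) (ε : ℕ → ℤˣ) (ξ : ℕ → ℕ → ℚ) :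
    chiOp n m ε (ket (IsClassicalTableau n m) ξ) ∈ LinearMap.range (splitMap n m ε) := by
  by_cases hξ : IsClassicalTableau n m ξ
  · obtain ⟨S, hS, η, hη, rfl⟩ := exists_flip_eq hm hξ
    rw [← flipOp_ket hS, ← Module.End.mul_apply, chiOp_mul_flipOp ε hS, LinearMap.smul_apply,
      ← splitMap_ket hη]
    exact Submodule.smul_mem _ _ (LinearMap.mem_range_self _ _)
  · rw [ket_eq_zero hξ, map_zero]
    exact zero_mem _

lemma range_splitMap_le (ε : ℕ → ℤˣ) :
    LinearMap.range (splitMap n m ε) ≤ LinearMap.range (chiOp n m ε) := by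
  rw [splitMap, Finsupp.range_linearCombination, Submodule.span_le]
  rintro _ ⟨ξ, rfl⟩
  have := splitMap_ket (ε := ε) ξ.2
  rw [splitMap, linearCombination_ket _ ξ.2] at this
  dsimp only
  rw [this]
  exact LinearMap.mem_range_self _ _

lemma splitMap_injective (hm : IsDominant n m) (ε : ℕ → ℤˣ) :
    Function.Injective (splitMap n m ε) := by
  -- discarding the vectors with a negative last entry in an even row is a left inverse
  have key : (Finsupp.linearCombination ℂ fun ξ : {ξ // IsClassicalTableau n m ξ} =>
      ket (IsTableau n m) ξ.1) ∘ₗ splitMap n m ε = LinearMap.id := by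
    refine hom_ext_ket fun ξ hξ => ?_
    have hξ' := ((isTableau_iff hm).1 hξ).1
    rw [LinearMap.comp_apply, splitMap, linearCombination_ket _ hξ, map_sum,
      sum_eq_single_of_mem ∅ (empty_mem_powerset _)]
    · rw [prod_empty, one_smul, flip_empty, linearCombination_ket _ hξ', LinearMap.id_apply]
    · intro S hS hne
      have hS := mem_powerset.1 hS
      rw [map_smul, linearCombination_ket _ (hξ'.flip hS)]
      dsimp only
      rw [ket_eq_zero (not_isTableau_flip hm hξ hS hne), smul_zero]
  exact Function.LeftInverse.injective (g := Finsupp.linearCombination ℂ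
    fun ξ : {ξ // IsClassicalTableau n m ξ} => ket (IsTableau n m) ξ.1) fun v => congr($key v)

end Split

/-! ### Intertwining -/

section Intertwining

variable {h : ℂ} {r : ℚ → ℂ} {n : ℕ} {m : ℕ → ℚ} {ε ε' : ℕ → ℤˣ} {ξ : ℕ → ℕ → ℚ} {k : ℕ}

lemma opT_ket_of_mem (hk : 1 ≤ k) (hξ : IsTableau n m ξ) :
    opT h r n m ε (k + 1) (ket (IsTableau n m) ξ) =
      (if Even k ∧ ξ k (k / 2) = 1 / 2 then
        sgn (ε (k + 1)) / (qPow h (1 / 2) - qPow h (-(1 / 2))) * coefD h (k / 2) ξ else 0) •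
          ket (IsTableau n m) ξ +
      ∑ x ∈ moves k, coef h r ε k x ξ • ket (IsTableau n m) (ξ + mv k x) := by
  rw [opT, linearCombination_ket _ hξ]
  obtain ⟨p, rfl | rfl⟩ := Nat.even_or_odd' k
  · rw [if_pos ⟨p, rfl⟩, show (2 * p + 1) / 2 = p by omega, oddPart_eq _ _ _ ε (by omega),
      Nat.add_sub_cancel, show 2 * p / 2 = p by omega]
    simp only [even_two_mul, true_and]
  · rw [if_neg (by simp [Nat.odd_add_one]), show (2 * p + 1 + 1) / 2 = p + 1 by omega,
      evenPart_eq _ _ _ _ (by omega), show 2 * (p + 1) - 1 = 2 * p + 1 by omega, if_neg (by simp),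
      zero_smul, zero_add]

/-- Beyond the tableaux of the nonclassical type the coefficient `A^p_{2p}` turns into `D_{2p}`. -/
lemma coef_eq_coefD (hr : ∀ a : ℚ, 0 ≤ a → r a ^ 2 = qNum h a) (hξ : IsClassicalTableau n m ξ)
    {p : ℕ} (hp : 1 ≤ p) (hpn : 2 * p + 1 ≤ n) (h1 : ξ (2 * p) p = 1 / 2) :
    coef h r ε (2 * p) (some (p, -1)) ξ =
      -(1 / (qPow h (1 / 2) - qPow h (-(1 / 2))) * coefD h p ξ) := by
  have hodd : ¬Odd (2 * p) := by simp
  have hc : ctr ξ (2 * p) p = 1 / 2 := by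
    rw [ctr, h1]
    push_cast
    ring
  have hsq : ∀ a : ℚ, 0 < a → r |a| * r |a| = qNum h a := fun a ha => by
    rw [← pow_two, abs_of_pos ha, hr a ha.le]
  have hpos : ∀ u ∈ adj (2 * p), 0 < ctr ξ u.1 u.2 := by
    rintro ⟨o, e⟩ hu
    obtain ⟨ho | ho, he, he'⟩ := (mem_adj (by omega)).1 hu
    · dsimp only at ho he he' ⊢
      subst ho
      obtain ⟨a1, a2, -⟩ := hξ.interlaces hpn he he' hp (by omega)
      linarith [a2 (by omega)]
    · dsimp only at ho he he' ⊢
      exact hξ.ctr_pos (by omega) ⟨p - 1, by omega⟩ he he'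
  have hlast : ∀ i ∈ (Icc 1 (2 * p / 2)).erase p, 1 / 2 < ctr ξ (2 * p) i := by
    intro i hi
    have h2 := mem_Icc.1 (mem_of_mem_erase hi)
    have h3 := ne_of_mem_erase hi
    have := hξ.abs_ctr_lt hpn h2.1 (show i < p by omega) (by omega)
    rwa [hc, abs_of_pos (by norm_num)] at this
  have hrt : rt (fun a => r |a|) ξ (2 * p) p (-(1 / 2)) = coefD h p ξ := by
    have e1 : rt (fun a => r |a|) ξ (2 * p) p (-(1 / 2)) =
        (∏ u ∈ adj (2 * p), qNum h (ctr ξ u.1 u.2)) / ∏ i ∈ (Icc 1 (2 * p / 2)).erase p,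
          qNum h (ctr ξ (2 * p) i + 1 / 2) * qNum h (ctr ξ (2 * p) i - 1 / 2) := by
      rw [rt]
      congr 1
      · refine prod_congr rfl fun u hu => ?_
        rw [← hsq _ (hpos u hu), add_assoc, neg_add_cancel, add_zero, sub_neg_eq_add,
          add_sub_cancel_right]
      · refine prod_congr rfl fun i hi => ?_
        have := hlast i hi
        rw [← hsq _ (show 0 < ctr ξ (2 * p) i + 1 / 2 by linarith),
          ← hsq _ (show 0 < ctr ξ (2 * p) i - 1 / 2 by linarith)]
        rw [show ctr ξ (2 * p) i + -(1 / 2) = ctr ξ (2 * p) i - 1 / 2 by ring,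
          show ctr ξ (2 * p) i - -(1 / 2) = ctr ξ (2 * p) i + 1 / 2 by ring,
          show ctr ξ (2 * p) i - 1 / 2 + 1 = ctr ξ (2 * p) i + 1 / 2 by ring,
          show ctr ξ (2 * p) i + 1 / 2 - 1 = ctr ξ (2 * p) i - 1 / 2 by ring]
        ring
    have e2 : (Icc 1 (2 * p / 2)).erase p = Icc 1 (p - 1) := by
      ext i
      simp only [mem_erase, mem_Icc]
      omega
    rw [e1, e2, prod_adj _ (by omega), coefD]
    simp only [lc_even, lc_odd, lc_odd' _ _ _ hp, add_sub_cancel_right]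
    rw [show (2 * p + 1) / 2 = p by omega, show (2 * p - 1) / 2 = p - 1 by omega]
  rw [coef, sc_neg_one, hc, wt, if_neg hodd, hrt, neg_neg, ← neg_sub (qPow h (1 / 2)),
    one_div_neg_eq_neg_one_div, neg_mul]

lemma chiOp_ket_flip {p : ℕ} (hp : 1 ≤ p) (hpn : 2 * p + 1 ≤ n) (ξ : ℕ → ℕ → ℚ) :
    chiOp n m ε (ket (IsClassicalTableau n m) (flip {p} ξ)) =
      -sgn (ε (2 * p + 1)) • chiOp n m ε (ket (IsClassicalTableau n m) ξ) := by
  have hS : ({p} : Finset ℕ) ⊆ Icc 1 ((n - 1) / 2) :=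
    singleton_subset_iff.2 (mem_Icc.2 ⟨hp, by omega⟩)
  rw [← flipOp_ket hS, ← Module.End.mul_apply, chiOp_mul_flipOp ε hS, LinearMap.smul_apply, chi,
    prod_singleton]

/-- The term with the factor `D_{2p}` is what remains, in a space on which the sign change acts by
the scalar `-ε_{2p+1}`, of the move from the last entry `1/2` to `-1/2`. -/
lemma opT'_comp_splitMap (hr : ∀ a : ℚ, 0 ≤ a → r a ^ 2 = qNum h a) (hm : IsDominant n m)
    (ε : ℕ → ℤˣ) (hk : 1 ≤ k) (hkn : k + 1 ≤ n) :
    opT' h r n m ε (k + 1) ∘ₗ splitMap n m ε = splitMap n m ε ∘ₗ opT h r n m ε (k + 1) := by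
  refine hom_ext_ket fun ξ hξ => ?_
  have hξ' := ((isTableau_iff hm).1 hξ).1
  have hregular : ∀ x ∈ moves k, ¬(Even k ∧ x = some (k / 2, -1) ∧ ξ k (k / 2) = 1 / 2) →
      chiOp n m ε (ket (IsClassicalTableau n m) (ξ + mv k x)) =
        splitMap n m ε (ket (IsTableau n m) (ξ + mv k x)) := by
    intro x hx hne
    by_cases h1 : IsTableau n m (ξ + mv k x)
    · rw [splitMap_ket h1]
    · rw [ket_eq_zero h1, ket_eq_zero fun h2 =>
        hne (add_mv_eq_flip_of_not_isTableau hm hξ hkn hx h2 h1), map_zero, map_zero]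
  rw [LinearMap.comp_apply, LinearMap.comp_apply, splitMap_ket hξ, ← Module.End.mul_apply,
    opT'_mul_chiOp hk, Module.End.mul_apply, opT'_ket_of_mem hk hξ', opT_ket_of_mem hk hξ, map_sum,
    map_add, map_smul, map_sum]
  simp only [map_smul]
  by_cases hc : Even k ∧ ξ k (k / 2) = 1 / 2
  · obtain ⟨p, rfl⟩ := even_iff_two_dvd.1 hc.1
    have h1 := hc.2
    rw [show 2 * p / 2 = p by omega] at h1
    have hmem : some (p, -1) ∈ moves (2 * p) := some_mem_moves.2 ⟨by omega, by omega⟩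
    have hnot : ¬IsTableau n m (ξ + mv (2 * p) (some (p, -1))) := by
      rw [add_mv_eq_flip h1]
      exact not_isTableau_flip hm hξ (singleton_subset_iff.2 (mem_Icc.2 ⟨by omega, by omega⟩))
        (singleton_ne_empty p)
    rw [if_pos hc, ← add_sum_erase _ _ hmem, ← add_sum_erase _ _ hmem, ket_eq_zero hnot, map_zero,
      smul_zero, zero_add, add_mv_eq_flip h1, chiOp_ket_flip (by omega) hkn,
      coef_eq_coefD hr hξ' (by omega) hkn h1, splitMap_ket hξ, smul_smul,
      show 2 * p / 2 = p by omega]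
    congr 1
    · congr 1
      ring
    · refine sum_congr rfl fun x hx => ?_
      rw [hregular x (mem_of_mem_erase hx)]
      rintro ⟨-, h2, -⟩
      rw [show 2 * p / 2 = p by omega] at h2
      exact ne_of_mem_erase hx h2
  · rw [if_neg hc, zero_smul, zero_add]
    refine sum_congr rfl fun x hx => ?_
    rw [hregular x hx fun h2 => hc ⟨h2.1, h2.2.2⟩]

/-- The classical representation only depends on the signs with even indices. -/
lemma opT'_congr (hεε : ∀ p, ε (2 * p) = ε' (2 * p)) (k : ℕ) :
    opT' h r n m ε k = opT' h r n m ε' k := by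
  rw [opT', opT']
  simp only [evenPart, hεε]

lemma withOdd_even (n : ℕ) (ε : ℕ → ℤˣ) (σ : Icc 1 ((n - 1) / 2) → ℤˣ) (p : ℕ) :
    withOdd n ε σ (2 * p) = ε (2 * p) := by
  rw [withOdd, dif_neg]
  rintro ⟨h1, -⟩
  exact Nat.not_odd_iff_even.2 (even_two_mul p) h1

lemma withOdd_odd (n : ℕ) (ε : ℕ → ℤˣ) (σ : Icc 1 ((n - 1) / 2) → ℤˣ) (p : Icc 1 ((n - 1) / 2)) :
    withOdd n ε σ (2 * (p : ℕ) + 1) = σ p := by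
  have h1 : (2 * (p : ℕ) + 1) / 2 = p := by omega
  rw [withOdd, dif_pos ⟨⟨p, rfl⟩, by rw [h1]; exact p.2⟩]
  congr 1
  exact Subtype.ext h1

lemma opT'_comp_splitMap_withOdd (hr : ∀ a : ℚ, 0 ≤ a → r a ^ 2 = qNum h a)
    (hm : IsDominant n m) (ε : ℕ → ℤˣ) (σ : Icc 1 ((n - 1) / 2) → ℤˣ) (k : Set.Icc 2 n) :
    opT' h r n m ε k ∘ₗ splitMap n m (withOdd n ε σ) =
      splitMap n m (withOdd n ε σ) ∘ₗ opT h r n m (withOdd n ε σ) k := by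
  obtain ⟨k, hk, hkn⟩ := k
  obtain ⟨k, rfl⟩ := Nat.exists_eq_add_of_le' (show 1 ≤ k by omega)
  dsimp only
  rw [opT'_congr fun p => (withOdd_even n ε σ p).symm]
  exact opT'_comp_splitMap hr hm _ (by omega) hkn

/-! ### The direct sum decomposition -/

lemma sgn_mul_sgn_of_ne {e e' : ℤˣ} (hne : e ≠ e') : sgn e * sgn e' = -1 := by
  rcases Int.units_eq_one_or e with rfl | rfl <;>
    rcases Int.units_eq_one_or e' with rfl | rfl <;> simp [sgn] at hne ⊢

lemma chiOp_mul_chiOp_of_ne (ε : ℕ → ℤˣ) {σ τ : Icc 1 ((n - 1) / 2) → ℤˣ} (hne : σ ≠ τ) :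
    chiOp n m (withOdd n ε σ) * chiOp n m (withOdd n ε τ) = 0 := by
  obtain ⟨p, hp⟩ := Function.ne_iff.1 hne
  rw [chiOp_mul_chiOp, prod_eq_zero p.2, zero_smul]
  rw [withOdd_odd, withOdd_odd, sgn_mul_sgn_of_ne hp, add_neg_cancel]

lemma chiOp_mul_chiOp_self (ε : ℕ → ℤˣ) : chiOp n m ε * chiOp n m ε =
    (2 : ℂ) ^ ((n - 1) / 2) • chiOp n m ε := by
  rw [chiOp_mul_chiOp]
  congr 1
  rw [prod_congr rfl fun p _ => by rw [sgn_mul_self, one_add_one_eq_two], prod_const, Nat.card_Icc,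
    Nat.add_sub_cancel]

lemma sum_chi_withOdd (ε : ℕ → ℤˣ) {S : Finset ℕ} (hS : S ⊆ Icc 1 ((n - 1) / 2)) :
    ∑ σ : Icc 1 ((n - 1) / 2) → ℤˣ, chi (withOdd n ε σ) S =
      if S = ∅ then (2 : ℂ) ^ ((n - 1) / 2) else 0 := by
  have h1 : ∀ σ : Icc 1 ((n - 1) / 2) → ℤˣ, chi (withOdd n ε σ) S =
      ∏ p : Icc 1 ((n - 1) / 2), if (p : ℕ) ∈ S then -sgn (σ p) else 1 := by
    intro σ
    rw [chi, ← inter_eq_right.2 hS, ← filter_mem_eq_inter, prod_filter, ← prod_coe_sort]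
    refine prod_congr rfl fun p _ => ?_
    rw [withOdd_odd, filter_mem_eq_inter, inter_eq_right.2 hS]
  have h2 : ∀ e : ℤˣ → ℂ, ∑ s : ℤˣ, e s = e 1 + e (-1) := fun e => by
    rw [show (univ : Finset ℤˣ) = {1, -1} from rfl, sum_pair (by decide)]
  simp only [h1]
  rw [← Fintype.prod_sum (fun (p : Icc 1 ((n - 1) / 2)) (s : ℤˣ) =>
    if (p : ℕ) ∈ S then -sgn s else 1)]
  simp only [h2]
  split_ifs with hS0
  · subst hS0
    simp [one_add_one_eq_two]
  · obtain ⟨p, hp⟩ := nonempty_iff_ne_empty.2 hS0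
    refine prod_eq_zero (mem_univ ⟨p, hS hp⟩) ?_
    simp [hp, sgn]

lemma sum_chiOp_withOdd (ε : ℕ → ℤˣ) : ∑ σ : Icc 1 ((n - 1) / 2) → ℤˣ,
    chiOp n m (withOdd n ε σ) = (2 : ℂ) ^ ((n - 1) / 2) • 1 := by
  simp only [chiOp]
  rw [sum_comm, sum_eq_single_of_mem ∅ (empty_mem_powerset _)]
  · rw [← sum_smul, sum_chi_withOdd ε (empty_subset _), if_pos rfl, flipOp_empty]
  · intro S hS hne
    rw [← sum_smul, sum_chi_withOdd ε (mem_powerset.1 hS), if_neg hne, zero_smul]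

/-- The operators `chiOp` of different characters annihilate each other, each is a multiple of a
projection, and their sum is a multiple of the identity. -/
theorem isInternal_range_splitMap (hm : IsDominant n m) (ε : ℕ → ℤˣ) :
    DirectSum.IsInternal fun σ : Icc 1 ((n - 1) / 2) → ℤˣ =>
      LinearMap.range (splitMap n m (withOdd n ε σ)) := by
  have h2 : (2 : ℂ) ^ ((n - 1) / 2) ≠ 0 := pow_ne_zero _ two_ne_zero
  rw [DirectSum.isInternal_submodule_iff_iSupIndep_and_iSup_eq_top]
  constructor
  · intro σ
    rw [Submodule.disjoint_def]
    intro v hv hv'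
    have h3 : chiOp n m (withOdd n ε σ) v = (2 : ℂ) ^ ((n - 1) / 2) • v := by
      obtain ⟨w, rfl⟩ := range_splitMap_le _ hv
      rw [← Module.End.mul_apply, chiOp_mul_chiOp_self, LinearMap.smul_apply]
    have h4 : (⨆ τ, ⨆ (_ : τ ≠ σ), LinearMap.range (splitMap n m (withOdd n ε τ))) ≤
        LinearMap.ker (chiOp n m (withOdd n ε σ)) := by
      refine iSup₂_le fun τ hτ => (range_splitMap_le _).trans ?_
      rintro _ ⟨w, rfl⟩
      rw [LinearMap.mem_ker, ← Module.End.mul_apply, chiOp_mul_chiOp_of_ne ε hτ.symm,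
        LinearMap.zero_apply]
    rw [LinearMap.mem_ker.1 (h4 hv')] at h3
    exact (smul_eq_zero.1 h3.symm).resolve_left h2
  · rw [eq_top_iff]
    have h3 : ∀ v : TabSpace (IsClassicalTableau n m),
        v = ((2 : ℂ) ^ ((n - 1) / 2))⁻¹ • ∑ σ : Icc 1 ((n - 1) / 2) → ℤˣ,
          chiOp n m (withOdd n ε σ) v := by
      intro v
      rw [← LinearMap.sum_apply, sum_chiOp_withOdd, LinearMap.smul_apply, Module.End.one_apply,
        inv_smul_smul₀ h2]
    intro v _
    rw [h3 v]
    refine Submodule.smul_mem _ _ (Submodule.sum_mem _ fun σ _ => ?_)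
    refine Submodule.mem_iSup_of_mem σ ?_
    induction v using Finsupp.induction_linear with
    | zero => rw [map_zero]; exact zero_mem _
    | add v w hv hw => rw [map_add]; exact add_mem (hv trivial) (hw trivial)
    | single ξ c =>
      have := chiOp_ket_mem_range hm (withOdd n ε σ) ξ.1
      rw [ket_eq_single ξ.2] at this
      rw [← Finsupp.smul_single_one, map_smul]
      exact Submodule.smul_mem _ _ this

end Intertwining

/-! ### Finite dimension, and the representations -/

section Finite

variable {n : ℕ} {m : ℕ → ℚ} {ξ : ℕ → ℕ → ℚ}

lemma IsDominant.anti_le (hm : IsDominant n m) {i j : ℕ} (hi : 1 ≤ i) (hij : i ≤ j)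
    (hj : j ≤ n / 2) : m j ≤ m i := by
  induction j, hij using Nat.le_induction with
  | base => exact le_rfl
  | succ j hij ih => exact (hm.anti j (by omega) (by omega)).trans (ih (by omega))

lemma IsDominant.half_le (hm : IsDominant n m) {j : ℕ} (hj : 1 ≤ j) (hj' : j ≤ n / 2) :
    1 / 2 ≤ m j := hm.last.trans (hm.anti_le hj hj' le_rfl)

/-- The tableau in which every row is an initial part of the top row. -/
lemma exists_isTableau (hm : IsDominant n m) : ∃ ξ, IsTableau n m ξ := by
  classical
  refine ⟨fun k j => if 2 ≤ k ∧ k ≤ n ∧ 1 ≤ j ∧ j ≤ k / 2 then m j else 0,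
    ⟨fun k j hkj => if_neg hkj, fun j hj hj' => if_pos (by omega), fun k j hk hkn hj hj' => ?_⟩,
    fun p j hp hj hjp => ?_, fun p j hp hj hjp => ?_, fun p hp hpn => ?_, fun p j hp hj hjp => ?_,
    fun p j hp hj hjp => ?_⟩
  · rw [if_pos (by omega)]
    exact hm.half j hj (by omega)
  · rw [if_pos (by omega), if_pos (by omega)]
  · rw [if_pos (by omega), if_pos (by omega)]
    exact hm.anti j hj (by omega)
  · rw [if_pos (by omega)]
    exact hm.half_le hp (by omega)
  · rw [if_pos (by omega), if_pos (by omega)]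
  · rw [if_pos (by omega), if_pos (by omega)]
    exact hm.anti j hj (by omega)

lemma IsClassicalTableau.abs_le (hm : IsDominant n m) (hξ : IsClassicalTableau n m ξ) {k : ℕ}
    (hk : 2 ≤ k) (hkn : k ≤ n) : ∀ j, 1 ≤ j → j ≤ k / 2 → |ξ k j| ≤ m 1 := by
  induction hkn using Nat.decreasingInduction with
  | self =>
    intro j hj hj'
    rw [hξ.top j hj hj', abs_of_nonneg (by linarith [hm.half_le hj hj'])]
    exact hm.anti_le le_rfl hj hj'
  | of_succ k hkn ih =>
    intro j hj hj'
    have ih := ih (by omega)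
    rw [_root_.abs_le]
    obtain ⟨p, rfl | rfl⟩ := Nat.even_or_odd' k
    · have h1 := _root_.abs_le.1 (ih j hj (by omega))
      refine ⟨?_, (hξ.odd_upper p j hkn hj (by omega)).trans h1.2⟩
      rcases Nat.lt_or_ge j p with hlt | hge
      · exact (_root_.abs_le.1 (ih (j + 1) (by omega) (by omega))).1.trans
          (hξ.odd_lower p j hkn hj hlt)
      · obtain rfl : j = p := by omega
        exact (neg_le_neg h1.2).trans (hξ.odd_last j hj hkn)
    · have h1 := _root_.abs_le.1 (ih j hj (by omega))
      have h2 := _root_.abs_le.1 (ih (j + 1) (by omega) (by omega))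
      have h3 := hξ.even_upper (p + 1) j hkn hj (by omega)
      rw [show 2 * (p + 1) - 1 = 2 * p + 1 by omega] at h3
      refine ⟨?_, h3.trans h1.2⟩
      rcases Nat.lt_or_ge (j + 1) (p + 1) with hlt | hge
      · exact h2.1.trans (hξ.even_lower (p + 1) j hkn hj hlt)
      · obtain rfl : j = p := by omega
        have h4 := hξ.even_last (j + 1) (by omega) hkn
        exact h2.1.trans ((le_abs_self _).trans h4)

lemma finite_isClassicalTableau (hn : 2 ≤ n) (hm : IsDominant n m) :
    {ξ : ℕ → ℕ → ℚ | IsClassicalTableau n m ξ}.Finite := by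
  refine Set.Finite.of_injOn (f := fun ξ (a : Fin (n + 1) × Fin (n + 1)) => ⌊ξ a.1 a.2⌋)
    (t := Set.pi Set.univ fun _ => Set.Icc ⌊-m 1⌋ ⌊m 1⌋) (fun ξ hξ => ?_) (fun ξ hξ η hη hξη => ?_)
    (Set.Finite.pi fun _ => Set.finite_Icc _ _)
  · rintro ⟨k, j⟩ -
    have h1 : |ξ k j| ≤ m 1 := by
      by_cases hkj : 2 ≤ (k : ℕ) ∧ (k : ℕ) ≤ n ∧ 1 ≤ (j : ℕ) ∧ (j : ℕ) ≤ k / 2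
      · exact hξ.abs_le hm hkj.1 hkj.2.1 _ hkj.2.2.1 hkj.2.2.2
      · rw [hξ.zero _ _ hkj, abs_zero]
        linarith [hm.half_le le_rfl (show 1 ≤ n / 2 by omega)]
    obtain ⟨h2, h3⟩ := _root_.abs_le.1 h1
    exact ⟨Int.floor_le_floor h2, Int.floor_le_floor h3⟩
  · ext k j
    by_cases hkj : 2 ≤ k ∧ k ≤ n ∧ 1 ≤ j ∧ j ≤ k / 2
    · have h1 := congrFun hξη (⟨k, by omega⟩, ⟨j, by omega⟩)
      obtain ⟨z, hz⟩ := hξ.half k j hkj.1 hkj.2.1 hkj.2.2.1 hkj.2.2.2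
      obtain ⟨w, hw⟩ := hη.half k j hkj.1 hkj.2.1 hkj.2.2.1 hkj.2.2.2
      have hfl : ∀ z : ℤ, ⌊(z : ℚ) + 1 / 2⌋ = z := fun z => by
        rw [Int.floor_eq_iff]
        constructor <;> linarith
      dsimp only at h1
      rw [hz, hw, hfl, hfl] at h1
      rw [hz, hw, h1]
    · rw [hξ.zero k j hkj, hη.zero k j hkj]

end Finite

/-- Operators that satisfy the relations define a unique representation. -/
lemma SatisfiesRelations.existsUnique_algHom {q : ℂ} {n : ℕ} {A : Type*} [Ring A] [Algebra ℂ A]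
    {X : Set.Icc 2 n → A} (hX : SatisfiesRelations q n X) :
    ∃! T : Uq q n →ₐ[ℂ] A, ∀ k, T (Uq.gen q n k) = X k := by
  have hrel : ∀ ⦃a b⦄, UqRel q n a b → FreeAlgebra.lift ℂ X a = FreeAlgebra.lift ℂ X b := by
    intro a b hab
    induction hab with
    | cubic_left i j hij => simpa using hX.cubic_left i j hij
    | cubic_right i j hij => simpa using hX.cubic_right i j hij
    | comm i j hij => simpa using hX.comm i j hij
  refine ⟨RingQuot.liftAlgHom ℂ ⟨FreeAlgebra.lift ℂ X, hrel⟩, fun k => ?_, fun T hT => ?_⟩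
  · rw [Uq.gen, RingQuot.liftAlgHom_mkAlgHom_apply, FreeAlgebra.lift_ι_apply]
  · refine RingQuot.ringQuot_ext' ℂ _ _ (FreeAlgebra.hom_ext (funext fun k => ?_))
    have := hT k
    rw [Uq.gen] at this
    simp [this]

/-- The relations pass to an invariant subspace, given as the range of an injective map. -/
lemma SatisfiesRelations.of_injective {q : ℂ} {n : ℕ} {V W : Type*} [AddCommGroup V] [Module ℂ V]
    [AddCommGroup W] [Module ℂ W] {X : Set.Icc 2 n → Module.End ℂ V}
    {Y : Set.Icc 2 n → Module.End ℂ W} (hY : SatisfiesRelations q n Y) (F : V →ₗ[ℂ] W)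
    (hF : Function.Injective F) (hXY : ∀ k, Y k ∘ₗ F = F ∘ₗ X k) : SatisfiesRelations q n X := by
  have h1 : ∀ k v, F (X k v) = Y k (F v) := fun k v => (congr($(hXY k) v)).symm
  constructor
  · intro i j hij
    ext v
    apply hF
    have := congr($(hY.cubic_left i j hij) (F v))
    simpa [pow_two, h1] using this
  · intro i j hij
    ext v
    apply hF
    have := congr($(hY.cubic_right i j hij) (F v))
    simpa [pow_two, h1] using this
  · intro i j hij
    ext v
    apply hF
    have := congr($(hY.comm i j hij) (F v))
    simpa [h1] using this

section Representations

variable {h : ℂ} {r : ℚ → ℂ} {n : ℕ} {m : ℕ → ℚ}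

lemma nontrivial_tabSpace (hm : IsDominant n m) : Nontrivial (TabSpace (IsTableau n m)) := by
  obtain ⟨ξ, hξ⟩ := exists_isTableau hm
  exact ⟨⟨Finsupp.single ⟨ξ, hξ⟩ 1, 0, by simp⟩⟩

theorem satisfiesRelations_opT (hq : ∀ k : ℕ, 0 < k → Complex.exp h ^ k ≠ 1)
    (hr : ∀ a : ℚ, 0 ≤ a → r a ^ 2 = qNum h a) (hm : IsDominant n m) (ε : ℕ → ℤˣ) :
    SatisfiesRelations (Complex.exp h) n (fun k : Set.Icc 2 n => opT h r n m ε k) := by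
  refine (satisfiesRelations_opT' hq hr n m ε).of_injective (splitMap n m ε)
    (splitMap_injective hm ε) ?_
  rintro ⟨k, hk, hkn⟩
  obtain ⟨k, rfl⟩ := Nat.exists_eq_add_of_le' (show 1 ≤ k by omega)
  exact opT'_comp_splitMap hr hm ε (by omega) hkn

/-- One of the `2^⌊(n-1)/2⌋ ≥ 2` summands is a proper invariant subspace. -/
theorem exists_invariant_submodule (hr : ∀ a : ℚ, 0 ≤ a → r a ^ 2 = qNum h a)
    (hm : IsDominant n m) (ε : ℕ → ℤˣ) (hn : 3 ≤ n) :
    ∃ W : Submodule ℂ (TabSpace (IsClassicalTableau n m)),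
      W ≠ ⊥ ∧ W ≠ ⊤ ∧ ∀ k : Set.Icc 2 n, ∀ v ∈ W, opT' h r n m ε k v ∈ W := by
  have hne : ∀ σ : Icc 1 ((n - 1) / 2) → ℤˣ,
      LinearMap.range (splitMap n m (withOdd n ε σ)) ≠ ⊥ := by
    intro σ hbot
    obtain ⟨v, hv⟩ := @exists_ne _ (nontrivial_tabSpace hm) 0
    refine hv (splitMap_injective hm (withOdd n ε σ) ?_)
    rw [map_zero, LinearMap.range_eq_bot.1 hbot, LinearMap.zero_apply]
  have hστ : (1 : Icc 1 ((n - 1) / 2) → ℤˣ) ≠ fun _ => -1 := fun h1 => by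
    have := congrFun h1 ⟨1, mem_Icc.2 ⟨le_rfl, by omega⟩⟩
    simp at this
  refine ⟨_, hne 1, fun htop => ?_, ?_⟩
  · have := (isInternal_range_splitMap hm ε).submodule_iSupIndep.pairwiseDisjoint hστ
    rw [Function.onFun, htop, top_disjoint] at this
    exact hne _ this
  · rintro k _ ⟨v, rfl⟩
    have := congr($(opT'_comp_splitMap_withOdd hr hm ε 1 k) v)
    rw [LinearMap.comp_apply, LinearMap.comp_apply] at this
    rw [this]
    exact LinearMap.mem_range_self _ _

end Representations

end QSo

theorem mainTheorem1 (h : ℂ) (hq : ∀ k : ℕ, 0 < k → Complex.exp h ^ k ≠ 1)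
    (r : ℚ → ℂ) (hr : ∀ a : ℚ, 0 ≤ a → r a ^ 2 = QSo.qNum h a)
    (n : ℕ) (hn : 2 ≤ n) (m : ℕ → ℚ) (hm : QSo.IsDominant n m) (ε : ℕ → ℤˣ) :
    -- the coefficients `A`, `B` are square roots of the expressions under the root signs
    ((∀ ξ p j, 2 * p + 1 ≤ n → 1 ≤ j → j ≤ p → QSo.IsClassicalTableau n m ξ →
        QSo.IsClassicalTableau n m (QSo.shift ξ (2 * p) j 1) →
        QSo.coefA r p j ξ ^ 2 = QSo.exprA (QSo.qNum h) p j ξ) ∧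
      (∀ ξ p j, 2 * p ≤ n → 1 ≤ j → j < p → QSo.IsClassicalTableau n m ξ →
        QSo.IsClassicalTableau n m (QSo.shift ξ (2 * p - 1) j 1) →
        QSo.coefB r p j ξ ^ 2 = QSo.exprB (QSo.qNum h) p j ξ)) ∧
    -- the operators `T_{ε,𝐦_n}` define a nonzero finite-dimensional representation
    (FiniteDimensional ℂ (QSo.TabSpace (QSo.IsTableau n m)) ∧
      Nontrivial (QSo.TabSpace (QSo.IsTableau n m)) ∧
      QSo.SatisfiesRelations (Complex.exp h) n
        (fun k : Set.Icc 2 n => QSo.opT h r n m ε k) ∧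
      ∃! T : QSo.Uq (Complex.exp h) n →ₐ[ℂ] Module.End ℂ (QSo.TabSpace (QSo.IsTableau n m)),
        ∀ k : Set.Icc 2 n, T (QSo.Uq.gen (Complex.exp h) n k) = QSo.opT h r n m ε k) ∧
    -- so do the operators `T'_{𝐦_n}`, and that representation is reducible
    (FiniteDimensional ℂ (QSo.TabSpace (QSo.IsClassicalTableau n m)) ∧
      QSo.SatisfiesRelations (Complex.exp h) n
        (fun k : Set.Icc 2 n => QSo.opT' h r n m ε k) ∧
      (∃! T : QSo.Uq (Complex.exp h) n →ₐ[ℂ]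
          Module.End ℂ (QSo.TabSpace (QSo.IsClassicalTableau n m)),
        ∀ k : Set.Icc 2 n, T (QSo.Uq.gen (Complex.exp h) n k) = QSo.opT' h r n m ε k) ∧
      (3 ≤ n → ∃ W : Submodule ℂ (QSo.TabSpace (QSo.IsClassicalTableau n m)),
        W ≠ ⊥ ∧ W ≠ ⊤ ∧ ∀ k : Set.Icc 2 n, ∀ v ∈ W, QSo.opT' h r n m ε k v ∈ W)) ∧
    -- it splits into invariant subspaces, one for each choice of the signs `ε_{2p+1}`, on which
    -- it acts by the formulas for `T_{ε,𝐦_n}`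
    DirectSum.IsInternal (fun σ : Finset.Icc 1 ((n - 1) / 2) → ℤˣ =>
      LinearMap.range (QSo.splitMap n m (QSo.withOdd n ε σ))) ∧
    ∀ σ : Finset.Icc 1 ((n - 1) / 2) → ℤˣ,
      Function.Injective (QSo.splitMap n m (QSo.withOdd n ε σ)) ∧
      ∀ k : Set.Icc 2 n,
        QSo.opT' h r n m ε k ∘ₗ QSo.splitMap n m (QSo.withOdd n ε σ) =
          QSo.splitMap n m (QSo.withOdd n ε σ) ∘ₗ QSo.opT h r n m (QSo.withOdd n ε σ) k := by
  have hT' := QSo.satisfiesRelations_opT' hq hr n m ε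
  have hT := QSo.satisfiesRelations_opT hq hr hm ε
  have hfin := QSo.finite_isClassicalTableau hn hm
  have hfin' : {ξ : ℕ → ℕ → ℚ | QSo.IsTableau n m ξ}.Finite :=
    hfin.subset fun ξ hξ => ((QSo.isTableau_iff hm).1 hξ).1
  have : Finite {ξ : ℕ → ℕ → ℚ // QSo.IsClassicalTableau n m ξ} := hfin.to_subtype
  have : Finite {ξ : ℕ → ℕ → ℚ // QSo.IsTableau n m ξ} := hfin'.to_subtype
  exact ⟨⟨fun ξ p j hp hj hjp hξ _ => QSo.coefA_sq hr hp hj hjp hξ,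
      fun ξ p j hp hj hjp hξ _ => QSo.coefB_sq hr hp hj hjp hξ⟩,
    ⟨inferInstance, QSo.nontrivial_tabSpace hm, hT, hT.existsUnique_algHom⟩,
    ⟨inferInstance, hT', hT'.existsUnique_algHom, QSo.exists_invariant_submodule hr hm ε⟩,
    QSo.isInternal_range_splitMap hm ε, fun σ => ⟨QSo.splitMap_injective hm _,
      QSo.opT'_comp_splitMap_withOdd hr hm ε σ⟩⟩
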